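/- Let $k\ge 2$ and let $\varepsilon\in\{1,-1\}$. All objects are germs at the origin of the plane $\mathbb R^2$ with coordinates $(x,\xi)$. Let $H$ be a real-analytic function with an $A_{k-1}$ singularity of sign $\varepsilon$ at the origin, i.e. $H\circ\varphi=\xi^2+\varepsilon x^k$ for some real-analytic diffeomorphism germ $\varphi$ of $(\mathbb R^2,0)$, and let $\omega$ be a real-analytic symplectic form. A pair $(H_0,\omega_0)$ is equivalent to $(H_1,\omega_1)$ if $\psi^*H_0=H_1$ and $\psi^*\omega_0=\omega_1$ for a real-analytic diffeomorphism germ $\psi$ of $(\mathbb R^2,0)$, and orientedly equivalent to it if $\psi$ can be chosen orientation-preserving. Then: 1. Every such pair $(H,\omega)$ is orientedly equivalent to a normal form $$\Big(H_k=\xi^2+\varepsilon x^k,\quad \omega_{\tilde c}=\sum_{i=0}^{k-2}x^i\,\tilde c_i(H_k)\,d\xi\wedge dx\Big)$$ with functions $\tilde c_0,\dots,\tilde c_{k-2}$ of one variable that are real-analytic at $0$ and satisfy $\tilde c_0(0)\neq0$. 2. For fixed $\varepsilon$, the germs at $0$ of the functions $\tilde c_i$ (equivalently, their Taylor series) in 1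 are determined by $(H,\omega)$ uniquely if $k$ is odd, and, if $k$ is even, exactly up to simultaneously changing the sign of all the odd-indexed functions $\tilde c_{2i+1}$: the tuple obtained by this sign change also gives a normal form of $(H,\omega)$, and there are no others. 3. The $\tilde c_i$ form a complete set of invariants: two pairs as above, with the same $k$ and $\varepsilon$, are orientedly equivalent if and only if the tuples in their normal forms have the same germs, or $k$ is even and they have the same germs after simultaneously changing the sign of all the odd-indexed functions of one of them. 4. There are no further restrictions on the invariants: every tuple $(\tilde c_0,\dots,\tilde c_{k-2})$ of functions analytic at $0$ with $\tilde c_0(0)\ne0$ occurs, namely for the pair $(H_k,\omega_{\tilde c})$ itself, which is a pair as above. 5. If orientation-reversing diffeomorphism germs are also allowed, the only additional relation is the simultaneous change of sign of all the $\tilde c_i$: two pairs as above, with the same $k$ and $\varepsilon$ and with tuples $\tilde c$ and $\tilde d$ in normal forms as in 1, are equivalent if and only if $\tilde d$ has the same germs as $\tilde c$ or as $-\tilde c$, up to the sign change of the odd-indexed functions if $k$ is even. -/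

import Mathlib

open Filter Topology

noncomputable section

namespace ASing

/-- The plane `ℝ²`; a point `p` has coordinates `x = p.1` and `ξ = p.2`.
Functions, maps and forms below represent germs at the origin. -/
abbrev Plane : Type := ℝ × ℝ

/-- Differential `2`-forms on the plane. -/
abbrev TwoForm : Type := Plane → Plane [⋀^Fin 2]→L[ℝ] ℝ

/-- `ψ` represents a germ in `Diff(ℝ², 0)` in the real-analytic category: it is analytic at the
origin, fixes the origin, and has an analytic inverse germ. -/
def IsDiffeoGerm (ψ : Plane → Plane) : Prop :=
  AnalyticAt ℝ ψ 0 ∧ ψ 0 = 0 ∧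
    ∃ φ : Plane → Plane, AnalyticAt ℝ φ 0 ∧ φ 0 = 0 ∧
      (∀ᶠ p in 𝓝 (0 : Plane), φ (ψ p) = p) ∧ (∀ᶠ p in 𝓝 (0 : Plane), ψ (φ p) = p)

/-- The germ of `ψ` preserves the orientation of the plane. -/
def PreservesOrientation (ψ : Plane → Plane) : Prop :=
  0 < (fderiv ℝ ψ 0).det

/-- The pull-back `ψ^* ω`. -/
def pullback (ψ : Plane → Plane) (ω : TwoForm) : TwoForm :=
  fun p => (ω (ψ p)).compContinuousLinearMap (fderiv ℝ ψ p)

/-- The constant form `dξ ∧ dx`. -/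
def dXiDx : Plane [⋀^Fin 2]→L[ℝ] ℝ where
  toFun v := (v 0).2 * (v 1).1 - (v 0).1 * (v 1).2
  map_update_add' := by
    intro _ m i x y
    fin_cases i <;> simp [Function.update] <;> ring
  map_update_smul' := by
    intro _ m i c x
    fin_cases i <;> simp [Function.update] <;> ring
  map_eq_zero_of_eq' := by
    intro v i j h hij
    fin_cases i <;> fin_cases j <;> simp_all <;> ring
  cont := by fun_prop

theorem dXiDx_apply (v : Fin 2 → Plane) :
    dXiDx v = (v 0).2 * (v 1).1 - (v 0).1 * (v 1).2 := rfl

/-- The model Hamiltonian `ξ² + ε x^k`, where `ε = 1` or `ε = -1`. -/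
def modelH (k : ℕ) (ε : ℝ) : Plane → ℝ :=
  fun p => p.2 ^ 2 + ε * p.1 ^ k

/-- `H` has a singularity of type `A_{k-1}` at the origin, with sign `ε`: in suitable local
real-analytic coordinates `(x, ξ)` centred at the origin, `H = ξ² + ε x^k`. -/
def HasASingularity (k : ℕ) (ε : ℝ) (H : Plane → ℝ) : Prop :=
  ∃ φ : Plane → Plane, IsDiffeoGerm φ ∧ (H ∘ φ) =ᶠ[𝓝 0] modelH k ε

/-- `ω` represents a germ at the origin of a real-analytic symplectic form
(non-degeneracy at the origin implies it at all nearby points). -/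
def IsSymplecticGerm (ω : TwoForm) : Prop :=
  AnalyticAt ℝ ω 0 ∧ (∀ᶠ p in 𝓝 (0 : Plane), extDeriv ω p = 0) ∧
    ∀ v : Plane, v ≠ 0 → ∃ w : Plane, ω 0 ![v, w] ≠ 0

/-- A real-analytic Hamiltonian germ with an `A_{k-1}` singularity (of sign `ε`) together with a
real-analytic symplectic form germ. -/
def IsASystem (k : ℕ) (ε : ℝ) (H : Plane → ℝ) (ω : TwoForm) : Prop :=
  AnalyticAt ℝ H 0 ∧ HasASingularity k ε H ∧ IsSymplecticGerm ω

/-- `(H₀, ω₀)` and `(H₁, ω₁)` lie in the same orbit of `Diff(ℝ², 0)`: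
`(ψ^* H₀, ψ^* ω₀) = (H₁, ω₁)` as germs. -/
def Equivalent (H₀ : Plane → ℝ) (ω₀ : TwoForm) (H₁ : Plane → ℝ) (ω₁ : TwoForm) : Prop :=
  ∃ ψ : Plane → Plane, IsDiffeoGerm ψ ∧
    (H₀ ∘ ψ) =ᶠ[𝓝 0] H₁ ∧ pullback ψ ω₀ =ᶠ[𝓝 0] ω₁

/-- The same for the subgroup of orientation-preserving diffeomorphism germs. -/
def OrientedEquivalent (H₀ : Plane → ℝ) (ω₀ : TwoForm) (H₁ : Plane → ℝ) (ω₁ : TwoForm) : Prop :=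
  ∃ ψ : Plane → Plane, IsDiffeoGerm ψ ∧ PreservesOrientation ψ ∧
    (H₀ ∘ ψ) =ᶠ[𝓝 0] H₁ ∧ pullback ψ ω₀ =ᶠ[𝓝 0] ω₁

/-- The form `∑_{i=0}^{k-2} x^i c_i(H) dξ ∧ dx` with `H = ξ² + ε x^k`. Only the functions `c i`
with `i < k - 1` matter. -/
def normalForm (k : ℕ) (ε : ℝ) (c : ℕ → ℝ → ℝ) : TwoForm :=
  fun p => (∑ i ∈ Finset.range (k - 1), p.1 ^ i * c i (modelH k ε p)) • dXiDx

/-- `c_0, …, c_{k-2}` are real-analytic at `0` and `c_0(0) ≠ 0`. -/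
def Admissible (k : ℕ) (c : ℕ → ℝ → ℝ) : Prop :=
  (∀ i < k - 1, AnalyticAt ℝ (c i) 0) ∧ c 0 0 ≠ 0

/-- `c` is an admissible tuple of coefficients of a normal form of `(H, ω)`. -/
def HasNormalForm (k : ℕ) (ε : ℝ) (H : Plane → ℝ) (ω : TwoForm) (c : ℕ → ℝ → ℝ) : Prop :=
  Admissible k c ∧ OrientedEquivalent H ω (modelH k ε) (normalForm k ε c)

/-- The tuples `c` and `d` have the same germs at `0`, or `k` is even and they have the same germs
after changing simultaneously the sign of all odd-indexed functions. -/
def SameInvariants (k : ℕ) (c d : ℕ → ℝ → ℝ) : Prop :=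
  (∀ i < k - 1, d i =ᶠ[𝓝 0] c i) ∨
    (Even k ∧ ∀ i < k - 1, d i =ᶠ[𝓝 0] fun h => (-1) ^ i * c i h)

end ASing

end

noncomputable section

namespace ASing

/-! ### Expansions of analytic functions of two variables -/

/-! In suitable coordinates H = ξ² + εx^k and ω = f dξ∧dx, so only the function f and the symmetries
of H matter. Let D = 2ξ∂_x − εk x^(k−1)∂_ξ be the derivative along the Hamiltonian field (`hamD` on
functions, `ham` on germs).

Existence rests on two facts. Every analytic f equals Σ x^i c_i(H) + Dη (`exists_normal_add_hamD`):
in the coordinates (x, H) the part odd in ξ is integrated in x, and the even part is handled by a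
coefficient recursion whose solution still converges. The term Dη is then removed by an explicit map
(`exists_level_preserving_diffeo`): the flow Φ of the field D/f preserves both H and f dξ∧dx, and p
↦ Φ(η(0) − η(p), p) preserves H and pulls f dξ∧dx back to (f − Dη) dξ∧dx. No homotopy of forms is
needed, only a flow analytic in time and initial point (`exists_analytic_flow`).

For uniqueness, the linear functionals `ell k ε i j` combine Taylor coefficients of a single weight.
They vanish on the image of D (`ell_ham`), and multiplication by H acts on them by a shift of j and
a nonzero factor (`ell_hamiltonian_mul`), so on Σ x^l c_l(H) they read off the j-th Taylor
coefficient of c_i. If ψ = (u, v) preserves H, its pull-back replaces x^l by u^l Jac ψ. The Euler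
field and its transport by ψ both multiply H by 2k, so they differ by a multiple of the Hamiltonian
field; hence u^l Jac ψ is homogeneous of the weight of x^l modulo the image of D
(`exists_euler_pow_mul_jacobian`). It follows that coefficients c and d of normal forms related by ψ
satisfy d_i = u_x(0)^i Jac ψ(0) c_i.

Finally Jac ψ(0) = ±1, and u_x(0)^k = 1 for k ≥ 3 (`symmetry_linear_part`), so u_x(0) is 1 for odd k
and ±1 for even k; for k = 2 only i = 0 occurs. The linear maps (x, ξ) ↦ (±x, ±ξ) that preserve H
realise all the remaining signs. -/

/-- The coefficients `a m n` grow at most geometrically. -/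
def GeomBound (a : ℕ → ℕ → ℝ) : Prop :=
  ∃ C R : ℝ, 0 ≤ C ∧ 1 ≤ R ∧ ∀ m n, |a m n| ≤ C * R ^ (m + n)

/-- Near the origin `f` is the sum of the double power series with coefficients `a m n`. -/
def HasExpansion (a : ℕ → ℕ → ℝ) (f : Plane → ℝ) : Prop :=
  GeomBound a ∧
    ∀ᶠ p in 𝓝 (0 : Plane), HasSum (fun q : ℕ × ℕ => a q.1 q.2 * p.1 ^ q.1 * p.2 ^ q.2) (f p)

theorem eventually_abs_lt {δ : ℝ} (hδ : 0 < δ) :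
    ∀ᶠ p in 𝓝 (0 : Plane), |p.1| < δ ∧ |p.2| < δ := by
  filter_upwards [Metric.ball_mem_nhds (0 : Plane) hδ] with p hp
  rw [mem_ball_zero_iff, Prod.norm_def, max_lt_iff] at hp
  simpa using hp

theorem summable_geometric_prod {r s : ℝ} (hr : 0 ≤ r) (hr1 : r < 1) (hs : 0 ≤ s) (hs1 : s < 1) :
    Summable fun q : ℕ × ℕ => r ^ q.1 * s ^ q.2 :=
  (summable_geometric_of_lt_one hr hr1).mul_of_nonneg (summable_geometric_of_lt_one hs hs1)
    (fun _ => by positivity) (fun _ => by positivity)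

theorem abs_term_le {a : ℕ → ℕ → ℝ} {C R : ℝ} (hC : 0 ≤ C) (hR : 1 ≤ R)
    (ha : ∀ m n, |a m n| ≤ C * R ^ (m + n)) {δ x y : ℝ} (hx : |x| ≤ δ) (hy : |y| ≤ δ) (m n : ℕ) :
    |a m n * x ^ m * y ^ n| ≤ C * ((R * δ) ^ m * (R * δ) ^ n) := by
  have hδ : 0 ≤ δ := (abs_nonneg x).trans hx
  rw [abs_mul, abs_mul, abs_pow, abs_pow]
  calc |a m n| * |x| ^ m * |y| ^ n ≤ (C * R ^ (m + n)) * δ ^ m * δ ^ n := by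
        gcongr
        exact ha m n
    _ = _ := by rw [pow_add, mul_pow, mul_pow]; ring

theorem summable_term {a : ℕ → ℕ → ℝ} {C R : ℝ} (hC : 0 ≤ C) (hR : 1 ≤ R)
    (ha : ∀ m n, |a m n| ≤ C * R ^ (m + n)) {δ x y : ℝ} (hδ : R * δ < 1)
    (hx : |x| ≤ δ) (hy : |y| ≤ δ) :
    Summable fun q : ℕ × ℕ => a q.1 q.2 * x ^ q.1 * y ^ q.2 := by
  have hδ0 : 0 ≤ δ := (abs_nonneg x).trans hx
  have h0 : 0 ≤ R * δ := by positivity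
  refine Summable.of_norm_bounded ((summable_geometric_prod h0 hδ h0 hδ).mul_left C) fun q => ?_
  exact abs_term_le hC hR ha hx hy q.1 q.2

theorem GeomBound.exists_hasExpansion {a : ℕ → ℕ → ℝ} (ha : GeomBound a) :
    ∃ f, HasExpansion a f := by
  refine ⟨fun p => ∑' q : ℕ × ℕ, a q.1 q.2 * p.1 ^ q.1 * p.2 ^ q.2, ha, ?_⟩
  obtain ⟨C, R, hC, hR, h⟩ := ha
  have hR0 : 0 < R := by linarith
  filter_upwards [eventually_abs_lt (show (0 : ℝ) < 1 / (2 * R) by positivity)] with p hp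
  refine (summable_term hC hR h (δ := 1 / (2 * R)) ?_ hp.1.le hp.2.le).hasSum
  field_simp; norm_num

theorem HasExpansion.eventuallyEq {a : ℕ → ℕ → ℝ} {f g : Plane → ℝ} (hf : HasExpansion a f)
    (hg : HasExpansion a g) : f =ᶠ[𝓝 0] g := by
  filter_upwards [hf.2, hg.2] with p h1 h2 using h1.unique h2

/-- The normalisation `1 ≤ R` in `GeomBound` makes powers of `R` monotone in the exponent. Passing
to `max R 1` frees later estimates from having to arrange it. -/
theorem GeomBound.of_le {a : ℕ → ℕ → ℝ} {C R : ℝ}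
    (h : ∀ m n, |a m n| ≤ C * R ^ (m + n)) (hC : 0 ≤ C) (hR : 0 ≤ R) : GeomBound a := by
  refine ⟨C, max R 1, hC, le_max_right _ _, fun m n => (h m n).trans ?_⟩
  gcongr
  exact le_max_left _ _

theorem GeomBound.add {a b : ℕ → ℕ → ℝ} (ha : GeomBound a) (hb : GeomBound b) :
    GeomBound fun m n => a m n + b m n := by
  obtain ⟨C, R, hC, hR, h⟩ := ha
  obtain ⟨C', R', hC', hR', h'⟩ := hb
  have h0 : 0 ≤ R := by linarith
  have h0' : 0 ≤ R' := by linarith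
  refine GeomBound.of_le (C := C + C') (R := max R R') (fun m n => ?_) (by positivity)
    (le_max_of_le_left h0)
  calc |a m n + b m n| ≤ |a m n| + |b m n| := abs_add_le _ _
    _ ≤ C * R ^ (m + n) + C' * R' ^ (m + n) := add_le_add (h m n) (h' m n)
    _ ≤ C * (max R R') ^ (m + n) + C' * (max R R') ^ (m + n) := by
        gcongr
        · exact le_max_left _ _
        · exact le_max_right _ _
    _ = _ := by ring

theorem GeomBound.const_mul {a : ℕ → ℕ → ℝ} (ha : GeomBound a) (c : ℝ) :
    GeomBound fun m n => c * a m n := by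
  obtain ⟨C, R, hC, hR, h⟩ := ha
  refine ⟨|c| * C, R, by positivity, hR, fun m n => ?_⟩
  rw [abs_mul, mul_assoc]
  gcongr
  exact h m n

theorem HasExpansion.add {a b : ℕ → ℕ → ℝ} {f g : Plane → ℝ} (hf : HasExpansion a f)
    (hg : HasExpansion b g) : HasExpansion (fun m n => a m n + b m n) fun p => f p + g p := by
  refine ⟨hf.1.add hg.1, ?_⟩
  filter_upwards [hf.2, hg.2] with p h1 h2
  simpa only [add_mul] using h1.add h2

theorem HasExpansion.const_mul {a : ℕ → ℕ → ℝ} {f : Plane → ℝ} (hf : HasExpansion a f) (c : ℝ) :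
    HasExpansion (fun m n => c * a m n) fun p => c * f p := by
  refine ⟨hf.1.const_mul c, ?_⟩
  filter_upwards [hf.2] with p h1
  simpa only [mul_assoc] using h1.mul_left c

theorem HasExpansion.finsetSum {ι : Type*} (s : Finset ι) {a : ι → ℕ → ℕ → ℝ}
    {f : ι → Plane → ℝ} (h : ∀ i ∈ s, HasExpansion (a i) (f i)) :
    HasExpansion (fun m n => ∑ i ∈ s, a i m n) fun p => ∑ i ∈ s, f i p := by
  classical
  induction s using Finset.induction_on with
  | empty =>
    refine ⟨⟨0, 1, le_rfl, le_rfl, by simp⟩, Eventually.of_forall fun p => ?_⟩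
    simp
  | insert i s hi ih =>
    simp only [Finset.sum_insert hi]
    exact (h i (Finset.mem_insert_self _ _)).add
      (ih fun j hj => h j (Finset.mem_insert_of_mem hj))

/-- Multiplication by the monomial `x ^ k * y ^ l` shifts the coefficients. -/
theorem HasExpansion.monomial_mul {a : ℕ → ℕ → ℝ} {f : Plane → ℝ} (hf : HasExpansion a f)
    (k l : ℕ) :
    HasExpansion (fun m n => if k ≤ m ∧ l ≤ n then a (m - k) (n - l) else 0)
      fun p => p.1 ^ k * p.2 ^ l * f p := by
  obtain ⟨⟨C, R, hC, hR, h⟩, hs⟩ := hf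
  refine ⟨⟨C, R, hC, hR, fun m n => ?_⟩, ?_⟩
  · beta_reduce
    split_ifs with hmn
    · refine (h _ _).trans ?_
      gcongr
      · omega
      · omega
    · simpa using mul_nonneg hC (pow_nonneg (by linarith) _)
  · filter_upwards [hs] with p hp
    have hinj : Function.Injective fun q : ℕ × ℕ => (q.1 + k, q.2 + l) := by
      rintro ⟨a, b⟩ ⟨c, d⟩ hcd
      simpa using hcd
    rw [← hinj.hasSum_iff]
    · refine (hp.mul_left (p.1 ^ k * p.2 ^ l)).congr_fun fun q => ?_
      rw [Function.comp_apply, if_pos ⟨Nat.le_add_left _ _, Nat.le_add_left _ _⟩]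
      simp only [add_tsub_cancel_right]
      ring
    · rintro ⟨m, n⟩ hmn
      rw [if_neg]
      · ring
      · rintro ⟨h1, h2⟩
        exact hmn ⟨(m - k, n - l), by ext <;> simp <;> omega⟩

/-! ### Analyticity of the sum -/

/-- The multilinear form `v ↦ ∏_{l < i} (v l).1 * ∏_{l ≥ i} (v l).2`. -/
def monomialForm (i n : ℕ) : ContinuousMultilinearMap ℝ (fun _ : Fin n => Plane) ℝ :=
  (ContinuousMultilinearMap.mkPiAlgebraFin ℝ n ℝ).compContinuousLinearMap fun l =>
    if (l : ℕ) < i then ContinuousLinearMap.fst ℝ ℝ ℝ else ContinuousLinearMap.snd ℝ ℝ ℝ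

theorem norm_monomialForm_le (i n : ℕ) : ‖monomialForm i n‖ ≤ 1 := by
  refine (ContinuousMultilinearMap.norm_compContinuousLinearMap_le _ _).trans ?_
  rw [ContinuousMultilinearMap.norm_mkPiAlgebraFin, one_mul]
  refine Finset.prod_le_one (fun _ _ => norm_nonneg _) fun l _ => ?_
  split_ifs
  · exact ContinuousLinearMap.norm_fst_le _ _ _
  · exact ContinuousLinearMap.norm_snd_le _ _ _

theorem monomialForm_apply {i j n : ℕ} (h : i + j = n) (p : Plane) :
    monomialForm i n (fun _ => p) = p.1 ^ i * p.2 ^ j := by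
  subst h
  simp only [monomialForm, ContinuousMultilinearMap.compContinuousLinearMap_apply,
    ContinuousMultilinearMap.mkPiAlgebraFin_apply, List.prod_ofFn, Fin.prod_univ_add]
  simp

theorem HasExpansion.analyticAt {a : ℕ → ℕ → ℝ} {f : Plane → ℝ} (hf : HasExpansion a f) :
    AnalyticAt ℝ f 0 := by
  obtain ⟨⟨C, R, hC, hR, h⟩, hs⟩ := hf
  have hR0 : 0 < R := by linarith
  -- The forms `monomialForm` are not symmetric; this is harmless, since only their values on the
  -- diagonal enter the sum.
  let P : FormalMultilinearSeries ℝ Plane ℝ := fun n =>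
    ∑ ij ∈ Finset.HasAntidiagonal.antidiagonal n, a ij.1 ij.2 • monomialForm ij.1 n
  have hP : ∀ n, ‖P n‖ ≤ (n + 1) * (C * R ^ n) := fun n => by
    refine (norm_sum_le _ _).trans ?_
    refine (Finset.sum_le_card_nsmul _ _ (C * R ^ n) fun ij hij => ?_).trans ?_
    · rw [Finset.HasAntidiagonal.mem_antidiagonal] at hij
      rw [norm_smul, ← hij]
      calc _ ≤ C * R ^ (ij.1 + ij.2) * 1 := by
            gcongr
            · exact h _ _
            · exact norm_monomialForm_le _ _
        _ = _ := mul_one _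
    · simp
  have hrad : 0 < P.radius := by
    refine lt_of_lt_of_le ?_ (P.le_radius_of_bound (C := C) (r := (1 / (2 * R)).toNNReal) ?_)
    · rw [ENNReal.coe_pos, Real.toNNReal_pos]
      positivity
    · intro n
      -- The `n + 1` monomials of degree `n` are absorbed by the factor 2 in the radius `1 / (2 *
      -- R)`.
      have h2 : ((n : ℝ) + 1) ≤ 2 ^ n := by
        exact_mod_cast Nat.lt_two_pow_self
      rw [Real.coe_toNNReal _ (by positivity)]
      calc ‖P n‖ * (1 / (2 * R)) ^ n ≤ (2 ^ n * (C * R ^ n)) * (1 / (2 * R)) ^ n := by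
            gcongr
            exact (hP n).trans (by gcongr)
        _ = C := by rw [one_div, inv_pow, mul_pow]; field_simp
  have hsum := P.hasFPowerSeriesOnBall hrad
  refine hsum.analyticAt.congr ?_
  filter_upwards [hs] with p hp
  rw [FormalMultilinearSeries.sum]
  have h1 : HasSum (fun n => ∑ ij ∈ Finset.HasAntidiagonal.antidiagonal n, a ij.1 ij.2 * p.1 ^ ij.1 * p.2 ^ ij.2)
      (f p) := by
    rw [← Finset.HasAntidiagonal.sigmaAntidiagonalEquivProd.hasSum_iff] at hp
    exact hp.sigma fun n => Finset.hasSum (Finset.HasAntidiagonal.antidiagonal n)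
      fun ij : ℕ × ℕ => a ij.1 ij.2 * p.1 ^ ij.1 * p.2 ^ ij.2
  rw [← h1.tsum_eq]
  congr 1
  ext n
  simp only [P, sum_apply, smul_apply]
  refine Finset.sum_congr rfl fun ij hij => ?_
  rw [monomialForm_apply (Finset.HasAntidiagonal.mem_antidiagonal.1 hij), smul_eq_mul, mul_assoc]

/-! ### Double power series expansion of an analytic function -/

/-- The coefficient of `x ^ i * y ^ (n - i)` in the homogeneous polynomial `p n (x, y)`. -/
def homogeneousCoeff (P : FormalMultilinearSeries ℝ Plane ℝ) (n i : ℕ) : ℝ :=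
  ∑ s ∈ (Finset.univ : Finset (Fin n)).powersetCard i,
    P n (s.piecewise (fun _ => ((1, 0) : Plane)) fun _ => (0, 1))

theorem abs_homogeneousCoeff_le (P : FormalMultilinearSeries ℝ Plane ℝ) (n i : ℕ) :
    |homogeneousCoeff P n i| ≤ 2 ^ n * ‖P n‖ := by
  refine (Finset.abs_sum_le_sum_abs _ _).trans ?_
  refine (Finset.sum_le_card_nsmul _ _ ‖P n‖ fun s _ => ?_).trans ?_
  · refine ((P n).le_opNorm _).trans ?_
    refine mul_le_of_le_one_right (norm_nonneg _)
      (Finset.prod_le_one (fun _ _ => norm_nonneg _) fun l _ => ?_)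
    by_cases hl : l ∈ s <;> simp [hl]
  · rw [nsmul_eq_mul]
    gcongr
    rw [Finset.card_powersetCard, Finset.card_univ, Fintype.card_fin]
    exact_mod_cast Nat.choose_le_two_pow n i

/-- Multilinearity expands the value at x(1,0) + ξ(0,1) over the sets of slots that receive (1,0);
the terms are grouped by the cardinality of that set. -/
theorem apply_eq_sum_homogeneousCoeff (P : FormalMultilinearSeries ℝ Plane ℝ) (n : ℕ)
    (p : Plane) : (P n fun _ => p) =
      ∑ ij ∈ Finset.HasAntidiagonal.antidiagonal n,
        homogeneousCoeff P n ij.1 * p.1 ^ ij.1 * p.2 ^ ij.2 := by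
  have hp : (fun _ : Fin n => p) =
      (fun _ => p.1 • ((1, 0) : Plane)) + fun _ => p.2 • ((0, 1) : Plane) := by
    ext <;> simp
  have hs : ∀ s : Finset (Fin n),
      P n (s.piecewise (fun _ => p.1 • ((1, 0) : Plane)) fun _ => p.2 • (0, 1)) =
        p.1 ^ s.card * p.2 ^ (n - s.card) *
          P n (s.piecewise (fun _ => ((1, 0) : Plane)) fun _ => (0, 1)) := fun s => by
    have : (s.piecewise (fun _ => p.1 • ((1, 0) : Plane)) fun _ => p.2 • ((0, 1) : Plane)) =
        fun l => (s.piecewise (fun _ => p.1) fun _ => p.2) l •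
          (s.piecewise (fun _ => ((1, 0) : Plane)) fun _ => (0, 1)) l := by
      ext l <;> by_cases hl : l ∈ s <;> simp [hl]
    rw [this, ContinuousMultilinearMap.map_smul_univ, smul_eq_mul, Finset.prod_piecewise]
    simp [Finset.card_sdiff]
  rw [hp, ContinuousMultilinearMap.map_add_univ, Finset.Nat.sum_antidiagonal_eq_sum_range_succ_mk]
  rw [← Finset.powerset_univ, Finset.sum_powerset, Finset.card_univ, Fintype.card_fin]
  refine Finset.sum_congr rfl fun i _ => ?_
  rw [homogeneousCoeff, Finset.sum_mul, Finset.sum_mul]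
  refine Finset.sum_congr rfl fun s hs' => ?_
  rw [hs, (Finset.mem_powersetCard.1 hs').2]
  ring

/-- An analytic function of two variables has an expansion in a double power series. -/
theorem exists_hasExpansion {f : Plane → ℝ} (hf : AnalyticAt ℝ f 0) : ∃ a, HasExpansion a f := by
  obtain ⟨P, r, hP⟩ := hf
  obtain ⟨r', hr', hrr⟩ := ENNReal.lt_iff_exists_nnreal_btwn.1 hP.r_pos
  have hr0 : 0 < (r' : ℝ) := by exact_mod_cast hr'
  obtain ⟨C, hC, hb⟩ := P.norm_mul_pow_le_of_lt_radius (hrr.trans_le hP.r_le)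
  have hgb : GeomBound fun i j => homogeneousCoeff P (i + j) i := by
    refine GeomBound.of_le (C := C) (R := 2 / r') (fun i j => ?_) hC.le (by positivity)
    refine (abs_homogeneousCoeff_le P _ _).trans ?_
    rw [div_pow, mul_div_assoc', le_div_iff₀ (by positivity), mul_assoc, mul_comm C]
    gcongr
    exact hb _
  refine ⟨_, hgb, ?_⟩
  -- The double series is known to converge, with sum `g`; summing it along antidiagonals gives back
  -- the series of `f`.
  obtain ⟨g, -, hg⟩ := hgb.exists_hasExpansion
  filter_upwards [hg, hP.hasFPowerSeriesAt.eventually_hasSum] with p h1 h2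
  convert h1
  rw [zero_add] at h2
  refine h2.unique ?_
  have h3 := h1
  rw [← Finset.HasAntidiagonal.sigmaAntidiagonalEquivProd.hasSum_iff] at h3
  have h4 := h3.sigma fun n => Finset.hasSum (Finset.HasAntidiagonal.antidiagonal n)
    fun ij : ℕ × ℕ => homogeneousCoeff P (ij.1 + ij.2) ij.1 * p.1 ^ ij.1 * p.2 ^ ij.2
  refine h4.congr_fun fun n => ?_
  rw [apply_eq_sum_homogeneousCoeff]
  refine Finset.sum_congr rfl fun ij hij => ?_
  rw [Finset.HasAntidiagonal.mem_antidiagonal.1 hij]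

/-! ### Termwise operations: derivative, primitive, division, parity -/

/-- The partial derivative in `x` of a double power series is taken term by term. -/
theorem HasExpansion.fderiv_fst {a : ℕ → ℕ → ℝ} {f : Plane → ℝ} (hf : HasExpansion a f) :
    HasExpansion (fun m n => (m + 1) * a (m + 1) n) fun p => fderiv ℝ f p (1, 0) := by
  have hfa := hf.analyticAt
  obtain ⟨⟨C, R, hC, hR, h⟩, hs⟩ := hf
  have hR0 : 0 < R := by linarith
  have hgb : GeomBound fun m n => ((m : ℝ) + 1) * a (m + 1) n := by
    refine GeomBound.of_le (C := C * R) (R := 2 * R) (fun m n => ?_) (by positivity) (by positivity)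
    have h2 : ((m : ℝ) + 1) ≤ 2 ^ (m + n) := by
      have h3 : m + 1 ≤ 2 ^ (m + n) :=
        (Nat.lt_two_pow_self (n := m)).trans_le (Nat.pow_le_pow_right two_pos (by omega))
      exact_mod_cast h3
    rw [abs_mul, abs_of_nonneg (by positivity : (0 : ℝ) ≤ (m : ℝ) + 1)]
    calc ((m : ℝ) + 1) * |a (m + 1) n| ≤ 2 ^ (m + n) * (C * R ^ (m + 1 + n)) := by
          gcongr
          exact h _ _
      _ = _ := by rw [mul_pow]; ring
  refine ⟨hgb, ?_⟩
  obtain ⟨g, -, hg⟩ := hgb.exists_hasExpansion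
  -- With `R * δ = 1 / 4`, the factor `m + 1 ≤ 2 ^ (m + 1)` produced by differentiation leaves the
  -- ratio 1/2 in the first index, so the majorant `u` is summable.
  set δ : ℝ := 1 / (4 * R) with hδ
  have hδ0 : 0 < δ := by positivity
  have hRδ : R * δ = 1 / 4 := by rw [hδ]; field_simp
  obtain ⟨ρ, hρ, hball⟩ := Metric.eventually_nhds_iff_ball.1 (hs.and hfa.eventually_analyticAt)
  filter_upwards [hg, eventually_abs_lt (lt_min hδ0 hρ)] with p hp hpδ
  have hpρ : p ∈ Metric.ball (0 : Plane) ρ := by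
    rw [mem_ball_zero_iff, Prod.norm_def]
    exact max_lt (hpδ.1.trans_le (min_le_right _ _)) (hpδ.2.trans_le (min_le_right _ _))
  have hp2 : |p.2| ≤ δ := (hpδ.2.trans_le (min_le_left _ _)).le
  let F : ℕ × ℕ → ℝ → ℝ := fun q x => a q.1 q.2 * x ^ q.1 * p.2 ^ q.2
  let F' : ℕ × ℕ → ℝ → ℝ := fun q x => a q.1 q.2 * (q.1 * x ^ (q.1 - 1)) * p.2 ^ q.2
  have hder : ∀ q, ∀ x ∈ Metric.ball (0 : ℝ) δ, HasDerivAt (F q) (F' q x) x := fun q x _ =>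
    ((hasDerivAt_pow q.1 x).const_mul _).mul_const _
  let u : ℕ × ℕ → ℝ := fun q => C / δ * ((1 / 2) ^ q.1 * (1 / 4) ^ q.2)
  have hu : Summable u :=
    (summable_geometric_prod (by norm_num) (by norm_num) (by norm_num) (by norm_num)).mul_left _
  have hbd : ∀ q, ∀ x ∈ Metric.ball (0 : ℝ) δ, ‖F' q x‖ ≤ u q := by
    rintro ⟨m, n⟩ x hx
    rw [mem_ball_zero_iff, Real.norm_eq_abs] at hx
    simp only [F', u, Real.norm_eq_abs, abs_mul, abs_pow, Nat.abs_cast]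
    rcases m with _ | m
    · simp only [Nat.cast_zero, zero_mul, mul_zero]; positivity
    rw [add_tsub_cancel_right]
    calc _ ≤ (C * R ^ (m + 1 + n)) * ((2 : ℝ) ^ (m + 1) * δ ^ m) * δ ^ n := by
          gcongr
          · exact h _ _
          · exact_mod_cast Nat.lt_two_pow_self.le
      _ = C / δ * (((R * δ) * 2) ^ (m + 1) * (R * δ) ^ n) := by
          simp only [mul_pow, pow_add, pow_one]; field_simp
      _ = _ := by rw [hRδ]; norm_num
  have hF0 : Summable fun q => F q 0 :=
    summable_term hC hR h (by rw [hRδ]; norm_num) (by simpa using hδ0.le) hp2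
  have hx : p.1 ∈ Metric.ball (0 : ℝ) δ := by
    rw [mem_ball_zero_iff]; exact hpδ.1.trans_le (min_le_left _ _)
  have hd := hasDerivAt_tsum_of_isPreconnected hu Metric.isOpen_ball
    (convex_ball (0 : ℝ) δ).isPreconnected hder hbd (Metric.mem_ball_self hδ0) hF0 hx
  have hline : HasDerivAt (fun x => ((x, p.2) : Plane)) (1, 0) p.1 :=
    (hasDerivAt_id p.1).prodMk (hasDerivAt_const _ _)
  have hd' : HasDerivAt (fun x => f (x, p.2)) (fderiv ℝ f p (1, 0)) p.1 :=
    (hball p hpρ).2.differentiableAt.hasFDerivAt.comp_hasDerivAt p.1 hline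
  have heq : (fun x => f (x, p.2)) =ᶠ[𝓝 p.1] fun x => ∑' q, F q x := by
    have hc : ContinuousAt (fun x => ((x, p.2) : Plane)) p.1 := hline.continuousAt
    filter_upwards [hc (Metric.isOpen_ball.mem_nhds hpρ)] with x hx'
    exact ((hball _ hx').1.tsum_eq).symm
  rw [(hd'.congr_of_eventuallyEq heq.symm).unique hd]
  have hsum : HasSum (fun q => F' q p.1) (g p) := by
    have hinj : Function.Injective fun q : ℕ × ℕ => (q.1 + 1, q.2) := by
      rintro ⟨a, b⟩ ⟨c, d⟩ hcd
      simpa using hcd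
    rw [← hinj.hasSum_iff]
    · refine hp.congr_fun fun q => ?_
      simp only [F', Function.comp_apply, add_tsub_cancel_right]
      push_cast
      ring
    · rintro ⟨m, n⟩ hmn
      rcases m with _ | m
      · simp [F']
      · exact absurd ⟨(m, n), rfl⟩ hmn
  rw [hsum.tsum_eq]
  exact hp

/-- Every analytic germ is a partial derivative in `x` of an analytic germ. -/
theorem exists_primitive_fst {f : Plane → ℝ} (hf : AnalyticAt ℝ f 0) :
    ∃ g : Plane → ℝ, AnalyticAt ℝ g 0 ∧ ∀ᶠ p in 𝓝 0, fderiv ℝ g p (1, 0) = f p := by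
  obtain ⟨a, ha⟩ := exists_hasExpansion hf
  have hb : GeomBound fun m n => if 1 ≤ m then a (m - 1) n / m else 0 := by
    obtain ⟨⟨C, R, hC, hR, h⟩, -⟩ := ha
    refine ⟨C, R, hC, hR, fun m n => ?_⟩
    have hR0 : 0 ≤ R := by linarith
    beta_reduce
    split_ifs with hm
    · rw [abs_div, Nat.abs_cast]
      have hm' : (1 : ℝ) ≤ m := by exact_mod_cast hm
      refine (div_le_self (abs_nonneg _) hm').trans ((h _ _).trans ?_)
      gcongr
      · omega
    · rw [abs_zero]; positivity
  obtain ⟨g, hg⟩ := hb.exists_hasExpansion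
  refine ⟨g, hg.analyticAt, ?_⟩
  refine (hg.fderiv_fst).eventuallyEq ?_
  convert ha using 3 with m n
  have : (m : ℝ) + 1 ≠ 0 := by positivity
  simp
  field_simp

/-- Hadamard's lemma in the second variable. -/
theorem exists_eq_add_snd_mul {f : Plane → ℝ} (hf : AnalyticAt ℝ f 0) :
    ∃ q : Plane → ℝ, AnalyticAt ℝ q 0 ∧ ∀ᶠ p in 𝓝 (0 : Plane), f p = f (p.1, 0) + p.2 * q p := by
  obtain ⟨a, ha⟩ := exists_hasExpansion hf
  have hb : GeomBound fun m n => a m (n + 1) := by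
    obtain ⟨⟨C, R, hC, hR, h⟩, -⟩ := ha
    refine ⟨C * R, R, by positivity, hR, fun m n => (h _ _).trans (le_of_eq ?_)⟩
    ring
  obtain ⟨q, hq⟩ := hb.exists_hasExpansion
  refine ⟨q, hq.analyticAt, ?_⟩
  have hc : Tendsto (fun p : Plane => ((p.1, 0) : Plane)) (𝓝 0) (𝓝 0) :=
    (continuous_fst.prodMk continuous_const).tendsto' _ _ rfl
  have h1 := hq.monomial_mul 0 1
  filter_upwards [ha.2, hc.eventually ha.2, h1.2] with p hp hp0 hp1
  have := hp0.add hp1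
  simp only [pow_zero, one_mul, pow_one, zero_le, true_and] at this
  refine hp.unique (this.congr_fun fun k => ?_)
  obtain ⟨m, n⟩ := k
  rcases n with _ | n <;> simp

/-- A double power series with finitely many nonzero rows. -/
theorem HasExpansion.exists_eq_sum {a : ℕ → ℕ → ℝ} {f : Plane → ℝ} (hf : HasExpansion a f)
    {M : ℕ} (hM : ∀ m n, M ≤ m → a m n = 0) :
    ∃ c : ℕ → ℝ → ℝ, (∀ m, AnalyticAt ℝ (c m) 0) ∧
      ∀ᶠ p in 𝓝 (0 : Plane), f p = ∑ m ∈ Finset.range M, p.1 ^ m * c m p.2 := by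
  have hrow : ∀ k, GeomBound fun m n => if m = 0 then a k n else 0 := fun k => by
    obtain ⟨⟨C, R, hC, hR, h⟩, -⟩ := hf
    refine ⟨C * R ^ k, R, by positivity, hR, fun m n => ?_⟩
    beta_reduce
    split_ifs with hm
    · subst hm
      refine (h _ _).trans (le_of_eq ?_)
      ring
    · rw [abs_zero]; positivity
  choose g hg using fun k => (hrow k).exists_hasExpansion
  refine ⟨fun k y => g k (0, y), fun k => ?_, ?_⟩
  · have h1 : AnalyticAt ℝ (fun y : ℝ => ((0, y) : Plane)) 0 := analyticAt_const.prod analyticAt_id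
    exact AnalyticAt.comp (g := g k) (hg k).analyticAt h1
  · have hc : Tendsto (fun p : Plane => ((0, p.2) : Plane)) (𝓝 0) (𝓝 0) :=
      (continuous_const.prodMk continuous_snd).tendsto' _ _ rfl
    -- Only the exponent 0 of x occurs in the series of `g k`, so `g k` is a function of the second
    -- variable.
    have hg0 : ∀ k, ∀ᶠ p in 𝓝 (0 : Plane), g k p = g k (0, p.2) := fun k => by
      filter_upwards [(hg k).2, hc.eventually (hg k).2] with p h1 h2
      refine h1.unique (h2.congr_fun fun q => ?_)
      obtain ⟨m, n⟩ := q
      rcases m with _ | m <;> simp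
    have h2 := HasExpansion.finsetSum (Finset.range M) fun k _ => (hg k).monomial_mul k 0
    have h3 : f =ᶠ[𝓝 0] _ := hf.eventuallyEq (by
      convert h2 using 3 with m n
      rcases lt_or_ge m M with hm | hm
      · rw [Finset.sum_eq_single_of_mem m (Finset.mem_range.2 hm)]
        · simp
        · intro b _ hb
          rcases lt_or_ge m b with h | h
          · simp [h]
          · simp [h, show m - b ≠ 0 by omega]
      · rw [hM m n hm, Finset.sum_eq_zero]
        intro b hb
        have := Finset.mem_range.1 hb
        simp [show m - b ≠ 0 by omega])
    filter_upwards [h3, (Finset.range M).eventually_all.2 fun k _ => hg0 k] with p hp hp0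
    rw [hp]
    refine Finset.sum_congr rfl fun k hk => ?_
    rw [hp0 k hk]
    ring

theorem hasSum_even_add_odd_snd {F : ℕ × ℕ → ℝ} {s t : ℝ}
    (hs : HasSum (fun q : ℕ × ℕ => F (q.1, 2 * q.2)) s)
    (ht : HasSum (fun q : ℕ × ℕ => F (q.1, 2 * q.2 + 1)) t) : HasSum F (s + t) := by
  have h0 : Function.Injective fun q : ℕ × ℕ => (q.1, 2 * q.2) := by
    rintro ⟨m, n⟩ ⟨m', n'⟩ h
    simp only [Prod.mk.injEq] at h ⊢
    omega
  have h1 : Function.Injective fun q : ℕ × ℕ => (q.1, 2 * q.2 + 1) := by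
    rintro ⟨m, n⟩ ⟨m', n'⟩ h
    simp only [Prod.mk.injEq] at h ⊢
    omega
  refine HasSum.add_isCompl ⟨Set.disjoint_left.2 ?_, codisjoint_iff.2 (Set.eq_univ_of_forall ?_)⟩
    (h0.hasSum_range_iff.2 hs) (h1.hasSum_range_iff.2 ht)
  · rintro _ ⟨q, rfl⟩ ⟨q', h⟩
    simp only [Prod.mk.injEq] at h
    omega
  · rintro ⟨m, n⟩
    rcases Nat.even_or_odd' n with ⟨l, hl | hl⟩
    · exact Or.inl ⟨(m, l), by simp [hl]⟩
    · exact Or.inr ⟨(m, l), by simp [hl]⟩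

/-- Splitting of an analytic germ into its even and odd parts in the second variable. -/
theorem exists_even_odd {f : Plane → ℝ} (hf : AnalyticAt ℝ f 0) :
    ∃ f₀ f₁ : Plane → ℝ, AnalyticAt ℝ f₀ 0 ∧ AnalyticAt ℝ f₁ 0 ∧
      ∀ᶠ p in 𝓝 (0 : Plane), f p = f₀ (p.1, p.2 ^ 2) + p.2 * f₁ (p.1, p.2 ^ 2) := by
  obtain ⟨a, ha⟩ := exists_hasExpansion hf
  have hb : ∀ i, GeomBound fun m n => a m (2 * n + i) := fun i => by
    obtain ⟨⟨C, R, hC, hR, h⟩, -⟩ := ha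
    have hR0 : 0 ≤ R := by linarith
    refine GeomBound.of_le (C := C * R ^ i) (R := R ^ 2) (fun m n => (h _ _).trans ?_)
      (by positivity) (by positivity)
    rw [mul_assoc, ← pow_mul, ← pow_add]
    exact mul_le_mul_of_nonneg_left (pow_le_pow_right₀ hR (by omega)) hC
  obtain ⟨f₀, h0⟩ := (hb 0).exists_hasExpansion
  obtain ⟨f₁, h1⟩ := (hb 1).exists_hasExpansion
  refine ⟨f₀, f₁, h0.analyticAt, h1.analyticAt, ?_⟩
  have hc : Tendsto (fun p : Plane => ((p.1, p.2 ^ 2) : Plane)) (𝓝 0) (𝓝 0) :=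
    (continuous_fst.prodMk (continuous_snd.pow 2)).tendsto' _ _ (by simp)
  filter_upwards [ha.2, hc.eventually h0.2, hc.eventually h1.2] with p hp hp0 hp1
  refine hp.unique (hasSum_even_add_odd_snd (hp0.congr_fun fun q => ?_)
    ((hp1.mul_left p.2).congr_fun fun q => ?_))
  · simp [pow_mul]
  · simp only [pow_add, pow_mul]
    ring

/-! ### Reduction modulo Hamiltonian derivatives -/

/-- The solution of the recursion
`ε (2 m + k) b_{m,n} = 2 (m + k) b_{m+k,n-1} - a_{m+k-1,n}`, with the index `n` first. -/
def reductionCoeff (k : ℕ) (ε : ℝ) (a : ℕ → ℕ → ℝ) : ℕ → ℕ → ℝ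
  | 0, m => ε * -a (m + k - 1) 0 / (2 * m + k)
  | n + 1, m => ε * (2 * (m + k) * reductionCoeff k ε a n (m + k) - a (m + k - 1) (n + 1)) /
      (2 * m + k)

/-- The recursion converges because 2(m + k)/(2m + k) ≤ 2 uniformly in m. Each step in n moves m by
k, which costs R^k; the base 3R^k adds the factor 2 of the recursive term and the factor 1 of the
inhomogeneous term. -/
theorem geomBound_reductionCoeff {k : ℕ} (hk : 1 ≤ k) {ε : ℝ} (hε : |ε| = 1) {a : ℕ → ℕ → ℝ}
    (ha : GeomBound a) : GeomBound fun m n => reductionCoeff k ε a n m := by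
  obtain ⟨C, R, hC, hR, h⟩ := ha
  have hR0 : 0 ≤ R := by linarith
  have hk1 : (1 : ℝ) ≤ k := by exact_mod_cast hk
  have hden : ∀ m : ℕ, (1 : ℝ) ≤ 2 * m + k := fun m => by
    have : (0 : ℝ) ≤ m := by positivity
    linarith
  -- This allows a single base `3 * R ^ k` for both exponents at the end.
  have hRk : R ≤ 3 * R ^ k := by
    have h1 : R ^ 1 ≤ R ^ k := pow_le_pow_right₀ hR hk
    have h2 : 0 ≤ R ^ k := by positivity
    linarith
  have key : ∀ n m, |reductionCoeff k ε a n m| ≤ C * R ^ (m + k) * (3 * R ^ k) ^ n := by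
    intro n
    induction n with
    | zero =>
      intro m
      rw [reductionCoeff, abs_div, abs_mul, hε, abs_neg, one_mul,
        abs_of_pos (by linarith [hden m] : (0 : ℝ) < 2 * m + k), pow_zero, mul_one]
      refine (div_le_self (abs_nonneg _) (hden m)).trans ((h _ _).trans ?_)
      exact mul_le_mul_of_nonneg_left (pow_le_pow_right₀ hR (by omega)) hC
    | succ n ih =>
      intro m
      have hpos : (0 : ℝ) < 2 * m + k := by linarith [hden m]
      have hm0 : (0 : ℝ) ≤ m := by positivity
      rw [reductionCoeff, abs_div, abs_mul, hε, one_mul, abs_of_pos hpos, div_le_iff₀ hpos]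
      have h1 : |a (m + k - 1) (n + 1)| ≤ C * R ^ (m + k) * ((3 * R ^ k) ^ n * R ^ k) := by
        refine (h _ _).trans ?_
        have h3 : R ^ (k * (n + 1)) ≤ (3 * R ^ k) ^ n * R ^ k := by
          rw [mul_add, mul_one, pow_add, pow_mul]
          gcongr
          have : 0 ≤ R ^ k := by positivity
          linarith
        calc C * R ^ (m + k - 1 + (n + 1)) ≤ C * R ^ (m + k + k * (n + 1)) :=
              mul_le_mul_of_nonneg_left (pow_le_pow_right₀ hR (by nlinarith [Nat.sub_le (m + k) 1])) hC
          _ = C * R ^ (m + k) * R ^ (k * (n + 1)) := by rw [pow_add, mul_assoc]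
          _ ≤ _ := by gcongr
      have h2 : |2 * ((m : ℝ) + k) * reductionCoeff k ε a n (m + k)| ≤
          (2 * m + k) * (C * R ^ (m + k) * ((3 * R ^ k) ^ n * (2 * R ^ k))) := by
        rw [abs_mul, abs_of_nonneg (by positivity : (0 : ℝ) ≤ 2 * ((m : ℝ) + k))]
        calc 2 * ((m : ℝ) + k) * |reductionCoeff k ε a n (m + k)|
            ≤ (2 * (2 * m + k)) * (C * R ^ (m + k + k) * (3 * R ^ k) ^ n) := by
              gcongr
              · linarith
              · exact ih _
          _ = _ := by rw [pow_add _ (m + k)]; ring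
      calc |2 * ((m : ℝ) + k) * reductionCoeff k ε a n (m + k) - a (m + k - 1) (n + 1)|
          ≤ (2 * m + k) * (C * R ^ (m + k) * ((3 * R ^ k) ^ n * (2 * R ^ k))) +
            (2 * m + k) * (C * R ^ (m + k) * ((3 * R ^ k) ^ n * R ^ k)) :=
            (abs_sub _ _).trans (add_le_add h2 (h1.trans
              (le_mul_of_one_le_left (by positivity) (hden m))))
        _ = _ := by ring
  refine GeomBound.of_le (C := C * R ^ k) (R := 3 * R ^ k) (fun m n => (key n m).trans ?_)
    (by positivity) (by positivity)
  rw [pow_add R, pow_add (3 * R ^ k)]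
  calc C * (R ^ m * R ^ k) * (3 * R ^ k) ^ n ≤ C * ((3 * R ^ k) ^ m * R ^ k) * (3 * R ^ k) ^ n := by
        gcongr
    _ = _ := by ring

/-- This is the comparison of the coefficients of x^(m+k−1) h^n in 2(h − εx^k) b_x − εk x^(k−1) b =
Σ a x^m h^n. The `if` accounts for the product with h having no term of degree 0 in h. -/
theorem reductionCoeff_eq {k : ℕ} (hk : 1 ≤ k) {ε : ℝ} (hε : ε * ε = 1) (a : ℕ → ℕ → ℝ)
    (m n : ℕ) : ε * (2 * m + k) * reductionCoeff k ε a n m =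
      (if 1 ≤ n then 2 * (m + k) * reductionCoeff k ε a (n - 1) (m + k) else 0) -
        a (m + k - 1) n := by
  have hk1 : (1 : ℝ) ≤ k := by exact_mod_cast hk
  have hpos : (2 * m + k : ℝ) ≠ 0 := by positivity
  rcases n with _ | n
  · rw [reductionCoeff]
    field_simp
    simp only [nonpos_iff_eq_zero, one_ne_zero, if_false]
    linear_combination (-a (m + k - 1) 0) * hε
  · rw [reductionCoeff, if_pos (by omega), add_tsub_cancel_right]
    field_simp
    linear_combination (2 * ((m : ℝ) + k) * reductionCoeff k ε a n (m + k) -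
      a (m + k - 1) (n + 1)) * hε

/-- In the coordinates `(x, h)`, `h = ξ² + ε x ^ k`, every analytic function is a combination
`∑ x ^ i c_i(h)` modulo the image of `b ↦ 2 (h - ε x ^ k) b_x - ε k x ^ (k - 1) b`. -/
theorem exists_reduction {k : ℕ} (hk : 1 ≤ k) {ε : ℝ} (hε : ε = 1 ∨ ε = -1) {f : Plane → ℝ}
    (hf : AnalyticAt ℝ f 0) :
    ∃ (c : ℕ → ℝ → ℝ) (b : Plane → ℝ), (∀ i, AnalyticAt ℝ (c i) 0) ∧ AnalyticAt ℝ b 0 ∧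
      ∀ᶠ p in 𝓝 (0 : Plane), f p = (∑ i ∈ Finset.range (k - 1), p.1 ^ i * c i p.2) +
        (2 * (p.2 - ε * p.1 ^ k) * fderiv ℝ b p (1, 0) - ε * k * p.1 ^ (k - 1) * b p) := by
  have hε1 : |ε| = 1 := by rcases hε with rfl | rfl <;> simp
  have hε2 : ε * ε = 1 := by rcases hε with rfl | rfl <;> norm_num
  obtain ⟨a, ha⟩ := exists_hasExpansion hf
  obtain ⟨b, hb⟩ := (geomBound_reductionCoeff hk hε1 ha.1).exists_hasExpansion
  -- This is the expansion of f − (2(h − εx^k) b_x − εk x^(k−1) b). The recursion was chosen to kill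
  -- every coefficient with x-exponent at least k − 1, so only k − 1 rows are left.
  have h1 := ((ha.add ((hb.fderiv_fst.monomial_mul 0 1).const_mul (-2))).add
    ((hb.fderiv_fst.monomial_mul k 0).const_mul (2 * ε))).add
    ((hb.monomial_mul (k - 1) 0).const_mul (ε * k))
  obtain ⟨c, hc, hsum⟩ := h1.exists_eq_sum (M := k - 1) (fun m n hm => by
    obtain ⟨N, rfl⟩ : ∃ N, m = N + k - 1 := ⟨m - (k - 1), by omega⟩
    have key := reductionCoeff_eq hk hε2 a N n
    have e1 : N + k - 1 + 1 = N + k := by omega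
    have e2 : N + k - 1 - (k - 1) = N := by omega
    simp only [zero_le, true_and, and_true, hm, if_true, Nat.sub_zero, e2, e1]
    have e3 : ((N + k - 1 : ℕ) : ℝ) + 1 = N + k := by exact_mod_cast e1
    rw [e3]
    rcases N with _ | N
    · rw [if_neg (show ¬ k ≤ 0 + k - 1 by omega)]
      split_ifs at key ⊢ <;> push_cast at key ⊢ <;> linear_combination key
    · rw [if_pos (show k ≤ N + 1 + k - 1 by omega), show N + 1 + k - 1 - k = N by omega]
      split_ifs at key ⊢ <;> push_cast at key ⊢ <;> linear_combination key)
  refine ⟨c, b, hc, hb.analyticAt, ?_⟩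
  filter_upwards [hsum] with p hp
  rw [← hp]
  ring

/-- The derivative of `g` along the Hamiltonian vector field `(2 ξ, - ε k x ^ (k - 1))`. -/
def hamD (k : ℕ) (ε : ℝ) (g : Plane → ℝ) (p : Plane) : ℝ :=
  2 * p.2 * fderiv ℝ g p (1, 0) - ε * k * p.1 ^ (k - 1) * fderiv ℝ g p (0, 1)

theorem fderiv_apply_eq (g : Plane → ℝ) (p v : Plane) :
    fderiv ℝ g p v = v.1 * fderiv ℝ g p (1, 0) + v.2 * fderiv ℝ g p (0, 1) := by
  conv_lhs => rw [show v = v.1 • ((1, 0) : Plane) + v.2 • ((0, 1) : Plane) by ext <;> simp]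
  rw [map_add, map_smul, map_smul, smul_eq_mul, smul_eq_mul]

theorem hasFDerivAt_modelH (k : ℕ) (ε : ℝ) (p : Plane) :
    HasFDerivAt (modelH k ε) ((2 * p.2) • ContinuousLinearMap.snd ℝ ℝ ℝ +
      (ε * k * p.1 ^ (k - 1)) • ContinuousLinearMap.fst ℝ ℝ ℝ) p := by
  have h1 := (hasFDerivAt_snd (𝕜 := ℝ) (p := p)).pow 2
  have h2 := ((hasFDerivAt_fst (𝕜 := ℝ) (p := p)).pow k).const_mul ε
  refine (h1.add h2).congr_fderiv ?_
  ext <;> simp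
  ring

theorem analyticAt_modelH (k : ℕ) (ε : ℝ) (p : Plane) : AnalyticAt ℝ (modelH k ε) p :=
  (analyticAt_snd.pow 2).add (analyticAt_const.mul (analyticAt_fst.pow k))

theorem modelH_zero {k : ℕ} (hk : 1 ≤ k) (ε : ℝ) : modelH k ε 0 = 0 := by
  simp [modelH, show k ≠ 0 by omega]

theorem tendsto_modelH {k : ℕ} (hk : 1 ≤ k) (ε : ℝ) :
    Tendsto (modelH k ε) (𝓝 0) (𝓝 0) := by
  have := (analyticAt_modelH k ε 0).continuousAt.tendsto
  rwa [modelH_zero hk] at this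

theorem analyticAt_comp_fst_modelH {k : ℕ} (hk : 1 ≤ k) (ε : ℝ) {g : Plane → ℝ}
    (hg : AnalyticAt ℝ g 0) : AnalyticAt ℝ (fun p : Plane => g (p.1, modelH k ε p)) 0 := by
  refine AnalyticAt.comp (g := g) (f := fun p : Plane => (p.1, modelH k ε p)) ?_
    (analyticAt_fst.prod (analyticAt_modelH k ε 0))
  rwa [show ((0 : Plane).1, modelH k ε 0) = 0 from Prod.ext rfl (modelH_zero hk ε)]

theorem hamD_mul {k : ℕ} {ε : ℝ} {f g : Plane → ℝ} {p : Plane} (hf : DifferentiableAt ℝ f p)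
    (hg : DifferentiableAt ℝ g p) :
    hamD k ε (fun p => f p * g p) p = f p * hamD k ε g p + g p * hamD k ε f p := by
  simp only [hamD, fderiv_fun_mul hf hg, add_apply, smul_apply, smul_eq_mul]
  ring

theorem hamD_add {k : ℕ} {ε : ℝ} {f g : Plane → ℝ} {p : Plane} (hf : DifferentiableAt ℝ f p)
    (hg : DifferentiableAt ℝ g p) :
    hamD k ε (fun p => f p + g p) p = hamD k ε f p + hamD k ε g p := by
  simp only [hamD, fderiv_fun_add hf hg, add_apply]
  ring

/-- The derivation annihilates H, so in the coordinates (x, H) it is 2ξ∂_x. -/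
theorem hamD_comp_fst_modelH {k : ℕ} {ε : ℝ} {g : Plane → ℝ} {p : Plane}
    (hg : DifferentiableAt ℝ g (p.1, modelH k ε p)) :
    hamD k ε (fun p => g (p.1, modelH k ε p)) p =
      2 * p.2 * fderiv ℝ g (p.1, modelH k ε p) (1, 0) := by
  have h1 : HasFDerivAt (fun p : Plane => (p.1, modelH k ε p)) _ p :=
    hasFDerivAt_fst.prodMk (hasFDerivAt_modelH k ε p)
  have h2 := HasFDerivAt.comp (g := g) p hg.hasFDerivAt h1
  have h3 : fderiv ℝ (fun p => g (p.1, modelH k ε p)) p = _ := h2.fderiv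
  rw [hamD, h3]
  simp only [ContinuousLinearMap.comp_apply, ContinuousLinearMap.prod_apply, add_apply,
    smul_apply, ContinuousLinearMap.coe_fst', ContinuousLinearMap.coe_snd', smul_eq_mul, mul_one,
    mul_zero, add_zero, zero_add]
  rw [fderiv_apply_eq g _ (1, _), fderiv_apply_eq g _ (0, 2 * p.2)]
  ring

theorem hamD_snd (k : ℕ) (ε : ℝ) (p : Plane) :
    hamD k ε (fun p => p.2) p = -(ε * k * p.1 ^ (k - 1)) := by
  have : fderiv ℝ (fun p : Plane => p.2) p = ContinuousLinearMap.snd ℝ ℝ ℝ := hasFDerivAt_snd.fderiv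
  simp [hamD, this]

/-- Every analytic germ is `∑ x ^ i c_i(H)` up to a Hamiltonian derivative. -/
theorem exists_normal_add_hamD {k : ℕ} (hk : 1 ≤ k) {ε : ℝ} (hε : ε = 1 ∨ ε = -1)
    {f : Plane → ℝ} (hf : AnalyticAt ℝ f 0) :
    ∃ (c : ℕ → ℝ → ℝ) (η : Plane → ℝ), (∀ i, AnalyticAt ℝ (c i) 0) ∧ AnalyticAt ℝ η 0 ∧
      ∀ᶠ p in 𝓝 (0 : Plane),
        f p = (∑ i ∈ Finset.range (k - 1), p.1 ^ i * c i (modelH k ε p)) + hamD k ε η p := by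
  obtain ⟨f₀, f₁, h0, h1, hf01⟩ := exists_even_odd hf
  have hsub : ∀ {g : Plane → ℝ}, AnalyticAt ℝ g 0 →
      AnalyticAt ℝ (fun p : Plane => g (p.1, p.2 - ε * p.1 ^ k)) 0 := fun {g} hg => by
    refine AnalyticAt.comp (g := g) (f := fun p : Plane => (p.1, p.2 - ε * p.1 ^ k)) ?_
      (analyticAt_fst.prod (analyticAt_snd.sub (analyticAt_const.mul (analyticAt_fst.pow k))))
    rwa [show ((0 : Plane).1, (0 : Plane).2 - ε * (0 : Plane).1 ^ k) = 0 from
      Prod.ext rfl (by simp [show k ≠ 0 by omega])]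
  obtain ⟨c, b, hc, hb, hred⟩ := exists_reduction hk hε (hsub h0)
  obtain ⟨α, hα, hprim⟩ := exists_primitive_fst (hsub h1)
  have hαH := analyticAt_comp_fst_modelH hk ε hα
  have hbH := analyticAt_comp_fst_modelH hk ε hb
  -- The first summand has Hamiltonian derivative ξ α_x, which is the odd part of f. The second
  -- gives 2ξ² b_x − εk x^(k−1) b, which by ξ² = h − εx^k is the operator of `exists_reduction` and
  -- accounts for the even part.
  refine ⟨c, fun p => 2⁻¹ * α (p.1, modelH k ε p) + p.2 * b (p.1, modelH k ε p), hc,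
    (analyticAt_const.mul hαH).add (analyticAt_snd.mul hbH), ?_⟩
  have hT : Tendsto (fun p : Plane => (p.1, modelH k ε p)) (𝓝 0) (𝓝 0) :=
    continuous_fst.continuousAt.tendsto.prodMk_nhds (tendsto_modelH hk ε)
  filter_upwards [hf01, hT.eventually hred, hT.eventually hprim, hT.eventually
    hα.eventually_analyticAt, hT.eventually hb.eventually_analyticAt,
    hαH.eventually_analyticAt, hbH.eventually_analyticAt] with p e1 e2 e3 a1 a2 a3 a4
  have hξ : modelH k ε p - ε * p.1 ^ k = p.2 ^ 2 := by simp [modelH]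
  simp only [hξ] at e2 e3
  have hs : DifferentiableAt ℝ (fun p : Plane => p.2) p := differentiableAt_snd
  rw [hamD_add (a3.differentiableAt.const_mul _)
    (hs.fun_mul a4.differentiableAt),
    hamD_mul (differentiableAt_const _) a3.differentiableAt,
    hamD_mul hs a4.differentiableAt,
    hamD_comp_fst_modelH a1.differentiableAt, hamD_comp_fst_modelH a2.differentiableAt, e3,
    hamD_snd, e1, e2]
  simp only [hamD, fderiv_fun_const, Pi.zero_apply, zero_apply]
  ring

/-! ### Analytic flows -/

section Flow

variable {E F : Type*} [NormedAddCommGroup E] [NormedSpace ℝ E] [NormedAddCommGroup F]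
  [NormedSpace ℝ F] {K : Type*} [TopologicalSpace K] [CompactSpace K]

/-- A continuous multilinear map acts pointwise on continuous functions. -/
def pointwiseMultilinear {n : ℕ} (K : Type*) [TopologicalSpace K] [CompactSpace K]
    (P : ContinuousMultilinearMap ℝ (fun _ : Fin n => E) F) :
    ContinuousMultilinearMap ℝ (fun _ : Fin n => C(K, E)) C(K, F) :=
  MultilinearMap.mkContinuous
    { toFun := fun m => ⟨fun t => P fun i => m i t,
        P.cont.comp (continuous_pi fun i => (m i).continuous)⟩
      map_update_add' := fun m i x y => by
        ext t
        have h : ∀ z : C(K, E), (fun j => Function.update m i z j t) =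
            Function.update (fun j => m j t) i (z t) := fun z => by
          ext j
          rcases eq_or_ne j i with rfl | hj <;> simp [*]
        simp [h]
      map_update_smul' := fun m i c x => by
        ext t
        have h : ∀ z : C(K, E), (fun j => Function.update m i z j t) =
            Function.update (fun j => m j t) i (z t) := fun z => by
          ext j
          rcases eq_or_ne j i with rfl | hj <;> simp [*]
        simp [h] }
    ‖P‖ fun m => by
      refine (ContinuousMap.norm_le _ (by positivity)).2 fun t => (P.le_opNorm _).trans ?_
      gcongr with i
      exact (m i).norm_coe_le_norm t

theorem norm_pointwiseMultilinear_le {n : ℕ}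
    (P : ContinuousMultilinearMap ℝ (fun _ : Fin n => E) F) :
    ‖pointwiseMultilinear K P‖ ≤ ‖P‖ :=
  MultilinearMap.mkContinuous_norm_le _ (norm_nonneg _) _

/-- Composition with an analytic map is analytic on the space of continuous functions. -/
theorem exists_analytic_superposition [CompleteSpace F] (K : Type*) [TopologicalSpace K]
    [CompactSpace K] {f : E → F} (hf : AnalyticAt ℝ f 0) :
    ∃ Φ : C(K, E) → C(K, F), AnalyticAt ℝ Φ 0 ∧ ∀ᶠ γ in 𝓝 0, ∀ t, Φ γ t = f (γ t) := by
  obtain ⟨P, r, hP⟩ := hf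
  let Q : FormalMultilinearSeries ℝ C(K, E) C(K, F) := fun n => pointwiseMultilinear K (P n)
  have hPQ : P.radius ≤ Q.radius := FormalMultilinearSeries.radius_le_of_le fun n =>
    norm_pointwiseMultilinear_le (P n)
  have hr : 0 < r := hP.r_pos
  have hQ := Q.hasFPowerSeriesOnBall ((hr.trans_le hP.r_le).trans_le hPQ)
  refine ⟨Q.sum, hQ.analyticAt, ?_⟩
  filter_upwards [Metric.eball_mem_nhds (0 : C(K, E)) hr] with γ hγ t
  have h1 : HasSum (fun n => Q n fun _ => γ) (Q.sum γ) := by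
    have := hQ.hasSum (y := γ) (Metric.eball_subset_eball (hP.r_le.trans hPQ) hγ)
    rwa [zero_add] at this
  have h2 : HasSum (fun n => P n fun _ => γ t) (Q.sum γ t) :=
    h1.mapL (ContinuousMap.evalCLM ℝ t)
  have h3 : HasSum (fun n => P n fun _ => γ t) (f (γ t)) := by
    have := hP.hasSum (y := γ t) (by
      rw [Metric.mem_eball, edist_zero_right] at hγ ⊢
      refine lt_of_le_of_lt ?_ hγ
      rw [← ofReal_norm, ← ofReal_norm]
      exact ENNReal.ofReal_le_ofReal (γ.norm_coe_le_norm t))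
    rwa [zero_add] at this
  exact h2.unique h3

/-- The interval `[-1, 1]`. -/
abbrev TimeInterval : Type := Set.Icc (-1 : ℝ) 1

/-- The primitive `t ↦ ∫ s in 0..t, γ s` of a continuous function on `[-1, 1]`. -/
def primitiveMap (γ : C(TimeInterval, E)) : C(TimeInterval, E) where
  toFun t := ∫ s in (0 : ℝ)..t, γ (Set.projIcc (-1) 1 (by norm_num) s)
  continuous_toFun := (intervalIntegral.continuous_primitive
    (fun a b => (γ.continuous.Icc_extend' (h := by norm_num)).intervalIntegrable a b) 0).comp
    continuous_subtype_val

theorem primitiveMap_apply (γ : C(TimeInterval, E)) (t : TimeInterval) :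
    primitiveMap γ t = ∫ s in (0 : ℝ)..t, γ (Set.projIcc (-1) 1 (by norm_num) s) := rfl

theorem intervalIntegrable_comp_projIcc {E : Type*} [NormedAddCommGroup E] (γ : C(TimeInterval, E)) (a b : ℝ) :
    IntervalIntegrable (fun s => γ (Set.projIcc (-1) 1 (by norm_num) s)) MeasureTheory.volume a b :=
  (γ.continuous.Icc_extend' (h := by norm_num)).intervalIntegrable a b

theorem norm_primitiveMap_le (γ : C(TimeInterval, E)) : ‖primitiveMap γ‖ ≤ 1 * ‖γ‖ := by
  refine (ContinuousMap.norm_le _ (by positivity)).2 fun t => ?_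
  rw [primitiveMap_apply]
  refine (intervalIntegral.norm_integral_le_of_norm_le_const (C := ‖γ‖)
    fun s _ => γ.norm_coe_le_norm (Set.projIcc (-1) 1 (by norm_num) s)).trans ?_
  rw [sub_zero, one_mul]
  exact mul_le_of_le_one_right (norm_nonneg _) (abs_le.2 t.2)

/-- `primitiveMap` as a continuous linear map. -/
def primitiveCLM (E : Type*) [NormedAddCommGroup E] [NormedSpace ℝ E] [CompleteSpace E] :
    C(TimeInterval, E) →L[ℝ] C(TimeInterval, E) :=
  LinearMap.mkContinuous
    { toFun := primitiveMap
      map_add' := fun γ δ => by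
        ext t
        exact intervalIntegral.integral_add (intervalIntegrable_comp_projIcc γ _ _)
          (intervalIntegrable_comp_projIcc δ _ _)
      map_smul' := fun c γ => by
        ext t
        exact intervalIntegral.integral_smul _ _ }
    1 norm_primitiveMap_le

/-- Constant functions as a continuous linear map. -/
def constCLM (E : Type*) [NormedAddCommGroup E] [NormedSpace ℝ E] :
    E →L[ℝ] C(TimeInterval, E) :=
  LinearMap.mkContinuous
    { toFun := fun x => ContinuousMap.const _ x
      map_add' := fun _ _ => rfl
      map_smul' := fun _ _ => rfl }
    1 fun x => by
      rw [one_mul]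
      exact (ContinuousMap.norm_le _ (norm_nonneg x)).2 fun t => le_rfl

/-- The solutions of the integral equation `γ t = p + s ∫ r in 0..t, Y (γ r)` with small data form
an analytic family. -/
theorem exists_analytic_solution [CompleteSpace E] {S : C(TimeInterval, E) → C(TimeInterval, E)}
    (hS : AnalyticAt ℝ S 0) :
    ∃ Γ : ℝ × E → C(TimeInterval, E), AnalyticAt ℝ Γ 0 ∧ Γ 0 = 0 ∧
      (∀ᶠ z in 𝓝 (0 : ℝ × E), Γ z = constCLM E z.2 + z.1 • primitiveCLM E (S (Γ z))) ∧
      ∀ᶠ w in 𝓝 (0 : (ℝ × E) × C(TimeInterval, E)),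
        w.2 = constCLM E w.1.2 + w.1.1 • primitiveCLM E (S w.2) → w.2 = Γ w.1 := by
  let G : (ℝ × E) × C(TimeInterval, E) → (ℝ × E) × C(TimeInterval, E) := fun w =>
    (w.1, w.2 - (constCLM E w.1.2 + w.1.1 • primitiveCLM E (S w.2)))
  have hS' : AnalyticAt ℝ (fun w : (ℝ × E) × C(TimeInterval, E) => S w.2) 0 :=
    AnalyticAt.comp (g := S) (f := Prod.snd) hS analyticAt_snd
  have hG : AnalyticAt ℝ G 0 :=
    analyticAt_fst.prod (analyticAt_snd.sub
      ((((constCLM E).comp (ContinuousLinearMap.snd ℝ ℝ E)).comp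
          (ContinuousLinearMap.fst ℝ (ℝ × E) C(TimeInterval, E))).analyticAt 0 |>.add
        (AnalyticAt.smul (((ContinuousLinearMap.fst ℝ ℝ E).comp
          (ContinuousLinearMap.fst ℝ (ℝ × E) C(TimeInterval, E))).analyticAt 0)
          ((primitiveCLM E).analyticAt _ |>.comp hS'))))
  -- At the base point the time parameter is 0, so the derivative of `S` drops out of the
  -- linearisation, which is therefore triangular with identity blocks.
  let e : ((ℝ × E) × C(TimeInterval, E)) ≃L[ℝ] ((ℝ × E) × C(TimeInterval, E)) :=
    (ContinuousLinearEquiv.refl ℝ (ℝ × E)).skewProd (ContinuousLinearEquiv.refl ℝ _)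
      (-((constCLM E).comp (ContinuousLinearMap.snd ℝ ℝ E) +
        (ContinuousLinearMap.fst ℝ ℝ E).smulRight (primitiveCLM E (S 0))))
  have he : HasFDerivAt G (e : _ →L[ℝ] _) 0 := by
    have h1 : HasFDerivAt (fun w : (ℝ × E) × C(TimeInterval, E) => primitiveCLM E (S w.2)) _ 0 :=
      (primitiveCLM E).hasFDerivAt.comp 0 hS'.differentiableAt.hasFDerivAt
    have h2 : HasFDerivAt (fun w : (ℝ × E) × C(TimeInterval, E) => w.1.1) _ 0 :=
      ((ContinuousLinearMap.fst ℝ ℝ E).comp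
          (ContinuousLinearMap.fst ℝ (ℝ × E) C(TimeInterval, E))).hasFDerivAt
    have h3 : HasFDerivAt (fun w : (ℝ × E) × C(TimeInterval, E) => constCLM E w.1.2) _ 0 :=
      (((constCLM E).comp (ContinuousLinearMap.snd ℝ ℝ E)).comp
          (ContinuousLinearMap.fst ℝ (ℝ × E) C(TimeInterval, E))).hasFDerivAt
    have h4 : HasFDerivAt G _ 0 :=
      hasFDerivAt_fst.prodMk (hasFDerivAt_snd.sub (h3.add (h2.smul h1)))
    refine h4.congr_fderiv (ContinuousLinearMap.ext fun w => ?_)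
    simp [e, sub_eq_add_neg]
  -- The exponent `⊤` means analytic, so the inverse function theorem returns an analytic inverse.
  have hC : ContDiffAt ℝ ⊤ G 0 := hG.contDiffAt
  have hG0 : G 0 = 0 := by simp [G]
  have hst := hC.hasStrictFDerivAt' he (by simp)
  have hinv : AnalyticAt ℝ (hC.localInverse he (by simp)) 0 := by
    have := hC.to_localInverse he (by simp)
    rw [hG0] at this
    exact this.analyticAt
  set g := hC.localInverse he (by simp) with hg
  have hg0 : g 0 = 0 := by
    have := hC.localInverse_apply_image he (by simp)
    rwa [hG0] at this
  have hι : AnalyticAt ℝ (fun z : ℝ × E => ((z, 0) : (ℝ × E) × C(TimeInterval, E))) 0 :=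
    analyticAt_id.prod analyticAt_const
  have hι0 : Tendsto (fun z : ℝ × E => ((z, 0) : (ℝ × E) × C(TimeInterval, E))) (𝓝 0) (𝓝 0) :=
    hι.continuousAt.tendsto
  refine ⟨fun z => (g (z, 0)).2, ?_, ?_, ?_, ?_⟩
  · exact analyticAt_snd.comp (AnalyticAt.comp (g := g) hinv hι)
  · change (g 0).2 = 0
    rw [hg0]; rfl
  · have hr := hst.eventually_right_inverse
    rw [hG0] at hr
    filter_upwards [hι0.eventually hr] with z hz
    change G (g (z, 0)) = (z, 0) at hz
    obtain ⟨h1, h2⟩ := Prod.mk.inj hz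
    rw [h1, sub_eq_zero] at h2
    exact h2
  · filter_upwards [hst.eventually_left_inverse] with w hw h
    change g (G w) = w at hw
    have : G w = (w.1, 0) := Prod.ext rfl (sub_eq_zero.2 h)
    rw [this] at hw
    rw [hw]

end Flow

/-- The product of two numbers in `[-1, 1]`. -/
def timeMul (r t : TimeInterval) : TimeInterval :=
  ⟨r * t, abs_le.1 (by
    rw [abs_mul]
    exact mul_le_one₀ (abs_le.2 r.2) (abs_nonneg _) (abs_le.2 t.2))⟩

/-- An analytic vector field has an analytic local flow. -/
theorem exists_analytic_flow {E : Type*} [NormedAddCommGroup E] [NormedSpace ℝ E]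
    [CompleteSpace E] {Y : E → E} (hY : AnalyticAt ℝ Y 0) :
    ∃ Φ : ℝ × E → E, AnalyticAt ℝ Φ 0 ∧ (∀ᶠ p in 𝓝 (0 : E), Φ (0, p) = p) ∧
      ∀ᶠ z in 𝓝 (0 : ℝ × E), HasDerivAt (fun s => Φ (s, z.2)) (Y (Φ z)) z.1 := by
  obtain ⟨S, hS, hSY⟩ := exists_analytic_superposition TimeInterval hY
  obtain ⟨Γ, hΓ, hΓ0, hsol, huniq⟩ := exists_analytic_solution hS
  let one : TimeInterval := ⟨1, by norm_num⟩
  have hΓt : Tendsto Γ (𝓝 0) (𝓝 0) := by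
    have := hΓ.continuousAt.tendsto
    rwa [hΓ0] at this
  obtain ⟨ρ, hρ, hball⟩ := Metric.eventually_nhds_iff_ball.1 huniq
  obtain ⟨ρ', hρ', hball'⟩ := Metric.eventually_nhds_iff_ball.1 hSY
  have hev : ∀ᶠ z in 𝓝 (0 : ℝ × E), Γ z = constCLM E z.2 + z.1 • primitiveCLM E (S (Γ z)) ∧
      ‖Γ z‖ < min ρ ρ' ∧ ‖z‖ < ρ := by
    filter_upwards [hsol, hΓt.eventually (Metric.ball_mem_nhds 0 (lt_min hρ hρ')),
      Metric.ball_mem_nhds (0 : ℝ × E) hρ] with z h1 h2 h3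
    exact ⟨h1, by simpa using h2, by simpa using h3⟩
  -- rescaling of time
  have hscale : ∀ᶠ z in 𝓝 (0 : ℝ × E), ∀ r : TimeInterval, Γ (r * z.1, z.2) one = Γ z r := by
    filter_upwards [hev] with z hz r
    obtain ⟨h1, h2, h3⟩ := hz
    -- The curve t ↦ Γ z (r t) solves the integral equation with time parameter r z.1. Since |r| ≤ 1
    -- it stays in the ball where solutions are unique, so it equals Γ (r z.1, z.2).
    let δ : C(TimeInterval, E) := ⟨fun t => Γ z (timeMul r t), (Γ z).continuous.comp
      ((continuous_const.mul continuous_subtype_val).subtype_mk _)⟩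
    have hδ : ‖δ‖ ≤ ‖Γ z‖ := (ContinuousMap.norm_le _ (norm_nonneg _)).2 fun t =>
      (Γ z).norm_coe_le_norm _
    have hr : |(r : ℝ)| ≤ 1 := abs_le.2 r.2
    have hmem : (((r * z.1, z.2), δ) : (ℝ × E) × C(TimeInterval, E)) ∈ Metric.ball 0 ρ := by
      rw [mem_ball_zero_iff]
      rw [Prod.norm_def, max_lt_iff] at h3 ⊢
      refine ⟨?_, hδ.trans_lt (h2.trans_le (min_le_left _ _))⟩
      rw [Prod.norm_def, max_lt_iff]
      refine ⟨?_, h3.2⟩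
      rw [norm_mul]
      exact (mul_le_of_le_one_left (norm_nonneg _) hr).trans_lt h3.1
    have hkey := hball _ hmem (by
      ext t
      have h4 : δ t = z.2 + z.1 • ∫ s in (0 : ℝ)..(r * t : ℝ),
          S (Γ z) (Set.projIcc (-1) 1 (by norm_num) s) :=
        congrArg (fun γ : C(TimeInterval, E) => γ (timeMul r t)) h1
      have h5 : ∀ u : TimeInterval, S δ u = S (Γ z) (timeMul r u) := fun u => by
        rw [hball' δ (by rw [mem_ball_zero_iff]
                         exact hδ.trans_lt (h2.trans_le (min_le_right _ _))),
          hball' (Γ z) (by rw [mem_ball_zero_iff]; exact h2.trans_le (min_le_right _ _))]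
        rfl
      have h6 : (r : ℝ) • ∫ s in (0 : ℝ)..t, S δ (Set.projIcc (-1) 1 (by norm_num) s) =
          ∫ s in (0 : ℝ)..(r * t : ℝ), S (Γ z) (Set.projIcc (-1) 1 (by norm_num) s) := by
        have := intervalIntegral.smul_integral_comp_mul_left (a := 0) (b := t)
          (fun s => S (Γ z) (Set.projIcc (-1) 1 (by norm_num) s)) (r : ℝ)
        rw [mul_zero] at this
        rw [← this]
        congr 1
        refine intervalIntegral.integral_congr fun s hs => ?_
        have hs' : s ∈ Set.Icc (-1 : ℝ) 1 :=
          Set.uIcc_subset_Icc (by norm_num) t.2 hs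
        have hrs : (r : ℝ) * s ∈ Set.Icc (-1 : ℝ) 1 := (timeMul r ⟨s, hs'⟩).2
        simp only [Set.projIcc_of_mem _ hs', Set.projIcc_of_mem _ hrs, h5]
        rfl
      change δ t = z.2 + ((r : ℝ) * z.1) •
        ∫ s in (0 : ℝ)..t, S δ (Set.projIcc (-1) 1 (by norm_num) s)
      rw [h4, ← h6, smul_smul, mul_comm (r : ℝ)])
    have := congrArg (fun γ => γ one) hkey
    change δ one = Γ (r * z.1, z.2) one at this
    rw [← this]
    change Γ z (timeMul r one) = _
    congr 1
    exact Subtype.ext (mul_one _)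
  refine ⟨fun z => Γ z one, ?_, ?_, ?_⟩
  · exact (ContinuousMap.evalCLM ℝ one).analyticAt _ |>.comp hΓ
  · have hc : Tendsto (fun p : E => ((0, p) : ℝ × E)) (𝓝 0) (𝓝 0) :=
      (continuous_const.prodMk continuous_id).tendsto' _ _ rfl
    filter_upwards [hc.eventually hsol] with p hp
    rw [hp, zero_smul, add_zero]
    rfl
  · obtain ⟨τ, hτ, hτb⟩ := Metric.eventually_nhds_iff_ball.1 (hscale.and hev)
    filter_upwards [Metric.ball_mem_nhds (0 : ℝ × E) (half_pos hτ)] with z hz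
    rw [mem_ball_zero_iff, Prod.norm_def, max_lt_iff] at hz
    have hz1 : |z.1| < τ / 2 := hz.1
    have hmem : ((τ / 2, z.2) : ℝ × E) ∈ Metric.ball 0 τ := by
      rw [mem_ball_zero_iff, Prod.norm_def, max_lt_iff]
      refine ⟨?_, hz.2.trans (half_lt_self hτ)⟩
      change |τ / 2| < τ
      rw [abs_of_pos (half_pos hτ)]
      exact half_lt_self hτ
    obtain ⟨h1, h2, h3, -⟩ := hτb _ hmem
    -- By rescaling, all times |s| < τ/2 are read off this one curve as γ(s/(τ/2)). Its integral
    -- equation can then be differentiated by the fundamental theorem of calculus.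
    set γ := Γ (τ / 2, z.2) with hγ
    have hτ2 : (0 : ℝ) < τ / 2 := half_pos hτ
    have hΦ : ∀ s, |s| < τ / 2 → Γ (s, z.2) one = z.2 + ∫ u in (0 : ℝ)..s,
        S γ (Set.projIcc (-1) 1 (by norm_num) ((τ / 2)⁻¹ * u)) := fun s hs => by
      have hr : s / (τ / 2) ∈ Set.Icc (-1 : ℝ) 1 := by
        rw [Set.mem_Icc, ← abs_le, abs_div, abs_of_pos hτ2]
        exact (div_le_one hτ2).2 hs.le
      have h4 := h1 ⟨s / (τ / 2), hr⟩
      simp only [div_mul_cancel₀ s hτ2.ne'] at h4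
      rw [h4]
      have h5 : γ ⟨s / (τ / 2), hr⟩ = z.2 + (τ / 2) • ∫ u in (0 : ℝ)..(s / (τ / 2)),
          S γ (Set.projIcc (-1) 1 (by norm_num) u) :=
        congrArg (fun γ : C(TimeInterval, E) => γ ⟨s / (τ / 2), hr⟩) h2
      rw [h5, intervalIntegral.integral_comp_mul_left
        (fun u => S γ (Set.projIcc (-1) 1 (by norm_num) u)) (inv_ne_zero hτ2.ne'), inv_inv,
        mul_zero, div_eq_inv_mul s]
    have hcont : Continuous fun u : ℝ => S γ (Set.projIcc (-1) 1 (by norm_num) ((τ / 2)⁻¹ * u)) :=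
      (S γ).continuous.comp (continuous_projIcc.comp (continuous_const.mul continuous_id))
    have hd := (intervalIntegral.integral_hasDerivAt_right (hcont.intervalIntegrable 0 z.1)
      (hcont.stronglyMeasurableAtFilter _ _) hcont.continuousAt).const_add z.2
    have hval : S γ (Set.projIcc (-1) 1 (by norm_num) ((τ / 2)⁻¹ * z.1)) = Y (Γ z one) := by
      have hr : (τ / 2)⁻¹ * z.1 ∈ Set.Icc (-1 : ℝ) 1 := by
        rw [Set.mem_Icc, ← abs_le, abs_mul, abs_of_pos (inv_pos.2 hτ2)]
        exact (inv_mul_le_one₀ hτ2).2 hz1.le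
      rw [Set.projIcc_of_mem _ hr, hball' γ (by
        rw [mem_ball_zero_iff]; exact h3.trans_le (min_le_right _ _)), ← h1 ⟨_, hr⟩]
      congr 3
      exact Prod.ext (by change (τ / 2)⁻¹ * z.1 * (τ / 2) = z.1; field_simp) rfl
    rw [← hval]
    refine hd.congr_of_eventuallyEq ?_
    filter_upwards [(continuous_abs.continuousAt (x := z.1)).eventually_lt_const hz1] with s hs
    exact hΦ s hs

/-! ### Jacobians, diffeomorphism germs and pull-backs -/

/-- The Jacobian determinant of a plane map. -/
def jac (ψ : Plane → Plane) (p : Plane) : ℝ :=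
  (fderiv ℝ ψ p (1, 0)).1 * (fderiv ℝ ψ p (0, 1)).2 -
    (fderiv ℝ ψ p (0, 1)).1 * (fderiv ℝ ψ p (1, 0)).2

theorem det_eq (A : Plane →L[ℝ] Plane) :
    A.det = (A (1, 0)).1 * (A (0, 1)).2 - (A (0, 1)).1 * (A (1, 0)).2 := by
  rw [ContinuousLinearMap.det, ← LinearMap.det_toMatrix (Module.Basis.finTwoProd ℝ),
    Matrix.det_fin_two]
  simp [LinearMap.toMatrix_apply]

theorem preservesOrientation_iff {ψ : Plane → Plane} : PreservesOrientation ψ ↔ 0 < jac ψ 0 := by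
  rw [PreservesOrientation, det_eq, jac]

theorem jac_congr {ψ φ : Plane → Plane} {p : Plane} (h : ψ =ᶠ[𝓝 p] φ) : jac ψ p = jac φ p := by
  rw [jac, jac, h.fderiv_eq]

theorem jac_comp {ψ φ : Plane → Plane} {p : Plane} (hψ : DifferentiableAt ℝ ψ (φ p))
    (hφ : DifferentiableAt ℝ φ p) : jac (ψ ∘ φ) p = jac ψ (φ p) * jac φ p := by
  have h : ∀ A B : Plane →L[ℝ] Plane, (A.comp B).det = A.det * B.det := fun A B => by
    simp only [ContinuousLinearMap.det, ContinuousLinearMap.toLinearMap_comp, LinearMap.det_comp]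
  have := h (fderiv ℝ ψ (φ p)) (fderiv ℝ φ p)
  rw [← fderiv_comp p hψ hφ] at this
  simp only [det_eq] at this
  exact this

theorem isDiffeoGerm_of_jac_ne_zero {ψ : Plane → Plane} (hψ : AnalyticAt ℝ ψ 0) (h0 : ψ 0 = 0)
    (hj : jac ψ 0 ≠ 0) : IsDiffeoGerm ψ := by
  have hdet : (fderiv ℝ ψ 0).det ≠ 0 := by rwa [det_eq]
  let e := ContinuousLinearMap.toContinuousLinearEquivOfDetNeZero (fderiv ℝ ψ 0) hdet
  have he : HasFDerivAt ψ (e : Plane →L[ℝ] Plane) 0 := by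
    rw [ContinuousLinearMap.coe_toContinuousLinearEquivOfDetNeZero]
    exact hψ.differentiableAt.hasFDerivAt
  have hC : ContDiffAt ℝ ⊤ ψ 0 := hψ.contDiffAt
  have hst := hC.hasStrictFDerivAt' he (by simp)
  have hinv := (hC.to_localInverse he (by simp)).analyticAt
  have hinv0 := hC.localInverse_apply_image he (by simp)
  have hr := hst.eventually_right_inverse
  rw [h0] at hinv hinv0 hr
  exact ⟨hψ, h0, _, hinv, hinv0, hst.eventually_left_inverse, hr⟩

theorem IsDiffeoGerm.analyticAt {ψ : Plane → Plane} (h : IsDiffeoGerm ψ) : AnalyticAt ℝ ψ 0 := h.1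

theorem IsDiffeoGerm.map_zero {ψ : Plane → Plane} (h : IsDiffeoGerm ψ) : ψ 0 = 0 := h.2.1

theorem IsDiffeoGerm.tendsto {ψ : Plane → Plane} (h : IsDiffeoGerm ψ) :
    Tendsto ψ (𝓝 0) (𝓝 0) := by
  have := h.analyticAt.continuousAt.tendsto
  rwa [h.map_zero] at this

theorem jac_id (p : Plane) : jac (fun p => p) p = 1 := by
  simp [jac]

theorem IsDiffeoGerm.exists_inverse {ψ : Plane → Plane} (h : IsDiffeoGerm ψ) :
    ∃ φ, IsDiffeoGerm φ ∧ (∀ᶠ p in 𝓝 (0 : Plane), φ (ψ p) = p) ∧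
      (∀ᶠ p in 𝓝 (0 : Plane), ψ (φ p) = p) ∧ jac ψ 0 * jac φ 0 = 1 := by
  obtain ⟨h1, h2, φ, h3, h4, h5, h6⟩ := h
  refine ⟨φ, ⟨h3, h4, ψ, h1, h2, h6, h5⟩, h5, h6, ?_⟩
  have h7 : jac (ψ ∘ φ) 0 = 1 := by
    rw [show jac (ψ ∘ φ) 0 = jac (fun p => p) 0 from jac_congr h6, jac_id]
  rw [jac_comp (by rw [h4]; exact h1.differentiableAt) h3.differentiableAt, h4] at h7
  exact h7

theorem IsDiffeoGerm.jac_ne_zero {ψ : Plane → Plane} (h : IsDiffeoGerm ψ) : jac ψ 0 ≠ 0 := by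
  obtain ⟨φ, -, -, -, h1⟩ := h.exists_inverse
  exact left_ne_zero_of_mul_eq_one h1

theorem IsDiffeoGerm.comp {ψ φ : Plane → Plane} (hψ : IsDiffeoGerm ψ) (hφ : IsDiffeoGerm φ) :
    IsDiffeoGerm (ψ ∘ φ) := by
  refine isDiffeoGerm_of_jac_ne_zero ?_ (by simp [hφ.map_zero, hψ.map_zero]) ?_
  · exact AnalyticAt.comp (by rw [hφ.map_zero]; exact hψ.analyticAt) hφ.analyticAt
  · rw [jac_comp (by rw [hφ.map_zero]; exact hψ.analyticAt.differentiableAt)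
      hφ.analyticAt.differentiableAt, hφ.map_zero]
    exact mul_ne_zero hψ.jac_ne_zero hφ.jac_ne_zero

/-- The coefficient of a two-form with respect to `dξ ∧ dx`. -/
def density (ω : TwoForm) (p : Plane) : ℝ := ω p ![(0, 1), (1, 0)]

/-- An alternating form is determined by its values on injective families of basis vectors; in the
plane these are the two orderings of the basis, related by a sign. -/
theorem alternating_eq_smul (A : Plane [⋀^Fin 2]→L[ℝ] ℝ) :
    A = A ![(0, 1), (1, 0)] • dXiDx := by
  have h : A.toAlternatingMap = (A ![(0, 1), (1, 0)] • dXiDx).toAlternatingMap := by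
    refine Module.Basis.ext_alternating (Module.Basis.finTwoProd ℝ) fun v hv => ?_
    have hv' : v 0 ≠ v 1 := fun h => by simpa using hv h
    have hsw : A ![(1, 0), (0, 1)] = -A ![(0, 1), (1, 0)] := by
      have := A.toAlternatingMap.map_swap (![(0, 1), (1, 0)] : Fin 2 → Plane) Fin.zero_ne_one
      have e : (![(0, 1), (1, 0)] : Fin 2 → Plane) ∘ Equiv.swap (0 : Fin 2) 1 = ![(1, 0), (0, 1)] := by
        ext i <;> fin_cases i <;> simp
      rw [e] at this
      exact this
    have hve : (fun i => Module.Basis.finTwoProd ℝ (v i)) =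
        ![Module.Basis.finTwoProd ℝ (v 0), Module.Basis.finTwoProd ℝ (v 1)] := by
      ext i <;> fin_cases i <;> rfl
    rw [hve]
    change A _ = A ![(0, 1), (1, 0)] * dXiDx _
    rw [dXiDx_apply]
    generalize v 0 = i at hv' ⊢
    generalize v 1 = j at hv' ⊢
    fin_cases i <;> fin_cases j <;> simp_all
  ext v
  exact congrArg (fun B => B v) h

theorem eq_density_smul (ω : TwoForm) (p : Plane) : ω p = density ω p • dXiDx :=
  alternating_eq_smul _

theorem density_smul (f : Plane → ℝ) : density (fun p => f p • dXiDx) = f := by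
  ext p
  simp [density, dXiDx_apply]

theorem eventuallyEq_of_density {ω ω' : TwoForm} (h : density ω =ᶠ[𝓝 0] density ω') :
    ω =ᶠ[𝓝 0] ω' := by
  filter_upwards [h] with p hp
  rw [eq_density_smul ω, eq_density_smul ω', hp]

theorem density_congr {ω ω' : TwoForm} (h : ω =ᶠ[𝓝 0] ω') : density ω =ᶠ[𝓝 0] density ω' := by
  filter_upwards [h] with p hp
  rw [density, density, hp]

theorem density_pullback (ψ : Plane → Plane) (ω : TwoForm) (p : Plane) :
    density (pullback ψ ω) p = density ω (ψ p) * jac ψ p := by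
  have h : density (pullback ψ ω) p =
      ω (ψ p) (fderiv ℝ ψ p ∘ ![(0, 1), (1, 0)]) := rfl
  rw [h, eq_density_smul ω]
  change _ * dXiDx _ = _
  rw [dXiDx_apply, jac]
  simp
  left
  ring

theorem analyticAt_density {ω : TwoForm} (h : AnalyticAt ℝ ω 0) : AnalyticAt ℝ (density ω) 0 := by
  let L : (Plane [⋀^Fin 2]→L[ℝ] ℝ) →L[ℝ] ℝ :=
    (ContinuousMultilinearMap.apply ℝ (fun _ : Fin 2 => Plane) ℝ ![(0, 1), (1, 0)]).comp
      (ContinuousAlternatingMap.toContinuousMultilinearMapCLM ℝ)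
  exact (L.analyticAt _).comp h

/-! ### Moving along the level curves of the Hamiltonian -/

theorem eventually_eq_of_hasDerivAt_zero {g : ℝ × Plane → ℝ}
    (h : ∀ᶠ z in 𝓝 (0 : ℝ × Plane), HasDerivAt (fun s => g (s, z.2)) 0 z.1) :
    ∀ᶠ z in 𝓝 (0 : ℝ × Plane), g z = g (0, z.2) := by
  obtain ⟨τ, hτ, hb⟩ := Metric.eventually_nhds_iff_ball.1 h
  filter_upwards [Metric.ball_mem_nhds (0 : ℝ × Plane) hτ] with z hz
  rw [mem_ball_zero_iff, Prod.norm_def, max_lt_iff] at hz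
  have hd : ∀ s ∈ Metric.ball (0 : ℝ) τ, HasDerivAt (fun s => g (s, z.2)) 0 s := fun s hs => by
    refine hb (s, z.2) ?_
    rw [mem_ball_zero_iff] at hs
    rw [mem_ball_zero_iff, Prod.norm_def, max_lt_iff]
    exact ⟨hs, hz.2⟩
  have := (convex_ball (0 : ℝ) τ).is_const_of_fderivWithin_eq_zero (𝕜 := ℝ)
    (f := fun s => g (s, z.2)) (fun s hs => (hd s hs).differentiableAt.differentiableWithinAt)
    (fun s hs => by
      rw [fderivWithin_of_isOpen Metric.isOpen_ball hs]
      ext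
      simpa using (hd s hs).deriv)
    (mem_ball_zero_iff.2 hz.1) (Metric.mem_ball_self hτ)
  exact this

theorem hasDerivAt_prodMk_left_const {E : Type*} [NormedAddCommGroup E] [NormedSpace ℝ E]
    (z : ℝ × E) : HasDerivAt (fun s => ((s, z.2) : ℝ × E)) (1, 0) z.1 :=
  (hasDerivAt_id z.1).prodMk (hasDerivAt_const _ _)

/-- Symmetry of the second derivative exchanges time and space; it remains to differentiate ∂_sΦ = Y
∘ Φ in a space direction. -/
theorem fderiv_fderiv_flow {E : Type*} [NormedAddCommGroup E] [NormedSpace ℝ E]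
    [CompleteSpace E] {Y : E → E} {Φ : ℝ × E → E} {z : ℝ × E} (hY : DifferentiableAt ℝ Y (Φ z))
    (hΦ : AnalyticAt ℝ Φ z) (htime : ∀ᶠ w in 𝓝 z, fderiv ℝ Φ w (1, 0) = Y (Φ w)) (v : E) :
    fderiv ℝ (fderiv ℝ Φ) z (1, 0) (0, v) = fderiv ℝ Y (Φ z) (fderiv ℝ Φ z (0, v)) := by
  have hD : DifferentiableAt ℝ (fderiv ℝ Φ) z := hΦ.fderiv.differentiableAt
  have hsymm : IsSymmSndFDerivAt ℝ Φ z := (hΦ.contDiffAt (n := ⊤)).isSymmSndFDerivAt (by simp)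
  rw [hsymm.eq]
  have h4 : HasFDerivAt (fun w => fderiv ℝ Φ w (1, 0))
      ((fderiv ℝ (fderiv ℝ Φ) z).flip (1, 0)) z :=
    (((ContinuousLinearMap.apply ℝ E ((1, 0) : ℝ × E)).hasFDerivAt).comp z hD.hasFDerivAt :)
  have h5 : HasFDerivAt (fun w => Y (Φ w)) ((fderiv ℝ Y (Φ z)).comp (fderiv ℝ Φ z)) z :=
    hY.hasFDerivAt.comp z hΦ.differentiableAt.hasFDerivAt
  have h6 := h4.unique (h5.congr_of_eventuallyEq htime)
  exact congrArg (fun A : ℝ × E →L[ℝ] E => A (0, v)) h6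

theorem hasDerivAt_fderiv_time {E : Type*} [NormedAddCommGroup E] [NormedSpace ℝ E]
    [CompleteSpace E] {Φ : ℝ × E → E} {z : ℝ × E} (hΦ : AnalyticAt ℝ Φ z) (v : E) :
    HasDerivAt (fun s => fderiv ℝ Φ (s, z.2) (0, v)) (fderiv ℝ (fderiv ℝ Φ) z (1, 0) (0, v))
      z.1 := by
  have h1 : HasFDerivAt (fun w => fderiv ℝ Φ w (0, v))
      ((fderiv ℝ (fderiv ℝ Φ) z).flip (0, v)) z :=
    (((ContinuousLinearMap.apply ℝ E ((0, v) : ℝ × E)).hasFDerivAt).comp z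
      hΦ.fderiv.differentiableAt.hasFDerivAt :)
  exact h1.comp_hasDerivAt z.1 (hasDerivAt_prodMk_left_const z)

/-- The equation of variations of a local flow. -/
theorem eventually_hasDerivAt_fderiv_flow {E : Type*} [NormedAddCommGroup E] [NormedSpace ℝ E]
    [CompleteSpace E] {Y : E → E} (hY : AnalyticAt ℝ Y 0)
    {Φ : ℝ × E → E} (hΦ : AnalyticAt ℝ Φ 0) (hΦ0 : Φ 0 = 0)
    (hflow : ∀ᶠ z in 𝓝 (0 : ℝ × E), HasDerivAt (fun s => Φ (s, z.2)) (Y (Φ z)) z.1)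
    (v : E) :
    ∀ᶠ z in 𝓝 (0 : ℝ × E), HasDerivAt (fun s => fderiv ℝ Φ (s, z.2) (0, v))
      (fderiv ℝ Y (Φ z) (fderiv ℝ Φ z (0, v))) z.1 := by
  have htime : ∀ᶠ z in 𝓝 (0 : ℝ × E), fderiv ℝ Φ z (1, 0) = Y (Φ z) := by
    filter_upwards [hflow, hΦ.eventually_analyticAt] with z h1 h2
    exact (h2.differentiableAt.hasFDerivAt.comp_hasDerivAt z.1
      (hasDerivAt_prodMk_left_const z)).unique h1
  have hΦt : Tendsto Φ (𝓝 0) (𝓝 0) := by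
    have := hΦ.continuousAt.tendsto
    rwa [hΦ0] at this
  filter_upwards [htime.eventually_nhds, hΦ.eventually_analyticAt,
    hΦt.eventually hY.eventually_analyticAt] with z h1 h2 h3
  rw [← fderiv_fderiv_flow h3.differentiableAt h2 h1]
  exact hasDerivAt_fderiv_time h2 v

/-- If `f - n` is a Hamiltonian derivative, then moving along the level curves of `ξ² + ε x ^ k`
carries `f dξ ∧ dx` to `n dξ ∧ dx`. -/
theorem exists_level_preserving_diffeo {k : ℕ} (hk : 2 ≤ k) (ε : ℝ) {f η : Plane → ℝ}
    (hf : AnalyticAt ℝ f 0) (hf0 : f 0 ≠ 0) (hη : AnalyticAt ℝ η 0) :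
    ∃ ψ : Plane → Plane, IsDiffeoGerm ψ ∧ jac ψ 0 = 1 ∧
      (modelH k ε ∘ ψ) =ᶠ[𝓝 0] modelH k ε ∧
      ∀ᶠ p in 𝓝 (0 : Plane), f (ψ p) * jac ψ p = f p - hamD k ε η p := by
  have hk1 : k - 1 ≠ 0 := by omega
  -- Up to the sign convention, (P, Q) is the Hamiltonian field of H for the area form f dξ∧dx.
  let P : Plane → ℝ := fun p => 2 * p.2 / f p
  let Q : Plane → ℝ := fun p => -(ε * k * p.1 ^ (k - 1)) / f p
  have hP : AnalyticAt ℝ P 0 := (analyticAt_const.mul analyticAt_snd).div hf hf0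
  have hQ : AnalyticAt ℝ Q 0 := (analyticAt_const.mul (analyticAt_fst.pow _)).neg.div hf hf0
  let Y : Plane → Plane := fun p => (P p, Q p)
  have hY : AnalyticAt ℝ Y 0 := hP.prod hQ
  obtain ⟨Φ, hΦ, hinit, hflow⟩ := exists_analytic_flow hY
  have hΦ0 : Φ 0 = 0 := hinit.self_of_nhds
  have hΦt : Tendsto Φ (𝓝 0) (𝓝 0) := by
    have := hΦ.continuousAt.tendsto
    rwa [hΦ0] at this
  have hfne : ∀ᶠ p in 𝓝 (0 : Plane), f p ≠ 0 := hf.continuousAt.eventually_ne hf0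
  have hsnd : Tendsto (fun z : ℝ × Plane => z.2) (𝓝 0) (𝓝 0) := continuous_snd.tendsto' _ _ rfl
  -- conservation of the Hamiltonian
  have hH : ∀ᶠ z in 𝓝 (0 : ℝ × Plane), modelH k ε (Φ z) = modelH k ε z.2 := by
    have h1 : ∀ᶠ z in 𝓝 (0 : ℝ × Plane),
        HasDerivAt (fun s => modelH k ε (Φ (s, z.2))) 0 z.1 := by
      filter_upwards [hflow] with z hz
      refine ((hasFDerivAt_modelH k ε (Φ z)).comp_hasDerivAt z.1 hz).congr_deriv ?_
      simp [Y, P, Q]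
      ring
    filter_upwards [eventually_eq_of_hasDerivAt_zero (g := fun z => modelH k ε (Φ z)) h1,
      hsnd.eventually hinit] with z h2 h3
    rw [h2, h3]
  -- conservation of the area form
  let Dx : ℝ × Plane → Plane := fun z => fderiv ℝ Φ z (0, (1, 0))
  let Dy : ℝ × Plane → Plane := fun z => fderiv ℝ Φ z (0, (0, 1))
  have hL : ∀ᶠ z in 𝓝 (0 : ℝ × Plane),
      f (Φ z) * ((Dx z).1 * (Dy z).2 - (Dy z).1 * (Dx z).2) = f z.2 := by
    have h1 : ∀ᶠ z in 𝓝 (0 : ℝ × Plane), HasDerivAt (fun s => f (Φ (s, z.2)) *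
        ((Dx (s, z.2)).1 * (Dy (s, z.2)).2 - (Dy (s, z.2)).1 * (Dx (s, z.2)).2)) 0 z.1 := by
      filter_upwards [hflow, eventually_hasDerivAt_fderiv_flow hY hΦ hΦ0 hflow (1, 0),
        eventually_hasDerivAt_fderiv_flow hY hΦ hΦ0 hflow (0, 1), hΦt.eventually hfne,
        hΦt.eventually hf.eventually_analyticAt, hΦt.eventually hP.eventually_analyticAt,
        hΦt.eventually hQ.eventually_analyticAt, hΦt.eventually hfne.eventually_nhds]
        with z e1 e2 e3 e4 a1 a2 a3 e5
      have d1 : HasDerivAt (fun s => f (Φ (s, z.2))) _ z.1 :=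
        a1.differentiableAt.hasFDerivAt.comp_hasDerivAt z.1 e1
      have dx1 : HasDerivAt (fun s => (Dx (s, z.2)).1) _ z.1 :=
        hasFDerivAt_fst.comp_hasDerivAt z.1 e2
      have dx2 : HasDerivAt (fun s => (Dx (s, z.2)).2) _ z.1 :=
        hasFDerivAt_snd.comp_hasDerivAt z.1 e2
      have dy1 : HasDerivAt (fun s => (Dy (s, z.2)).1) _ z.1 :=
        hasFDerivAt_fst.comp_hasDerivAt z.1 e3
      have dy2 : HasDerivAt (fun s => (Dy (s, z.2)).2) _ z.1 :=
        hasFDerivAt_snd.comp_hasDerivAt z.1 e3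
      refine (d1.fun_mul ((dx1.fun_mul dy2).fun_sub (dy1.fun_mul dx2))).congr_deriv ?_
      have hYd : ∀ w : Plane, fderiv ℝ Y (Φ z) w =
          (fderiv ℝ P (Φ z) w, fderiv ℝ Q (Φ z) w) := fun w => by
        rw [show fderiv ℝ Y (Φ z) = _ from (a2.differentiableAt.hasFDerivAt.prodMk
          a3.differentiableAt.hasFDerivAt).fderiv]
        rfl
      -- The product fP = 2ξ does not involve x, and fQ does not involve ξ. The two resulting
      -- identities add up to div(fY) = 0, the infinitesimal form of area preservation.
      have hfP : f (Φ z) * fderiv ℝ P (Φ z) (1, 0) + P (Φ z) * fderiv ℝ f (Φ z) (1, 0) = 0 := by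
        have h2 : (fun p => f p * P p) =ᶠ[𝓝 (Φ z)] fun p => 2 * p.2 := by
          filter_upwards [e5] with p hp
          simp only [P]
          field_simp
        have h3 := h2.fderiv_eq (𝕜 := ℝ)
        rw [fderiv_fun_mul a1.differentiableAt a2.differentiableAt,
          ((hasFDerivAt_snd (𝕜 := ℝ) (p := Φ z)).const_mul 2).fderiv] at h3
        simpa using congrArg (fun A : Plane →L[ℝ] ℝ => A (1, 0)) h3
      have hfQ : f (Φ z) * fderiv ℝ Q (Φ z) (0, 1) + Q (Φ z) * fderiv ℝ f (Φ z) (0, 1) = 0 := by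
        have h2 : (fun p => f p * Q p) =ᶠ[𝓝 (Φ z)] fun p => (-(ε * k)) * p.1 ^ (k - 1) := by
          filter_upwards [e5] with p hp
          simp only [Q]
          field_simp
        have h3 := h2.fderiv_eq (𝕜 := ℝ)
        rw [fderiv_fun_mul a1.differentiableAt a3.differentiableAt,
          (((hasFDerivAt_fst (𝕜 := ℝ) (p := Φ z)).pow (k - 1)).const_mul (-(ε * k))).fderiv] at h3
        simpa using congrArg (fun A : Plane →L[ℝ] ℝ => A (0, 1)) h3
      simp only [ContinuousLinearMap.coe_fst', ContinuousLinearMap.coe_snd', hYd]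
      rw [fderiv_apply_eq f _ (Y (Φ z)), fderiv_apply_eq P _ (fderiv ℝ Φ z (0, (1, 0))),
        fderiv_apply_eq P _ (fderiv ℝ Φ z (0, (0, 1))),
        fderiv_apply_eq Q _ (fderiv ℝ Φ z (0, (1, 0))),
        fderiv_apply_eq Q _ (fderiv ℝ Φ z (0, (0, 1)))]
      simp only [Y, Dx, Dy, Prod.mk.eta]
      linear_combination ((fderiv ℝ Φ z (0, (1, 0))).1 * (fderiv ℝ Φ z (0, (0, 1))).2 -
        (fderiv ℝ Φ z (0, (0, 1))).1 * (fderiv ℝ Φ z (0, (1, 0))).2) * (hfP + hfQ)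
    have hline : ∀ p : Plane, HasFDerivAt (fun p : Plane => ((0, p) : ℝ × Plane))
        (ContinuousLinearMap.inr ℝ ℝ Plane) p := fun p => hasFDerivAt_prodMk_right 0 p
    have hc : Tendsto (fun p : Plane => ((0, p) : ℝ × Plane)) (𝓝 0) (𝓝 0) :=
      (continuous_const.prodMk continuous_id).tendsto' _ _ rfl
    have h2 : ∀ᶠ p in 𝓝 (0 : Plane), ∀ v, fderiv ℝ Φ (0, p) (0, v) = v := by
      filter_upwards [hinit.eventually_nhds, hc.eventually hΦ.eventually_analyticAt] with p h3 h4 v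
      have h5 := (h4.differentiableAt.hasFDerivAt.comp p (hline p)).unique
        ((hasFDerivAt_id p).congr_of_eventuallyEq h3)
      exact congrArg (fun A : Plane →L[ℝ] Plane => A v) h5
    filter_upwards [eventually_eq_of_hasDerivAt_zero (g := fun z => f (Φ z) *
      ((Dx z).1 * (Dy z).2 - (Dy z).1 * (Dx z).2)) h1, hsnd.eventually hinit, hsnd.eventually h2] with z h3 h4 h5
    rw [h3, h4]
    simp [Dx, Dy, h5]
  -- the diffeomorphism
  let σ : Plane → ℝ := fun p => η 0 - η p
  have hσ : AnalyticAt ℝ σ 0 := analyticAt_const.sub hη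
  let ι : Plane → ℝ × Plane := fun p => (σ p, p)
  have hι : AnalyticAt ℝ ι 0 := hσ.prod analyticAt_id
  have hι0 : ι 0 = 0 := by simp [ι, σ]
  have hιt : Tendsto ι (𝓝 0) (𝓝 0) := by
    have := hι.continuousAt.tendsto
    rwa [hι0] at this
  let ψ : Plane → Plane := fun p => Φ (ι p)
  have hψ : AnalyticAt ℝ ψ 0 := AnalyticAt.comp (g := Φ) (by rwa [hι0]) hι
  have hψ0 : ψ 0 = 0 := by simp only [ψ, hι0, hΦ0]
  have hjac : ∀ᶠ p in 𝓝 (0 : Plane), f (ψ p) * jac ψ p = f p - hamD k ε η p := by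
    have hline : ∀ z : ℝ × Plane, HasDerivAt (fun s => ((s, z.2) : ℝ × Plane)) (1, 0) z.1 :=
      fun z => (hasDerivAt_id z.1).prodMk (hasDerivAt_const _ _)
    filter_upwards [hιt.eventually hL, hιt.eventually hflow, hιt.eventually hH.eventually_nhds,
      hιt.eventually hΦ.eventually_analyticAt, hη.eventually_analyticAt,
      (hΦt.comp hιt).eventually hfne] with p e1 e2 e3 a1 a2 e4
    have ht : fderiv ℝ Φ (ι p) (1, 0) = Y (ψ p) :=
      (a1.differentiableAt.hasFDerivAt.comp_hasDerivAt _ (hline (ι p))).unique e2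
    have hσd : HasFDerivAt σ (-fderiv ℝ η p) p := by
      simpa using a2.differentiableAt.hasFDerivAt.const_sub (η 0)
    have hψd : HasFDerivAt ψ _ p :=
      HasFDerivAt.comp (g := Φ) p a1.differentiableAt.hasFDerivAt (hσd.prodMk (hasFDerivAt_id p))
    -- Dψ differs from the space derivative of Φ by a rank-one term along Y, so the Jacobian of ψ is
    -- affine in dη.
    have hv : ∀ v : Plane, fderiv ℝ ψ p v =
        (-fderiv ℝ η p v) • Y (ψ p) + fderiv ℝ Φ (ι p) (0, v) := fun v => by
      rw [hψd.fderiv, ← ht, ← map_smul, ← map_add]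
      simp
    -- The components of fY at ψ(p) are, up to sign, those of dH there. Conservation of H carries
    -- them back to dH at p, which turns the rank-one correction into −Dη.
    have hHd : ∀ v : Plane, 2 * (ψ p).2 * (fderiv ℝ Φ (ι p) (0, v)).2 +
        ε * k * (ψ p).1 ^ (k - 1) * (fderiv ℝ Φ (ι p) (0, v)).1 =
        2 * p.2 * v.2 + ε * k * p.1 ^ (k - 1) * v.1 := fun v => by
      have h1 : HasFDerivAt (fun z => modelH k ε (Φ z)) _ (ι p) :=
        (hasFDerivAt_modelH k ε (ψ p)).comp (ι p) a1.differentiableAt.hasFDerivAt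
      have h2 : HasFDerivAt (fun z : ℝ × Plane => modelH k ε z.2) _ (ι p) :=
        (hasFDerivAt_modelH k ε (ι p).2).comp (ι p) hasFDerivAt_snd
      have h3 := h1.unique (h2.congr_of_eventuallyEq e3)
      simpa using congrArg (fun A : ℝ × Plane →L[ℝ] ℝ => A (0, v)) h3
    have hx := hHd (1, 0)
    have hy := hHd (0, 1)
    have e1' : f (ψ p) * ((Dx (ι p)).1 * (Dy (ι p)).2 - (Dy (ι p)).1 * (Dx (ι p)).2) = f p := e1
    have e4' : f (ψ p) ≠ 0 := e4
    have hPf : f (ψ p) * P (ψ p) = 2 * (ψ p).2 := by simp only [P]; field_simp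
    have hQf : f (ψ p) * Q (ψ p) = -(ε * k * (ψ p).1 ^ (k - 1)) := by simp only [Q]; field_simp
    rw [jac, hv, hv, hamD]
    simp only [Y, Dx, Dy, Prod.fst_add, Prod.snd_add, Prod.smul_fst, Prod.smul_snd, smul_eq_mul,
      mul_one, mul_zero, add_zero, zero_add] at hx hy e1' ⊢
    linear_combination e1' - fderiv ℝ η p (1, 0) * hy + fderiv ℝ η p (0, 1) * hx +
      (-fderiv ℝ η p (1, 0) * (fderiv ℝ Φ (ι p) (0, (0, 1))).2 +
        fderiv ℝ η p (0, 1) * (fderiv ℝ Φ (ι p) (0, (1, 0))).2) * hPf +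
      (fderiv ℝ η p (1, 0) * (fderiv ℝ Φ (ι p) (0, (0, 1))).1 -
        fderiv ℝ η p (0, 1) * (fderiv ℝ Φ (ι p) (0, (1, 0))).1) * hQf
  have hj1 : jac ψ 0 = 1 := by
    have h1 := hjac.self_of_nhds
    rw [hψ0] at h1
    simp only [hamD, Prod.snd_zero, Prod.fst_zero, zero_pow hk1, mul_zero, zero_mul, sub_zero] at h1
    exact mul_left_cancel₀ hf0 (h1.trans (mul_one _).symm)
  refine ⟨ψ, isDiffeoGerm_of_jac_ne_zero hψ hψ0 (by rw [hj1]; exact one_ne_zero), hj1, ?_, hjac⟩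
  exact hιt.eventually hH

/-! ### The differential ring of analytic germs -/

/-- Germs at the origin of analytic functions, as a subring of all germs of functions. -/
def analyticGerms : Subring (Germ (𝓝 (0 : Plane)) ℝ) where
  carrier := {g | ∃ f : Plane → ℝ, AnalyticAt ℝ f 0 ∧ (f : Germ (𝓝 (0 : Plane)) ℝ) = g}
  mul_mem' := by
    rintro _ _ ⟨f, hf, rfl⟩ ⟨g, hg, rfl⟩
    exact ⟨f * g, hf.mul hg, rfl⟩
  one_mem' := ⟨fun _ => 1, analyticAt_const, rfl⟩
  add_mem' := by
    rintro _ _ ⟨f, hf, rfl⟩ ⟨g, hg, rfl⟩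
    exact ⟨f + g, hf.add hg, rfl⟩
  zero_mem' := ⟨fun _ => 0, analyticAt_const, rfl⟩
  neg_mem' := by
    rintro _ ⟨f, hf, rfl⟩
    exact ⟨-f, hf.neg, rfl⟩

/-- The ring of germs at the origin of analytic functions on the plane. -/
def AGerm : Type := analyticGerms

instance : CommRing AGerm := inferInstanceAs (CommRing analyticGerms)

namespace AGerm

/-- The germ of an analytic function. -/
def mk (f : Plane → ℝ) (hf : AnalyticAt ℝ f 0) : AGerm := ⟨f, f, hf, rfl⟩

theorem mk_eq_iff {f g : Plane → ℝ} {hf : AnalyticAt ℝ f 0} {hg : AnalyticAt ℝ g 0} :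
    mk f hf = mk g hg ↔ f =ᶠ[𝓝 0] g :=
  Subtype.ext_iff.trans Germ.coe_eq

theorem exists_rep (a : AGerm) : ∃ (f : Plane → ℝ) (hf : AnalyticAt ℝ f 0), mk f hf = a := by
  obtain ⟨_, f, hf, rfl⟩ := a
  exact ⟨f, hf, rfl⟩

theorem mk_add {f g : Plane → ℝ} (hf : AnalyticAt ℝ f 0) (hg : AnalyticAt ℝ g 0) :
    mk f hf + mk g hg = mk (fun p => f p + g p) (hf.add hg) := rfl

theorem mk_mul {f g : Plane → ℝ} (hf : AnalyticAt ℝ f 0) (hg : AnalyticAt ℝ g 0) :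
    mk f hf * mk g hg = mk (fun p => f p * g p) (hf.mul hg) := rfl

theorem one_eq : (1 : AGerm) = mk (fun _ => 1) analyticAt_const := rfl

theorem zero_eq : (0 : AGerm) = mk (fun _ => 0) analyticAt_const := rfl

theorem mk_pow {f : Plane → ℝ} (hf : AnalyticAt ℝ f 0) (m : ℕ) :
    mk f hf ^ m = mk (fun p => f p ^ m) (hf.pow m) := by
  induction m with
  | zero => simp only [pow_zero]; rfl
  | succ m ih => simp only [pow_succ, ih]; rfl

/-- Constant germs. -/
def const : ℝ →+* AGerm where
  toFun r := mk (fun _ => r) analyticAt_const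
  map_one' := rfl
  map_mul' _ _ := rfl
  map_zero' := rfl
  map_add' _ _ := rfl

instance : Algebra ℝ AGerm := const.toAlgebra

theorem algebraMap_eq (r : ℝ) : algebraMap ℝ AGerm r = mk (fun _ => r) analyticAt_const := rfl

/-- A function representing a germ. -/
def rep (a : AGerm) : Plane → ℝ := (exists_rep a).choose

theorem analyticAt_rep (a : AGerm) : AnalyticAt ℝ (rep a) 0 := (exists_rep a).choose_spec.choose

theorem mk_rep (a : AGerm) : mk (rep a) (analyticAt_rep a) = a :=
  (exists_rep a).choose_spec.choose_spec

theorem rep_mk {f : Plane → ℝ} (hf : AnalyticAt ℝ f 0) : rep (mk f hf) =ᶠ[𝓝 0] f :=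
  mk_eq_iff.1 (mk_rep (mk f hf))

theorem analyticAt_fderiv_apply {f : Plane → ℝ} (hf : AnalyticAt ℝ f 0) (v : Plane) :
    AnalyticAt ℝ (fun p => fderiv ℝ f p v) 0 :=
  ((ContinuousLinearMap.apply ℝ ℝ v).analyticAt _).comp hf.fderiv

/-- The value of a germ at the origin. -/
def eval : AGerm →ₐ[ℝ] ℝ where
  toFun a := rep a 0
  map_one' := (rep_mk analyticAt_const).self_of_nhds
  map_mul' a b := by
    obtain ⟨f, hf, rfl⟩ := exists_rep a
    obtain ⟨g, hg, rfl⟩ := exists_rep b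
    rw [mk_mul, (rep_mk _).self_of_nhds, (rep_mk _).self_of_nhds, (rep_mk _).self_of_nhds]
  map_zero' := (rep_mk analyticAt_const).self_of_nhds
  map_add' a b := by
    obtain ⟨f, hf, rfl⟩ := exists_rep a
    obtain ⟨g, hg, rfl⟩ := exists_rep b
    rw [mk_add, (rep_mk _).self_of_nhds, (rep_mk _).self_of_nhds, (rep_mk _).self_of_nhds]
  commutes' r := (rep_mk analyticAt_const).self_of_nhds

theorem eval_mk {f : Plane → ℝ} (hf : AnalyticAt ℝ f 0) : eval (mk f hf) = f 0 :=
  (rep_mk hf).self_of_nhds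

theorem mk_fderiv_congr {f g : Plane → ℝ} (hf : AnalyticAt ℝ f 0) (hg : AnalyticAt ℝ g 0)
    (h : f =ᶠ[𝓝 0] g) (v : Plane) :
    mk (fun p => fderiv ℝ f p v) (analyticAt_fderiv_apply hf v) =
      mk (fun p => fderiv ℝ g p v) (analyticAt_fderiv_apply hg v) := by
  rw [mk_eq_iff]
  filter_upwards [h.fderiv (𝕜 := ℝ)] with p hp
  rw [hp]

/-- The germ of the derivative in direction `v`. -/
def derivGerm (v : Plane) (a : AGerm) : AGerm :=
  mk (fun p => fderiv ℝ (rep a) p v) (analyticAt_fderiv_apply (analyticAt_rep a) v)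

theorem derivGerm_mk (v : Plane) {f : Plane → ℝ} (hf : AnalyticAt ℝ f 0) :
    derivGerm v (mk f hf) = mk (fun p => fderiv ℝ f p v) (analyticAt_fderiv_apply hf v) :=
  mk_fderiv_congr (analyticAt_rep _) hf (rep_mk hf) v

theorem derivGerm_mul (v : Plane) (a b : AGerm) :
    derivGerm v (a * b) = a * derivGerm v b + b * derivGerm v a := by
  obtain ⟨f, hf, rfl⟩ := exists_rep a
  obtain ⟨g, hg, rfl⟩ := exists_rep b
  rw [mk_mul, derivGerm_mk, derivGerm_mk, derivGerm_mk, mk_mul, mk_mul, mk_add, mk_eq_iff]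
  filter_upwards [hf.eventually_analyticAt, hg.eventually_analyticAt] with p h1 h2
  rw [fderiv_fun_mul h1.differentiableAt h2.differentiableAt]
  rfl

theorem derivGerm_add (v : Plane) (a b : AGerm) :
    derivGerm v (a + b) = derivGerm v a + derivGerm v b := by
  obtain ⟨f, hf, rfl⟩ := exists_rep a
  obtain ⟨g, hg, rfl⟩ := exists_rep b
  rw [mk_add, derivGerm_mk, derivGerm_mk, derivGerm_mk, mk_add, mk_eq_iff]
  filter_upwards [hf.eventually_analyticAt, hg.eventually_analyticAt] with p h1 h2
  rw [fderiv_fun_add h1.differentiableAt h2.differentiableAt]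
  rfl

theorem derivGerm_const (v : Plane) (r : ℝ) : derivGerm v (algebraMap ℝ AGerm r) = 0 := by
  rw [algebraMap_eq, derivGerm_mk, zero_eq, mk_eq_iff]
  exact Eventually.of_forall fun p => by simp

/-- The directional derivative of germs. -/
def dirDeriv (v : Plane) : Derivation ℝ AGerm AGerm :=
  Derivation.mk'
    { toFun := derivGerm v
      map_add' := derivGerm_add v
      map_smul' := fun r a => by
        rw [RingHom.id_apply, Algebra.smul_def, Algebra.smul_def, derivGerm_mul, derivGerm_const,
          mul_zero, add_zero] }
    (derivGerm_mul v)

theorem dirDeriv_mk {f : Plane → ℝ} (hf : AnalyticAt ℝ f 0) (v : Plane) :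
    dirDeriv v (mk f hf) = mk (fun p => fderiv ℝ f p v) (analyticAt_fderiv_apply hf v) :=
  derivGerm_mk v hf

theorem dirDeriv_comm (v w : Plane) (a : AGerm) :
    dirDeriv v (dirDeriv w a) = dirDeriv w (dirDeriv v a) := by
  obtain ⟨f, hf, rfl⟩ := exists_rep a
  simp only [dirDeriv_mk]
  rw [mk_eq_iff]
  filter_upwards [hf.eventually_analyticAt] with p h1
  have hd : ∀ u : Plane, HasFDerivAt (fun p => fderiv ℝ f p u) ((fderiv ℝ (fderiv ℝ f) p).flip u) p :=
    fun u => (((ContinuousLinearMap.apply ℝ ℝ u).hasFDerivAt).comp p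
      h1.fderiv.differentiableAt.hasFDerivAt :)
  rw [(hd w).fderiv, (hd v).fderiv]
  exact ((h1.contDiffAt (n := ⊤)).isSymmSndFDerivAt (by simp)).eq v w

/-- The derivation `∂/∂x`. -/
def dx : Derivation ℝ AGerm AGerm := dirDeriv (1, 0)

/-- The derivation `∂/∂ξ`. -/
def dy : Derivation ℝ AGerm AGerm := dirDeriv (0, 1)

/-- The germ of the coordinate `x`. -/
def x : AGerm := mk (fun p => p.1) analyticAt_fst

/-- The germ of the coordinate `ξ`. -/
def y : AGerm := mk (fun p => p.2) analyticAt_snd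

theorem dy_dx (a : AGerm) : dy (dx a) = dx (dy a) := dirDeriv_comm _ _ a

theorem fderiv_fst_eq (p : Plane) :
    fderiv ℝ (fun p : Plane => p.1) p = ContinuousLinearMap.fst ℝ ℝ ℝ := hasFDerivAt_fst.fderiv

theorem fderiv_snd_eq (p : Plane) :
    fderiv ℝ (fun p : Plane => p.2) p = ContinuousLinearMap.snd ℝ ℝ ℝ := hasFDerivAt_snd.fderiv

@[simp] theorem dx_x : dx x = 1 := by
  refine (dirDeriv_mk _ _).trans ?_
  rw [one_eq, mk_eq_iff]
  refine Eventually.of_forall fun p => ?_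
  simp only [fderiv_fst_eq]
  rfl

@[simp] theorem dy_x : dy x = 0 := by
  refine (dirDeriv_mk _ _).trans ?_
  rw [zero_eq, mk_eq_iff]
  refine Eventually.of_forall fun p => ?_
  simp only [fderiv_fst_eq]
  rfl

@[simp] theorem dx_y : dx y = 0 := by
  refine (dirDeriv_mk _ _).trans ?_
  rw [zero_eq, mk_eq_iff]
  refine Eventually.of_forall fun p => ?_
  simp only [fderiv_snd_eq]
  rfl

@[simp] theorem dy_y : dy y = 1 := by
  refine (dirDeriv_mk _ _).trans ?_
  rw [one_eq, mk_eq_iff]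
  refine Eventually.of_forall fun p => ?_
  simp only [fderiv_snd_eq]
  rfl

@[simp] theorem eval_x : eval x = 0 := eval_mk _

@[simp] theorem eval_y : eval y = 0 := eval_mk _

/-! ### Divisibility by the coordinate `ξ` -/

/-- The equality can be divided by ξ off the axis ξ = 0, whose complement is dense, and it extends
to the axis by continuity. -/
theorem y_mul_cancel {a b : AGerm} (h : y * a = y * b) : a = b := by
  obtain ⟨f, hf, rfl⟩ := exists_rep a
  obtain ⟨g, hg, rfl⟩ := exists_rep b
  rw [y, mk_mul, mk_mul, mk_eq_iff] at h
  rw [mk_eq_iff]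
  obtain ⟨ρ, hρ, hb⟩ := Metric.eventually_nhds_iff_ball.1
    ((h.and hf.eventually_analyticAt).and hg.eventually_analyticAt)
  filter_upwards [Metric.ball_mem_nhds (0 : Plane) hρ] with p hp
  by_contra hne
  have hopen : ∀ᶠ q in 𝓝 p, f q ≠ g q :=
    (hb p hp).1.2.continuousAt.ne_iff_eventually_ne (hb p hp).2.continuousAt |>.1 hne
  have hdense : Dense {q : Plane | q.2 ≠ 0} :=
    (dense_compl_singleton (0 : ℝ)).preimage isOpenMap_snd
  obtain ⟨q, ⟨hq1, hq2⟩, hq⟩ := mem_closure_iff_nhds.1 (hdense p) _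
    (hopen.and (Metric.isOpen_ball.mem_nhds hp))
  exact hq1 (mul_left_cancel₀ hq (hb q hq2).1.1)

/-- Divisibility by ξ means vanishing on the axis ξ = 0. There a function of x that vanishes after
multiplication by x^m is zero off the origin, hence near it by analyticity. -/
theorem y_dvd_of_x_pow_mul {m : ℕ} {a : AGerm} (h : y ∣ x ^ m * a) : y ∣ a := by
  obtain ⟨b, hb⟩ := h
  obtain ⟨f, hf, rfl⟩ := exists_rep a
  obtain ⟨g, hg, rfl⟩ := exists_rep b
  obtain ⟨q, hq, hfq⟩ := exists_eq_add_snd_mul hf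
  refine ⟨mk q hq, ?_⟩
  rw [x, y, mk_pow, mk_mul, mk_mul, mk_eq_iff] at hb
  rw [y, mk_mul, mk_eq_iff]
  have hline : AnalyticAt ℝ (fun t : ℝ => ((t, 0) : Plane)) 0 := analyticAt_id.prod analyticAt_const
  have hr : AnalyticAt ℝ (fun t : ℝ => f (t, 0)) 0 := AnalyticAt.comp (g := f) hf hline
  have hz : ∀ᶠ t in 𝓝 (0 : ℝ), f (t, 0) = 0 := by
    refine hr.frequently_zero_iff_eventually_zero.1 (Eventually.frequently ?_)
    have h1 : ∀ᶠ t in 𝓝 (0 : ℝ), t ^ m * f (t, 0) = 0 * g (t, 0) :=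
      (show Tendsto (fun t : ℝ => ((t, 0) : Plane)) (𝓝 0) (𝓝 0) from
        hline.continuousAt.tendsto).eventually hb
    filter_upwards [h1.filter_mono nhdsWithin_le_nhds, self_mem_nhdsWithin] with t h2 h3
    rw [zero_mul] at h2
    exact (mul_eq_zero.1 h2).resolve_left (pow_ne_zero _ h3)
  have hfst : Tendsto (fun p : Plane => p.1) (𝓝 0) (𝓝 0) := continuous_fst.tendsto' _ _ rfl
  filter_upwards [hfq, hfst.eventually hz] with p h1 h2
  rw [h1, h2, zero_add]

end AGerm

namespace AGerm

/-! ### Taylor coefficients -/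

/-- The coefficient of `x ^ m` in the Taylor series. -/
def coeffX : ℕ → AGerm →ₗ[ℝ] ℝ
  | 0 => eval.toLinearMap
  | m + 1 => ((m : ℝ) + 1)⁻¹ • (coeffX m ∘ₗ dx.toLinearMap)

/-- The coefficient of `x ^ m ξ ^ n` in the Taylor series. -/
def coeff (m : ℕ) : ℕ → AGerm →ₗ[ℝ] ℝ
  | 0 => coeffX m
  | n + 1 => ((n : ℝ) + 1)⁻¹ • (coeff m n ∘ₗ dy.toLinearMap)

theorem coeff_zero_zero (f : AGerm) : coeff 0 0 f = eval f := rfl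

theorem coeff_succ_zero (m : ℕ) (f : AGerm) :
    coeff (m + 1) 0 f = ((m : ℝ) + 1)⁻¹ * coeff m 0 (dx f) := rfl

theorem coeff_succ (m n : ℕ) (f : AGerm) :
    coeff m (n + 1) f = ((n : ℝ) + 1)⁻¹ * coeff m n (dy f) := rfl

theorem coeff_dy (m n : ℕ) (f : AGerm) : coeff m n (dy f) = (n + 1) * coeff m (n + 1) f := by
  rw [coeff_succ, mul_inv_cancel_left₀]
  positivity

theorem coeff_dx (m n : ℕ) (f : AGerm) : coeff m n (dx f) = (m + 1) * coeff (m + 1) n f := by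
  induction n generalizing f with
  | zero =>
    rw [coeff_succ_zero, mul_inv_cancel_left₀]
    positivity
  | succ n ih => rw [coeff_succ, coeff_succ, dy_dx, ih]; ring

theorem coeff_x_mul (m n : ℕ) (f : AGerm) :
    coeff (m + 1) n (x * f) = coeff m n f ∧ coeff 0 n (x * f) = 0 := by
  induction n generalizing f with
  | succ n ih =>
    have : dy (x * f) = x * dy f := by simp
    simp only [coeff_succ, this, (ih (dy f)).1, (ih (dy f)).2, mul_zero, and_self]
  | zero =>
    have h : dx (x * f) = x * dx f + f := by simp [Derivation.leibniz]
    refine ⟨?_, by simp [coeff_zero_zero]⟩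
    induction m generalizing f with
    | zero => simp [coeff_succ_zero, h, coeff_zero_zero]
    | succ m ih =>
      rw [coeff_succ_zero, h, map_add, ih (dx f) (by simp [Derivation.leibniz]), coeff_dx]
      push_cast
      field_simp

theorem coeff_y_mul (m n : ℕ) (f : AGerm) :
    coeff m (n + 1) (y * f) = coeff m n f ∧ coeff m 0 (y * f) = 0 := by
  have h0 : ∀ m, ∀ f : AGerm, coeff m 0 (y * f) = 0 := by
    intro m
    induction m with
    | zero => intro f; simp [coeff_zero_zero]
    | succ m ih => intro f; simp [coeff_succ_zero, ih]
  refine ⟨?_, h0 m f⟩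
  have h : ∀ f : AGerm, dy (y * f) = y * dy f + f := fun f => by simp [Derivation.leibniz]
  induction n generalizing f with
  | zero => simp [coeff_succ _ 0, h, h0]
  | succ n ih =>
    rw [coeff_succ, h, map_add, ih (dy f), coeff_dy]
    push_cast
    field_simp

theorem coeff_x_pow_mul (k m n : ℕ) (f : AGerm) :
    coeff m n (x ^ k * f) = if k ≤ m then coeff (m - k) n f else 0 := by
  induction k generalizing m with
  | zero => simp
  | succ k ih =>
    rw [pow_succ', mul_assoc]
    rcases m with _ | m
    · rw [(coeff_x_mul 0 n _).2, if_neg (by omega)]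
    · rw [(coeff_x_mul m n _).1, ih]
      simp

/-! ### The weighted functionals -/

/-- The derivative along the Hamiltonian vector field of `ξ² + ε x ^ k`. -/
def ham (k : ℕ) (ε : ℝ) (f : AGerm) : AGerm :=
  2 * y * dx f - algebraMap ℝ AGerm (ε * k) * x ^ (k - 1) * dy f

/-- The derivative along the Euler vector field. -/
def euler (k : ℕ) (f : AGerm) : AGerm := 2 * (x * dx f) + (k : AGerm) * (y * dy f)

/-- The Hamiltonian `ξ² + ε x ^ k`. -/
def hamiltonian (k : ℕ) (ε : ℝ) : AGerm := y ^ 2 + algebraMap ℝ AGerm ε * x ^ k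

/-- The coefficients of the functional `ell`. -/
def ellCoeff (k : ℕ) (ε : ℝ) (i j : ℕ) : ℕ → ℝ
  | 0 => 1
  | n + 1 => ellCoeff k ε i j n * (ε * k * (2 * n + 1) / (2 * (i + 1 + k * (j - 1 - n))))

/-- A functional on germs that is homogeneous of weight `i + k j` and vanishes on Hamiltonian
derivatives. -/
def ell (k : ℕ) (ε : ℝ) (i j : ℕ) (f : AGerm) : ℝ :=
  ∑ n ∈ Finset.range (j + 1), ellCoeff k ε i j n * coeff (i + k * (j - n)) (2 * n) f

theorem ell_add (k : ℕ) (ε : ℝ) (i j : ℕ) (f g : AGerm) :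
    ell k ε i j (f + g) = ell k ε i j f + ell k ε i j g := by
  simp only [ell, map_add, mul_add, Finset.sum_add_distrib]

theorem ell_smul (k : ℕ) (ε : ℝ) (i j : ℕ) (r : ℝ) (f : AGerm) :
    ell k ε i j (algebraMap ℝ AGerm r * f) = r * ell k ε i j f := by
  simp only [ell, ← Algebra.smul_def, map_smul, smul_eq_mul, Finset.mul_sum]
  exact Finset.sum_congr rfl fun _ _ => by ring

theorem ell_zero_right (k : ℕ) (ε : ℝ) (i : ℕ) (f : AGerm) : ell k ε i 0 f = coeff i 0 f := by
  simp [ell, ellCoeff]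

theorem coeff_const_mul (m n : ℕ) (r : ℝ) (f : AGerm) :
    coeff m n (algebraMap ℝ AGerm r * f) = r * coeff m n f := by
  rw [← Algebra.smul_def, map_smul, smul_eq_mul]

theorem natCast_eq (n : ℕ) : (n : AGerm) = algebraMap ℝ AGerm n := (map_natCast _ n).symm

theorem two_eq : (2 : AGerm) = algebraMap ℝ AGerm 2 := (map_ofNat _ 2).symm

theorem coeff_y_sq_mul (m n : ℕ) (f : AGerm) : coeff m (2 * (n + 1)) (y ^ 2 * f) =
    coeff m (2 * n) f ∧ coeff m 0 (y ^ 2 * f) = 0 := by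
  rw [sq, mul_assoc, show 2 * (n + 1) = 2 * n + 1 + 1 by ring, (coeff_y_mul _ _ _).1,
    (coeff_y_mul _ _ _).1, (coeff_y_mul m 0 _).2]
  exact ⟨rfl, rfl⟩

theorem weight_sub {k i j n : ℕ} (h : n < j) : i + k * (j - n) = i + k * (j - n - 1) + k := by
  obtain ⟨d, rfl⟩ : ∃ d, j = n + 1 + d := ⟨j - (n + 1), by omega⟩
  rw [show n + 1 + d - n = d + 1 by omega, show d + 1 - 1 = d by omega]
  ring

theorem cast_weight {k i j n : ℕ} (h : n < j) :
    ((i + k * (j - n - 1) : ℕ) : ℝ) = i + k * (j - 1 - n) := by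
  obtain ⟨d, rfl⟩ : ∃ d, j = n + 1 + d := ⟨j - (n + 1), by omega⟩
  rw [show n + 1 + d - n - 1 = d by omega]
  push_cast
  ring

/-- Each monomial x^(i+k(j−n)) ξ^(2n) in the functional is an eigenvector of 2x∂_x + kξ∂_ξ with the
same eigenvalue 2(i + kj). -/
theorem ell_euler (k : ℕ) (ε : ℝ) (i j : ℕ) (f : AGerm) :
    ell k ε i j (euler k f) = 2 * (i + k * j) * ell k ε i j f := by
  rw [ell, ell, Finset.mul_sum]
  refine Finset.sum_congr rfl fun n hn => ?_
  have hn' : n ≤ j := Nat.lt_succ_iff.1 (Finset.mem_range.1 hn)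
  have hx : ∀ m l, coeff m l (x * dx f) = m * coeff m l f := fun m l => by
    rcases m with _ | m
    · rw [(coeff_x_mul 0 l _).2]; simp
    · rw [(coeff_x_mul m l _).1, coeff_dx]; push_cast; ring
  have hy : ∀ m l, coeff m l (y * dy f) = l * coeff m l f := fun m l => by
    rcases l with _ | l
    · rw [(coeff_y_mul m 0 _).2]; simp
    · rw [(coeff_y_mul m l _).1, coeff_dy]; push_cast; ring
  rw [euler, two_eq, natCast_eq, map_add, coeff_const_mul, coeff_const_mul, hx, hy]
  push_cast [hn']
  ring

/-- The coefficients of `ell` are defined so that the x^(k−1)∂_ξ contribution at index n cancels the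
2ξ∂_x contribution at n + 1. The two unmatched end terms vanish: ξ divides the first, and the last
asks for a power of x below k − 1. -/
theorem ell_ham {k : ℕ} (hk : 1 ≤ k) (ε : ℝ) {i : ℕ} (hi : i < k - 1) (j : ℕ) (f : AGerm) :
    ell k ε i j (ham k ε f) = 0 := by
  have h1 : ∀ m l, coeff m l (ham k ε f) =
      2 * coeff m l (y * dx f) - ε * k * coeff m l (x ^ (k - 1) * dy f) := fun m l => by
    rw [ham, two_eq, mul_assoc, mul_assoc, map_sub, coeff_const_mul, coeff_const_mul]
  simp only [ell, h1, mul_sub, Finset.sum_sub_distrib]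
  rw [Finset.sum_range_succ', Finset.sum_range_succ (n := j), Nat.sub_self, mul_zero,
    coeff_x_pow_mul (m := i + k * 0), if_neg (by omega),
    (coeff_y_mul _ 0 _).2]
  simp only [mul_zero, add_zero]
  rw [sub_eq_zero]
  refine Finset.sum_congr rfl fun n hn => ?_
  have hn' : n < j := Finset.mem_range.1 hn
  have hw := weight_sub (k := k) (i := i) hn'
  rw [show j - (n + 1) = j - n - 1 by omega, show 2 * (n + 1) = 2 * n + 1 + 1 by ring,
    (coeff_y_mul _ _ _).1, coeff_x_pow_mul, if_pos (by omega), coeff_dx, coeff_dy,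
    show i + k * (j - n) - (k - 1) = i + k * (j - n - 1) + 1 by omega, ellCoeff, cast_weight hn']
  have hpos : (0 : ℝ) < i + k * (j - 1 - n) + 1 := by
    rw [← cast_weight hn']; positivity
  have hpos' : ((i : ℝ) + 1 + k * (j - 1 - n)) ≠ 0 := by
    have : (i : ℝ) + 1 + k * (j - 1 - n) = i + k * (j - 1 - n) + 1 := by ring
    rw [this]; exact hpos.ne'
  push_cast
  field_simp
  ring

/-- The coefficients are products over n factors, and raising j by one shifts the denominators by
one place, so the quotient telescopes. -/
theorem ellCoeff_succ_weight {k : ℕ} (hk : 1 ≤ k) (ε : ℝ) (i j n : ℕ) (hn : n ≤ j) :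
    ellCoeff k ε i j n * (i + 1 + k * (j - n)) = ellCoeff k ε i (j + 1) n * (i + 1 + k * j) := by
  induction n with
  | zero => simp [ellCoeff]
  | succ n ih =>
    have ih' := ih (by omega)
    have hn1 : (n : ℝ) + 1 ≤ j := by exact_mod_cast hn
    have hk0 : (0 : ℝ) ≤ k := by positivity
    have h1 : (0 : ℝ) < i + 1 + k * (j - 1 - n) := by
      have : 0 ≤ (k : ℝ) * (j - 1 - n) := mul_nonneg hk0 (by linarith)
      positivity
    have h2 : (0 : ℝ) < i + 1 + k * (j + 1 - 1 - n) := by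
      have : 0 ≤ (k : ℝ) * (j + 1 - 1 - n) := mul_nonneg hk0 (by linarith)
      positivity
    have h3 : (j : ℝ) + 1 - 1 - n = j - n := by ring
    rw [ellCoeff, ellCoeff]
    push_cast
    rw [h3] at h2 ⊢
    have h4 : (j : ℝ) - (n + 1) = j - 1 - n := by ring
    rw [h4]
    generalize (i : ℝ) + 1 + k * (j - 1 - n) = a at *
    generalize (i : ℝ) + 1 + k * (j - n) = b at *
    field_simp
    linear_combination ε * ih'

/-- The factor by which multiplication by the Hamiltonian acts. -/
def ellFactor (k : ℕ) (ε : ℝ) (i j : ℕ) : ℝ :=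
  ε * (2 * (i + 1) + 2 * k * j + k) / (2 * (i + 1 + k * j))

theorem ellFactor_ne_zero (k : ℕ) {ε : ℝ} (hε : ε ≠ 0) (i j : ℕ) : ellFactor k ε i j ≠ 0 := by
  have h1 : (0 : ℝ) < 2 * (i + 1) + 2 * k * j + k := by positivity
  have h2 : (0 : ℝ) < 2 * (i + 1 + k * j) := by positivity
  exact div_ne_zero (mul_ne_zero hε h1.ne') h2.ne'

/-- A monomial of f reaches level j + 1 through ξ², raising n, and through εx^k, keeping n. The
point is that the combined factor does not depend on n. -/
theorem ellCoeff_add {k : ℕ} (hk : 1 ≤ k) (ε : ℝ) (i j n : ℕ) (hn : n ≤ j) :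
    ellCoeff k ε i (j + 1) (n + 1) + ε * ellCoeff k ε i (j + 1) n =
      ellFactor k ε i j * ellCoeff k ε i j n := by
  have h := ellCoeff_succ_weight hk ε i j n hn
  have hn1 : (n : ℝ) ≤ j := by exact_mod_cast hn
  have h1 : (0 : ℝ) < i + 1 + k * (j - n) := by
    have : 0 ≤ (k : ℝ) * (j - n) := mul_nonneg (by positivity) (by linarith)
    positivity
  have h2 : (0 : ℝ) < i + 1 + k * j := by positivity
  have h3 : (j : ℝ) + 1 - 1 - n = j - n := by ring
  rw [ellCoeff, ellFactor]
  push_cast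
  rw [h3]
  field_simp
  linear_combination (-(ε * (2 * (i + 1) + 2 * k * j + k))) * h

theorem ell_hamiltonian_mul {k : ℕ} (hk : 1 ≤ k) (ε : ℝ) {i : ℕ} (hi : i < k) (j : ℕ) (f : AGerm) :
    ell k ε i (j + 1) (hamiltonian k ε * f) = ellFactor k ε i j * ell k ε i j f ∧
      ell k ε i 0 (hamiltonian k ε * f) = 0 := by
  have h1 : ∀ m l, coeff m l (hamiltonian k ε * f) =
      coeff m l (y ^ 2 * f) + ε * coeff m l (x ^ k * f) := fun m l => by
    rw [hamiltonian, add_mul, mul_assoc, map_add, coeff_const_mul]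
  constructor
  · simp only [ell, h1, mul_add, Finset.sum_add_distrib]
    rw [Finset.sum_range_succ', Finset.sum_range_succ (n := j + 1), Nat.sub_self,
      coeff_x_pow_mul (m := i + k * 0), if_neg (by omega), mul_zero 2, (coeff_y_sq_mul _ 0 _).2,
      Finset.mul_sum]
    simp only [mul_zero, add_zero]
    rw [← Finset.sum_add_distrib]
    refine Finset.sum_congr rfl fun n hn => ?_
    have hn' : n ≤ j := Nat.lt_succ_iff.1 (Finset.mem_range.1 hn)
    have hw := weight_sub (k := k) (i := i) (show n < j + 1 by omega)
    rw [show j + 1 - n - 1 = j - n by omega] at hw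
    rw [show j + 1 - (n + 1) = j - n by omega, (coeff_y_sq_mul _ _ _).1, coeff_x_pow_mul,
      if_pos (by omega), show i + k * (j + 1 - n) - k = i + k * (j - n) by omega]
    linear_combination coeff (i + k * (j - n)) (2 * n) f * ellCoeff_add hk ε i j n hn'
  · rw [ell_zero_right, h1, (coeff_y_sq_mul _ 0 _).2, coeff_x_pow_mul, if_neg (by omega)]
    ring

end AGerm

namespace AGerm

/-! ### Uniqueness of the coefficients of a normal form -/

theorem ell_hamiltonian_pow_mul_of_lt {k : ℕ} (hk : 1 ≤ k) (ε : ℝ) {i : ℕ} (hi : i < k) (q j : ℕ)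
    (h : j < q) (f : AGerm) : ell k ε i j (hamiltonian k ε ^ q * f) = 0 := by
  induction q generalizing j with
  | zero => omega
  | succ q ih =>
    rw [pow_succ', mul_assoc]
    rcases j with _ | j
    · exact (ell_hamiltonian_mul hk ε hi 0 _).2
    · rw [(ell_hamiltonian_mul hk ε hi j _).1, ih j (by omega), mul_zero]

/-- The constant is a product of values of `ellFactor`. Its independence of f is what allows it to
be cancelled when two normal forms are compared. -/
theorem exists_ell_hamiltonian_pow_mul {k : ℕ} (hk : 1 ≤ k) {ε : ℝ} (hε : ε ≠ 0) {i : ℕ}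
    (hi : i < k) (q d : ℕ) :
    ∃ K : ℝ, K ≠ 0 ∧ ∀ f, ell k ε i (d + q) (hamiltonian k ε ^ q * f) = K * ell k ε i d f := by
  induction q with
  | zero => exact ⟨1, one_ne_zero, fun f => by simp⟩
  | succ q ih =>
    obtain ⟨K, hK, h⟩ := ih
    refine ⟨ellFactor k ε i (d + q) * K, mul_ne_zero (ellFactor_ne_zero k hε _ _) hK, fun f => ?_⟩
    rw [pow_succ', mul_assoc, ← add_assoc, (ell_hamiltonian_mul hk ε hi _ _).1, h, mul_assoc]

/-- The functional sees g both with its own weight i + kj and with the weight l of g, the correction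
`ham k ε ζ` being invisible to it. As i, l < k − 1, these weights agree only for (i, j) = (l, 0). -/
theorem ell_eq_zero_of_euler {k : ℕ} (hk : 1 ≤ k) {ε : ℝ} {l : ℕ} (hl : l < k - 1)
    {g ζ : AGerm} (hg : euler k g = algebraMap ℝ AGerm (2 * l) * g + ham k ε ζ) {i j : ℕ}
    (hi : i < k - 1) (hij : ¬(i = l ∧ j = 0)) : ell k ε i j g = 0 := by
  have h := ell_euler k ε i j g
  rw [hg, ell_add, ell_smul, ell_ham hk ε hi, add_zero] at h
  have hne : (i : ℝ) + k * j - l ≠ 0 := by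
    have : i + k * j ≠ l := by
      rcases j with _ | j
      · simpa using hij
      · have : k ≤ k * (j + 1) := Nat.le_mul_of_pos_right k (by omega)
        omega
    rw [sub_ne_zero]
    exact_mod_cast this
  have h2 : ((i : ℝ) + k * j - l) * ell k ε i j g = 0 := by linear_combination (-1 / 2) * h
  exact (mul_eq_zero.1 h2).resolve_left hne

/-! ### Taylor expansion in powers of the Hamiltonian -/

/-- Iterated difference quotients at `0`. -/
def taylorRem (c : ℝ → ℝ) : ℕ → ℝ → ℝ
  | 0 => c
  | n + 1 => dslope (taylorRem c n) 0

theorem analyticAt_taylorRem {c : ℝ → ℝ} (hc : AnalyticAt ℝ c 0) (n : ℕ) :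
    AnalyticAt ℝ (taylorRem c n) 0 := by
  induction n with
  | zero => exact hc
  | succ n ih =>
    obtain ⟨p, hp⟩ := ih
    exact hp.has_fpower_series_dslope_fslope.analyticAt

theorem eq_add_mul_dslope (f : ℝ → ℝ) (t : ℝ) : f t = f 0 + t * dslope f 0 t := by
  have := sub_smul_dslope f 0 t
  rw [sub_zero, smul_eq_mul] at this
  rw [this]
  ring

theorem eq_taylor (c : ℝ → ℝ) (N : ℕ) (t : ℝ) :
    c t = (∑ q ∈ Finset.range N, taylorRem c q 0 * t ^ q) + t ^ N * taylorRem c N t := by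
  induction N with
  | zero => simp [taylorRem]
  | succ N ih =>
    rw [ih, Finset.sum_range_succ, taylorRem, pow_succ]
    linear_combination t ^ N * eq_add_mul_dslope (taylorRem c N) t

theorem eventuallyEq_zero_of_forall_pow_mul {e : ℝ → ℝ} (he : AnalyticAt ℝ e 0)
    (h : ∀ n : ℕ, ∃ r, AnalyticAt ℝ r 0 ∧ ∀ t, e t = t ^ n * r t) : e =ᶠ[𝓝 0] fun _ => 0 := by
  refine analyticOrderAt_eq_top.1 (ENat.eq_top_iff_forall_ge.2 fun n => ?_)
  obtain ⟨r, hr, hrt⟩ := h n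
  exact (natCast_le_analyticOrderAt he).2 ⟨r, hr, Eventually.of_forall fun t => by simp [hrt t]⟩

theorem eventuallyEq_of_taylorRem {c d : ℝ → ℝ} (hc : AnalyticAt ℝ c 0) (hd : AnalyticAt ℝ d 0)
    {r : ℝ} (h : ∀ q, taylorRem d q 0 = r * taylorRem c q 0) : d =ᶠ[𝓝 0] fun t => r * c t := by
  have h1 : (fun t => d t - r * c t) =ᶠ[𝓝 0] fun _ => 0 := by
    refine eventuallyEq_zero_of_forall_pow_mul (hd.sub (analyticAt_const.mul hc)) fun n =>
      ⟨fun t => taylorRem d n t - r * taylorRem c n t, (analyticAt_taylorRem hd n).sub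
        (analyticAt_const.mul (analyticAt_taylorRem hc n)), fun t => ?_⟩
    rw [eq_taylor d n, eq_taylor c n]
    simp only [h, mul_add, Finset.mul_sum, mul_assoc]
    ring
  filter_upwards [h1] with t ht
  linarith

theorem analyticAt_comp_modelH {k : ℕ} (hk : 1 ≤ k) (ε : ℝ) {c : ℝ → ℝ} (hc : AnalyticAt ℝ c 0) :
    AnalyticAt ℝ (fun p => c (modelH k ε p)) 0 :=
  AnalyticAt.comp (g := c) (by rwa [modelH_zero hk]) (analyticAt_modelH k ε 0)

theorem hamiltonian_eq (k : ℕ) (ε : ℝ) :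
    hamiltonian k ε = mk (modelH k ε) (analyticAt_modelH k ε 0) := by
  rw [hamiltonian, x, y, mk_pow, mk_pow, algebraMap_eq, mk_mul, mk_add]
  rfl

theorem mk_sum {ι : Type*} (s : Finset ι) (f : ι → Plane → ℝ) (hf : ∀ i, AnalyticAt ℝ (f i) 0)
    (hs : AnalyticAt ℝ (fun p => ∑ i ∈ s, f i p) 0) :
    mk (fun p => ∑ i ∈ s, f i p) hs = ∑ i ∈ s, mk (f i) (hf i) := by
  classical
  induction s using Finset.induction_on with
  | empty =>
    rw [Finset.sum_empty, zero_eq, mk_eq_iff]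
    simp
  | insert i s hi ih =>
    have hs' : AnalyticAt ℝ (fun p => ∑ i ∈ s, f i p) 0 :=
      Finset.analyticAt_fun_sum _ fun i _ => hf i
    rw [Finset.sum_insert hi, ← ih hs', mk_add, mk_eq_iff]
    simp [Finset.sum_insert hi]

/-- The germ of `c ∘ H`. -/
def ofH (k : ℕ) (hk : 1 ≤ k) (ε : ℝ) (c : ℝ → ℝ) (hc : AnalyticAt ℝ c 0) : AGerm :=
  mk (fun p => c (modelH k ε p)) (analyticAt_comp_modelH hk ε hc)

theorem ofH_eq_taylor {k : ℕ} (hk : 1 ≤ k) (ε : ℝ) {c : ℝ → ℝ} (hc : AnalyticAt ℝ c 0) (N : ℕ) :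
    ofH k hk ε c hc = (∑ q ∈ Finset.range N, algebraMap ℝ AGerm (taylorRem c q 0) *
        hamiltonian k ε ^ q) +
      hamiltonian k ε ^ N * ofH k hk ε (taylorRem c N) (analyticAt_taylorRem hc N) := by
  have hH := analyticAt_modelH k ε 0
  simp only [hamiltonian_eq, mk_pow, algebraMap_eq, ofH, mk_mul]
  rw [← mk_sum _ (fun q p => taylorRem c q 0 * modelH k ε p ^ q)
    (fun q => analyticAt_const.mul (hH.pow q))
    (Finset.analyticAt_fun_sum _ fun q _ => analyticAt_const.mul (hH.pow q)), mk_add, mk_eq_iff]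
  exact Eventually.of_forall fun p => eq_taylor c N _

theorem ell_sum (k : ℕ) (ε : ℝ) (i j : ℕ) {ι : Type*} (s : Finset ι) (f : ι → AGerm) :
    ell k ε i j (∑ a ∈ s, f a) = ∑ a ∈ s, ell k ε i j (f a) := by
  simp only [ell, map_sum, Finset.mul_sum]
  exact Finset.sum_comm

/-- The value of the functionals on a multiple of a weighted homogeneous class. -/
theorem ell_ofH_mul {k : ℕ} (hk : 1 ≤ k) {ε : ℝ} {l : ℕ} (hl : l < k - 1)
    {g ζ : AGerm} (hg : euler k g = algebraMap ℝ AGerm (2 * l) * g + ham k ε ζ)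
    {c : ℝ → ℝ} (hc : AnalyticAt ℝ c 0) {i : ℕ} (hi : i < k - 1) {j : ℕ} {K : ℝ}
    (hK : ∀ f, ell k ε i (0 + j) (hamiltonian k ε ^ j * f) = K * ell k ε i 0 f)
    (hε : ε ≠ 0) :
    ell k ε i j (ofH k hk ε c hc * g) =
      if i = l then taylorRem c j 0 * (K * coeff i 0 g) else 0 := by
  have hlt : ∀ q < j, ell k ε i j (hamiltonian k ε ^ q * g) = 0 := fun q hq => by
    obtain ⟨K', -, h'⟩ := exists_ell_hamiltonian_pow_mul hk hε (show i < k by omega) q (j - q)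
    have := h' g
    rw [Nat.sub_add_cancel hq.le] at this
    rw [this, ell_eq_zero_of_euler hk hl hg hi (by omega), mul_zero]
  rw [zero_add] at hK
  -- Expanding to order j + 1 hides the remainder from `ell k ε i j`. The terms with q < j vanish by
  -- `hlt`, so only q = j survives.
  rw [ofH_eq_taylor hk ε hc (j + 1), add_mul, Finset.sum_mul, ell_add, ell_sum, mul_assoc,
    ell_hamiltonian_pow_mul_of_lt hk ε (by omega) (j + 1) j (by omega), add_zero,
    Finset.sum_range_succ, Finset.sum_eq_zero, zero_add, mul_assoc, ell_smul, hK]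
  · split_ifs with h
    · rw [ell_zero_right]
    · rw [ell_eq_zero_of_euler hk hl hg hi (by tauto)]
      ring
  · intro q hq
    rw [mul_assoc, ell_smul, hlt q (Finset.mem_range.1 hq), mul_zero]

/-- With ζ = 0 this puts x^l under the same hypothesis as the pull-backs u^l Jac ψ, so that
`ell_ofH_mul` applies to both sides of the comparison. -/
theorem euler_x_pow (k : ℕ) (ε : ℝ) (l : ℕ) :
    euler k (x ^ l) = algebraMap ℝ AGerm (2 * l) * x ^ l + ham k ε 0 := by
  have h : x * dx (x ^ l) = (l : AGerm) * x ^ l := by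
    rcases l with _ | l
    · simp
    · rw [Derivation.leibniz_pow, dx_x]
      simp [pow_succ]
      ring
  have h2 : dy (x ^ l) = 0 := by rw [Derivation.leibniz_pow, dy_x]; simp
  rw [euler, h, h2, ham, map_zero, map_zero, map_mul, ← natCast_eq, ← two_eq]
  ring

/-- As u vanishes at the origin, each of the l derivatives in x must consume one factor u; all other
terms vanish there. -/
theorem coeff_pow_mul {u : AGerm} (hu : eval u = 0) (l : ℕ) (g : AGerm) :
    coeff l 0 (u ^ l * g) = eval (dx u) ^ l * eval g := by
  induction l generalizing g with
  | zero => simp [coeff_zero_zero]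
  | succ l ih =>
    have h : dx (u ^ (l + 1) * g) = u ^ l * (((l + 1 : ℕ) : AGerm) * dx u * g + u * dx g) := by
      rw [Derivation.leibniz, Derivation.leibniz_pow]
      simp [pow_succ]
      ring
    rw [coeff_succ_zero, h, ih]
    simp only [map_add, map_mul, hu, map_natCast]
    push_cast
    field_simp
    ring

/-! ### Pull-backs by symmetries of the Hamiltonian -/

/-- The Jacobian determinant of a pair of germs. -/
def jacobian (u v : AGerm) : AGerm := dx u * dy v - dy u * dx v

section Symmetry

variable {k : ℕ} {ε : ℝ} {u v : AGerm}

theorem dx_relation (h : v ^ 2 + algebraMap ℝ AGerm ε * u ^ k = hamiltonian k ε) :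
    2 * v * dx v + algebraMap ℝ AGerm (ε * k) * u ^ (k - 1) * dx u =
      algebraMap ℝ AGerm (ε * k) * x ^ (k - 1) := by
  have h1 := congrArg dx h
  simp only [hamiltonian, map_add, Derivation.leibniz, Derivation.leibniz_pow, dx_x, dx_y,
    Derivation.map_algebraMap, smul_eq_mul, nsmul_eq_mul] at h1
  rw [map_mul, ← natCast_eq]
  simp at h1
  linear_combination h1

theorem dy_relation (h : v ^ 2 + algebraMap ℝ AGerm ε * u ^ k = hamiltonian k ε) :
    2 * v * dy v + algebraMap ℝ AGerm (ε * k) * u ^ (k - 1) * dy u = 2 * y := by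
  have h1 := congrArg dy h
  simp only [hamiltonian, map_add, Derivation.leibniz, Derivation.leibniz_pow, dy_x, dy_y,
    Derivation.map_algebraMap, smul_eq_mul, nsmul_eq_mul] at h1
  rw [map_mul, ← natCast_eq]
  simp at h1
  linear_combination h1

/-- A vector field annihilating the Hamiltonian is a multiple of the Hamiltonian field. -/
theorem exists_eq_mul_of_tangent (hk : 1 ≤ k) (hε : ε ≠ 0) {a b : AGerm}
    (h : algebraMap ℝ AGerm (ε * k) * x ^ (k - 1) * a + 2 * y * b = 0) :
    ∃ ζ, a = 2 * y * ζ ∧ b = -(algebraMap ℝ AGerm (ε * k) * x ^ (k - 1) * ζ) := by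
  have hεk : ε * k ≠ 0 := mul_ne_zero hε (by positivity)
  have hinv : algebraMap ℝ AGerm (ε * k)⁻¹ * algebraMap ℝ AGerm (ε * k) = 1 := by
    rw [← map_mul, inv_mul_cancel₀ hεk, map_one]
  have hhalf : algebraMap ℝ AGerm 2⁻¹ * 2 = 1 := by
    rw [two_eq, ← map_mul, inv_mul_cancel₀ two_ne_zero, map_one]
  -- The hypothesis shows that ξ divides x^(k−1) a, because εk is invertible.
  obtain ⟨q, hq⟩ : y ∣ a := by
    refine y_dvd_of_x_pow_mul (m := k - 1) ⟨-(algebraMap ℝ AGerm (ε * k)⁻¹ * 2 * b), ?_⟩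
    linear_combination (algebraMap ℝ AGerm (ε * k)⁻¹) * h - (x ^ (k - 1) * a) * hinv
  refine ⟨algebraMap ℝ AGerm 2⁻¹ * q, ?_, ?_⟩
  · linear_combination hq - y * q * hhalf
  · refine y_mul_cancel ?_
    linear_combination (algebraMap ℝ AGerm 2⁻¹) * h - y * b * hhalf -
      algebraMap ℝ AGerm 2⁻¹ * (algebraMap ℝ AGerm (ε * k) * x ^ (k - 1)) * hq

/-- The pull-back of `x ^ l dξ ∧ dx` by a symmetry of the Hamiltonian is weighted homogeneous
modulo Hamiltonian derivatives. -/
theorem exists_euler_pow_mul_jacobian (hk : 1 ≤ k) (hε : ε ≠ 0)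
    (h : v ^ 2 + algebraMap ℝ AGerm ε * u ^ k = hamiltonian k ε) (l : ℕ) :
    ∃ ζ, euler k (u ^ l * jacobian u v) =
      algebraMap ℝ AGerm (2 * l) * (u ^ l * jacobian u v) + ham k ε ζ := by
  have hx := dx_relation h
  have hy := dy_relation h
  obtain ⟨g, hg⟩ : ∃ g, g = u ^ l * jacobian u v := ⟨_, rfl⟩
  rw [← hg]
  -- With E = 2x∂_x + kξ∂_ξ, the field (N₁, N₂) is u^l times the adjugate of Dψ applied to (2u, kv),
  -- minus gE. Formally it is g(ψ^*E − E), written without inverting Dψ.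
  set N₁ := u ^ l * (2 * u * dy v - (k : AGerm) * v * dy u) - 2 * x * g with hN₁
  set N₂ := u ^ l * (-(2 * u * dx v) + (k : AGerm) * v * dx u) - (k : AGerm) * y * g with hN₂
  -- The first part has divergence (2l + 2 + k) g, by pulling back the weight of x^l dξ∧dx; the
  -- divergence of gE is E g + (2 + k) g.
  have hdiv : dx N₁ + dy N₂ = algebraMap ℝ AGerm (2 * l) * g - euler k g := by
    have hpow : ∀ D : Derivation ℝ AGerm AGerm, u * D (u ^ l) = (l : AGerm) * (u ^ l * D u) :=
      fun D => by
        rcases l with _ | l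
        · simp
        · rw [Derivation.leibniz_pow]
          simp [pow_succ]
          ring
    have h1 : dx (u ^ l) * dy u = dy (u ^ l) * dx u := by
      rw [Derivation.leibniz_pow, Derivation.leibniz_pow]
      simp only [smul_eq_mul, nsmul_eq_mul]
      ring
    have h2 := hpow dx
    have h3 := hpow dy
    have h4 : ∀ D : Derivation ℝ AGerm AGerm, D (k : AGerm) = 0 := fun D => D.map_natCast k
    have h5 : ∀ D : Derivation ℝ AGerm AGerm, D (2 : AGerm) = 0 := fun D => by
      rw [two_eq, Derivation.map_algebraMap]
    have h6 : dx N₁ = dx (u ^ l) * (2 * u * dy v - (k : AGerm) * v * dy u) +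
        u ^ l * (2 * dx u * dy v + 2 * u * dx (dy v) - (k : AGerm) * dx v * dy u -
          (k : AGerm) * v * dx (dy u)) - 2 * g - 2 * x * dx g := by
      simp only [hN₁, map_sub, Derivation.leibniz, smul_eq_mul, h4, h5, dx_x]
      ring
    have h7 : dy N₂ = dy (u ^ l) * (-(2 * u * dx v) + (k : AGerm) * v * dx u) +
        u ^ l * (-(2 * dy u * dx v) - 2 * u * dx (dy v) + (k : AGerm) * dy v * dx u +
          (k : AGerm) * v * dx (dy u)) - (k : AGerm) * g - (k : AGerm) * y * dy g := by
      simp only [hN₂, map_sub, map_add, map_neg, Derivation.leibniz, smul_eq_mul, h4, h5, dy_y,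
        dy_dx]
      ring
    have h8 : g = u ^ l * (dx u * dy v - dy u * dx v) := hg
    have h9 : algebraMap ℝ AGerm (2 * l) = 2 * (l : AGerm) := by
      rw [map_mul, ← natCast_eq, ← two_eq]
    rw [h6, h7, euler, h9]
    linear_combination (2 * dy v) * h2 - (2 * dx v) * h3 - ((k : AGerm) * v) * h1 -
      (2 * (l : AGerm) + 2 + (k : AGerm)) * h8
  -- Both fields multiply H by 2k: E by homogeneity, its transport because ψ preserves H. Their
  -- difference is therefore tangent to the level curves.
  have htan : algebraMap ℝ AGerm (ε * k) * x ^ (k - 1) * N₁ + 2 * y * N₂ = 0 := by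
    have h1 : algebraMap ℝ AGerm (ε * k) = algebraMap ℝ AGerm ε * (k : AGerm) := by
      rw [map_mul, natCast_eq]
    have h2 : hamiltonian k ε = y ^ 2 + algebraMap ℝ AGerm ε * x ^ k := rfl
    have h3 : ∀ a : AGerm, a ^ k = a ^ (k - 1) * a := fun a => by
      rw [← pow_succ, Nat.sub_add_cancel hk]
    rw [h2, h3, h3] at h
    rw [h1] at hx hy ⊢
    have h8 : g = u ^ l * (dx u * dy v - dy u * dx v) := hg
    rw [hN₁, hN₂, h8]
    linear_combination (-(u ^ l * (2 * u * dy v - (k : AGerm) * v * dy u))) * hx -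
      (u ^ l * (-(2 * u * dx v) + (k : AGerm) * v * dx u)) * hy +
      (2 * (k : AGerm) * (u ^ l * (dx u * dy v - dy u * dx v))) * h
  obtain ⟨ζ, h1, h2⟩ := exists_eq_mul_of_tangent hk hε htan
  refine ⟨-ζ, ?_⟩
  -- The Hamiltonian field is divergence-free, so the divergence of ζ times it is the derivative of
  -- ζ along it.
  have h3 : dx N₁ + dy N₂ = ham k ε ζ := by
    rw [h1, h2, ham, two_eq]
    simp only [Derivation.leibniz, map_neg, smul_eq_mul, Derivation.map_algebraMap, dx_y, dy_x,
      Derivation.leibniz_pow]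
    simp
    ring
  have h4 : ham k ε (-ζ) = -ham k ε ζ := by
    simp only [ham, map_neg]
    ring
  rw [h4]
  linear_combination hdiv - h3

end Symmetry

end AGerm

/-! ### Comparison of coefficients and linear parts of symmetries -/

namespace AGerm

theorem exists_mul_eq_one {a : AGerm} (ha : eval a ≠ 0) : ∃ b, b * a = 1 := by
  obtain ⟨f, hf, rfl⟩ := exists_rep a
  rw [eval_mk] at ha
  refine ⟨mk (fun p => (f p)⁻¹) (hf.fun_inv ha), ?_⟩
  rw [mk_mul, one_eq, mk_eq_iff]
  filter_upwards [hf.continuousAt.eventually_ne ha] with p hp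
  exact inv_mul_cancel₀ hp

theorem exists_eq_x_mul_add_y_mul {u : AGerm} (hu : eval u = 0) :
    ∃ a b, u = x * a + y * b := by
  obtain ⟨f, hf, rfl⟩ := exists_rep u
  rw [eval_mk] at hu
  obtain ⟨q, hq, hfq⟩ := exists_eq_add_snd_mul hf
  have hline : AnalyticAt ℝ (fun t : ℝ => ((t, 0) : Plane)) 0 := analyticAt_id.prod analyticAt_const
  have hr : AnalyticAt ℝ (fun t : ℝ => f (t, 0)) 0 := AnalyticAt.comp (g := f) hf hline
  have hs : AnalyticAt ℝ (fun p : Plane => dslope (fun t : ℝ => f (t, 0)) 0 p.1) 0 :=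
    AnalyticAt.comp (g := dslope (fun t : ℝ => f (t, 0)) 0) (analyticAt_taylorRem hr 1)
      analyticAt_fst
  refine ⟨mk _ hs, mk q hq, ?_⟩
  rw [x, y, mk_mul, mk_mul, mk_add, mk_eq_iff]
  filter_upwards [hfq] with p hp
  have := eq_add_mul_dslope (fun t : ℝ => f (t, 0)) p.1
  rw [hp, this, show f (0, 0) = 0 from hu, zero_add]

section Symmetry

variable {k : ℕ} {ε : ℝ} {u v : AGerm}

/-- The coefficients of two normal forms related by a symmetry `(u, v)` of the Hamiltonian are
proportional. -/
theorem eventuallyEq_of_sum_ofH_eq (hk : 1 ≤ k) (hε : ε ≠ 0)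
    (h : v ^ 2 + algebraMap ℝ AGerm ε * u ^ k = hamiltonian k ε) (hu : eval u = 0)
    {c d : ℕ → ℝ → ℝ} (hc : ∀ i, AnalyticAt ℝ (c i) 0) (hd : ∀ i, AnalyticAt ℝ (d i) 0)
    (hsum : ∑ i ∈ Finset.range (k - 1), ofH k hk ε (c i) (hc i) * (u ^ i * jacobian u v) =
      ∑ i ∈ Finset.range (k - 1), ofH k hk ε (d i) (hd i) * x ^ i) {i : ℕ} (hi : i < k - 1) :
    d i =ᶠ[𝓝 0] fun t => eval (dx u) ^ i * eval (jacobian u v) * c i t := by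
  refine eventuallyEq_of_taylorRem (hc i) (hd i) fun j => ?_
  obtain ⟨K, hK, hKf⟩ := exists_ell_hamiltonian_pow_mul hk hε (show i < k by omega) j 0
  have h1 : ∀ l ∈ Finset.range (k - 1),
      ell k ε i j (ofH k hk ε (c l) (hc l) * (u ^ l * jacobian u v)) =
        if i = l then taylorRem (c l) j 0 * (K * coeff i 0 (u ^ l * jacobian u v)) else 0 :=
    fun l hl => by
      obtain ⟨ζ, hζ⟩ := exists_euler_pow_mul_jacobian hk hε h l
      exact ell_ofH_mul hk (Finset.mem_range.1 hl) hζ (hc l) hi hKf hε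
  have h2 : ∀ l ∈ Finset.range (k - 1), ell k ε i j (ofH k hk ε (d l) (hd l) * x ^ l) =
        if i = l then taylorRem (d l) j 0 * (K * coeff i 0 (x ^ l)) else 0 :=
    fun l hl => ell_ofH_mul hk (Finset.mem_range.1 hl) (euler_x_pow k ε l) (hd l) hi hKf hε
  have h3 := congrArg (ell k ε i j) hsum
  rw [ell_sum, ell_sum, Finset.sum_congr rfl h1, Finset.sum_congr rfl h2, Finset.sum_ite_eq,
    Finset.sum_ite_eq, if_pos (Finset.mem_range.2 hi), if_pos (Finset.mem_range.2 hi),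
    coeff_pow_mul hu] at h3
  have h4 : coeff i 0 (x ^ i) = 1 := by
    have := coeff_pow_mul eval_x i 1
    simpa using this
  rw [h4] at h3
  refine mul_left_cancel₀ hK ?_
  linear_combination -h3

/-- These are the three entries of the Hessian of H ∘ ψ = H at the origin. The power `0 ^ (k - 2)`
treats k = 2, where x^k contributes, together with k ≥ 3, where it does not. -/
theorem eval_second_derivatives (h : v ^ 2 + algebraMap ℝ AGerm ε * u ^ k = hamiltonian k ε)
    (hk : 2 ≤ k) (hu : eval u = 0) (hv : eval v = 0) :
    2 * eval (dx v) ^ 2 + ε * k * (k - 1) * 0 ^ (k - 2) * eval (dx u) ^ 2 =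
        ε * k * (k - 1) * 0 ^ (k - 2) ∧
      2 * eval (dx v) * eval (dy v) + ε * k * (k - 1) * 0 ^ (k - 2) * eval (dx u) * eval (dy u) =
        0 ∧
      2 * eval (dy v) ^ 2 + ε * k * (k - 1) * 0 ^ (k - 2) * eval (dy u) ^ 2 = 2 := by
  obtain ⟨m, rfl⟩ : ∃ m, k = m + 2 := ⟨k - 2, by omega⟩
  have hx := dx_relation h
  have hy := dy_relation h
  rw [show m + 2 - 1 = m + 1 by omega] at hx hy
  have h2 : ∀ D : Derivation ℝ AGerm AGerm, D (2 : AGerm) = 0 := fun D => by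
    rw [two_eq, Derivation.map_algebraMap]
  have e2 : eval 2 = 2 := map_ofNat _ 2
  have key : ∀ D E : Derivation ℝ AGerm AGerm, ∀ b : AGerm,
      2 * v * D v + algebraMap ℝ AGerm (ε * (m + 2 : ℕ)) * u ^ (m + 1) * D u = b →
      2 * eval (E v) * eval (D v) + ε * (m + 2) * (m + 1) * 0 ^ m * eval (E u) * eval (D u) =
        eval (E b) := fun D E b hb => by
    rw [← hb]
    simp only [map_add, Derivation.leibniz, Derivation.leibniz_pow, Derivation.map_algebraMap,
      smul_eq_mul, nsmul_eq_mul, map_mul, map_pow, hu, hv, h2, map_natCast, AlgHom.commutes, e2]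
    simp
    ring
  refine ⟨?_, ?_, ?_⟩
  · have := key dx dx _ hx
    simp [Derivation.leibniz, Derivation.leibniz_pow] at this
    push_cast
    linear_combination this
  · have := key dy dx _ hy
    simp [Derivation.leibniz, h2] at this
    push_cast
    linear_combination this
  · have := key dy dy _ hy
    simp [Derivation.leibniz, h2, e2] at this
    push_cast
    linear_combination this

/-- On the axis ξ = 0 one has u = xa, and the ξ-derivative of the relation makes v a multiple of
u^(k−1), as v_ξ is a unit. Hence v² = O(x^(2k−2)) is negligible against x^k for k ≥ 3, and comparing
the coefficients of x^k in H ∘ ψ = H gives a(0)^k = 1. -/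
theorem eval_dx_pow_eq_one (h : v ^ 2 + algebraMap ℝ AGerm ε * u ^ k = hamiltonian k ε)
    (hk : 3 ≤ k) (hε : ε ≠ 0) (hu : eval u = 0) (hv : eval (dy v) ≠ 0) : eval (dx u) ^ k = 1 := by
  obtain ⟨a, b, hab⟩ := exists_eq_x_mul_add_y_mul hu
  obtain ⟨w, hw⟩ := exists_mul_eq_one hv
  have ha : eval (dx u) = eval a := by
    rw [hab]
    simp
  have hpow : ∀ n : ℕ, ∃ s, u ^ n = x ^ n * a ^ n + y * s := fun n => by
    obtain ⟨s, hs⟩ := sub_dvd_pow_sub_pow u (x * a) n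
    refine ⟨b * s, ?_⟩
    have h1 : u - x * a = y * b := by rw [hab]; ring
    rw [h1, mul_pow] at hs
    linear_combination hs
  obtain ⟨s, hs⟩ := hpow (k - 1)
  obtain ⟨s', hs'⟩ := hpow k
  have hy := dy_relation h
  have hhalf : algebraMap ℝ AGerm 2⁻¹ * 2 = 1 := by
    rw [two_eq, ← map_mul, inv_mul_cancel₀ two_ne_zero, map_one]
  set B := -(algebraMap ℝ AGerm 2⁻¹ * algebraMap ℝ AGerm (ε * k) * w * dy u) with hB
  have hv' : v = x ^ (k - 1) * (B * a ^ (k - 1)) + y * (w + B * s) := by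
    rw [hB]
    linear_combination algebraMap ℝ AGerm 2⁻¹ * w * hy - v * (w * dy v) * hhalf - v * hw +
      w * y * hhalf - algebraMap ℝ AGerm 2⁻¹ * algebraMap ℝ AGerm (ε * k) * w * dy u * hs
  have hx2 : (x ^ (k - 1)) ^ 2 = x ^ k * x ^ (k - 2) := by
    rw [← pow_mul, ← pow_add]
    congr 1
    omega
  obtain ⟨q, hq⟩ : y ∣ x ^ (k - 2) * (B * a ^ (k - 1)) ^ 2 + algebraMap ℝ AGerm ε * a ^ k -
      algebraMap ℝ AGerm ε := by
    refine y_dvd_of_x_pow_mul (m := k) ⟨y - algebraMap ℝ AGerm ε * s' -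
      (2 * (x ^ (k - 1) * (B * a ^ (k - 1))) * (w + B * s) + y * (w + B * s) ^ 2), ?_⟩
    rw [hs', hamiltonian, hv'] at h
    linear_combination h - (B * a ^ (k - 1)) ^ 2 * hx2
  have h3 := congrArg eval hq
  simp only [map_add, map_sub, map_mul, map_pow, eval_x, eval_y, AlgHom.commutes,
    Algebra.algebraMap_self_apply, zero_mul] at h3
  rw [zero_pow (by omega), zero_mul, zero_add] at h3
  rw [ha]
  refine mul_left_cancel₀ hε ?_
  linear_combination h3

/-- The possible linear parts of a symmetry of the Hamiltonian. -/
theorem symmetry_linear_part (h : v ^ 2 + algebraMap ℝ AGerm ε * u ^ k = hamiltonian k ε)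
    (hk : 2 ≤ k) (hε : ε ≠ 0) (hu : eval u = 0) (hv : eval v = 0) :
    eval (jacobian u v) ^ 2 = 1 ∧ (3 ≤ k → eval (dx u) ^ k = 1) := by
  obtain ⟨h1, h2, h3⟩ := eval_second_derivatives h hk hu hv
  have hJ' : eval (jacobian u v) = eval (dx u) * eval (dy v) - eval (dy u) * eval (dx v) := by
    simp [jacobian]
  rcases hk.eq_or_lt with rfl | hk'
  · refine ⟨?_, fun h => by omega⟩
    rw [hJ']
    norm_num at h1 h2 h3
    generalize eval (dx u) = p at *
    generalize eval (dy u) = q at *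
    generalize eval (dx v) = r at *
    generalize eval (dy v) = s at *
    -- The three equations say AᵀSA = S with S = diag(ε, 1); the combination below takes
    -- determinants.
    refine mul_left_cancel₀ hε ?_
    linear_combination (s ^ 2 / 2 + ε * q ^ 2 / 2) * h1 + (ε / 2) * h3 -
      (r * s + ε * p * q) * h2 / 2
  · have hz : (0 : ℝ) ^ (k - 2) = 0 := zero_pow (by omega)
    rw [hz] at h1 h3
    have h4 : eval (dx v) = 0 := by
      refine pow_eq_zero_iff two_ne_zero |>.1 ?_
      linear_combination h1 / 2
    have h5 : eval (dy v) ^ 2 = 1 := by linear_combination h3 / 2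
    have h6 : eval (dy v) ≠ 0 := fun h => by norm_num [h] at h5
    have h7 := eval_dx_pow_eq_one h hk' hε hu h6
    refine ⟨?_, fun _ => h7⟩
    have h8 : eval (dx u) ^ 2 = 1 := by
      have : |eval (dx u)| = 1 := by
        refine (pow_eq_one_iff_of_nonneg (abs_nonneg _) (show k ≠ 0 by omega)).1 ?_
        rw [← abs_pow, h7, abs_one]
      rw [← sq_abs, this, one_pow]
    rw [hJ', h4]
    linear_combination eval (dy v) ^ 2 * h8 + h5

end Symmetry

end AGerm

/-! ### Symmetries of the Hamiltonian acting on normal forms -/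

theorem analyticAt_fst_comp {ψ : Plane → Plane} (hψ : AnalyticAt ℝ ψ 0) :
    AnalyticAt ℝ (fun p => (ψ p).1) 0 :=
  AnalyticAt.comp (g := Prod.fst) analyticAt_fst hψ

theorem analyticAt_snd_comp {ψ : Plane → Plane} (hψ : AnalyticAt ℝ ψ 0) :
    AnalyticAt ℝ (fun p => (ψ p).2) 0 :=
  AnalyticAt.comp (g := Prod.snd) analyticAt_snd hψ

theorem analyticAt_jac {ψ : Plane → Plane} (hψ : AnalyticAt ℝ ψ 0) : AnalyticAt ℝ (jac ψ) 0 := by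
  have h : ∀ v : Plane, AnalyticAt ℝ (fun p => fderiv ℝ ψ p v) 0 := fun v =>
    ((ContinuousLinearMap.apply ℝ Plane v).analyticAt _).comp hψ.fderiv
  exact ((analyticAt_fst_comp (h _)).mul (analyticAt_snd_comp (h _))).sub
    ((analyticAt_fst_comp (h _)).mul (analyticAt_snd_comp (h _)))

theorem jac_eq_fderiv {ψ : Plane → Plane} {p : Plane} (hψ : DifferentiableAt ℝ ψ p) :
    jac ψ p = fderiv ℝ (fun p => (ψ p).1) p (1, 0) * fderiv ℝ (fun p => (ψ p).2) p (0, 1) -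
      fderiv ℝ (fun p => (ψ p).1) p (0, 1) * fderiv ℝ (fun p => (ψ p).2) p (1, 0) := by
  rw [hψ.hasFDerivAt.fst.fderiv, hψ.hasFDerivAt.snd.fderiv, jac]
  rfl

theorem AGerm.jacobian_mk {ψ : Plane → Plane} (hψ : AnalyticAt ℝ ψ 0) :
    AGerm.jacobian (AGerm.mk _ (analyticAt_fst_comp hψ)) (AGerm.mk _ (analyticAt_snd_comp hψ)) =
      AGerm.mk (jac ψ) (analyticAt_jac hψ) := by
  have h : ∀ a b : AGerm, a - b = a + algebraMap ℝ AGerm (-1) * b := fun a b => by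
    rw [map_neg, map_one]
    ring
  rw [AGerm.jacobian, AGerm.dx, AGerm.dy, AGerm.dirDeriv_mk, AGerm.dirDeriv_mk, AGerm.dirDeriv_mk,
    AGerm.dirDeriv_mk, h, AGerm.algebraMap_eq, AGerm.mk_mul, AGerm.mk_mul, AGerm.mk_mul,
    AGerm.mk_add, AGerm.mk_eq_iff]
  filter_upwards [hψ.eventually_analyticAt] with p hp
  rw [jac_eq_fderiv hp.differentiableAt]
  ring

theorem density_normalForm (k : ℕ) (ε : ℝ) (c : ℕ → ℝ → ℝ) :
    density (normalForm k ε c) =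
      fun p => ∑ i ∈ Finset.range (k - 1), p.1 ^ i * c i (modelH k ε p) :=
  density_smul _

/-- Two normal forms with the same germs of coefficients have the same germ. -/
theorem normalForm_congr {k : ℕ} (hk : 1 ≤ k) (ε : ℝ) {c d : ℕ → ℝ → ℝ}
    (h : ∀ i < k - 1, c i =ᶠ[𝓝 0] d i) : normalForm k ε c =ᶠ[𝓝 0] normalForm k ε d := by
  have h1 : ∀ᶠ t in 𝓝 (0 : ℝ), ∀ i ∈ Finset.range (k - 1), c i t = d i t :=
    (Finset.eventually_all _).2 fun i hi => h i (Finset.mem_range.1 hi)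
  filter_upwards [(tendsto_modelH hk ε).eventually h1] with p hp
  rw [normalForm, normalForm, Finset.sum_congr rfl fun i hi => by rw [hp i hi]]

theorem eventuallyEq_of_symmetry {k : ℕ} (hk : 1 ≤ k) {ε : ℝ} (hε : ε ≠ 0) {ψ : Plane → Plane}
    (hψ : AnalyticAt ℝ ψ 0) (hψ0 : ψ 0 = 0) (hH : (modelH k ε ∘ ψ) =ᶠ[𝓝 0] modelH k ε)
    {c d : ℕ → ℝ → ℝ} (hc : ∀ i, AnalyticAt ℝ (c i) 0) (hd : ∀ i, AnalyticAt ℝ (d i) 0)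
    (hω : pullback ψ (normalForm k ε c) =ᶠ[𝓝 0] normalForm k ε d) {i : ℕ} (hi : i < k - 1) :
    d i =ᶠ[𝓝 0] fun t => fderiv ℝ (fun p => (ψ p).1) 0 (1, 0) ^ i * jac ψ 0 * c i t := by
  have h1 := analyticAt_fst_comp hψ
  have h2 := analyticAt_snd_comp hψ
  have h := AGerm.eventuallyEq_of_sum_ofH_eq (k := k) (u := AGerm.mk _ h1) (v := AGerm.mk _ h2)
    hk hε ?_ ?_ hc hd ?_ hi
  · rwa [AGerm.jacobian_mk hψ, AGerm.eval_mk, AGerm.dx, AGerm.dirDeriv_mk, AGerm.eval_mk] at h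
  · rw [AGerm.mk_pow, AGerm.mk_pow, AGerm.algebraMap_eq, AGerm.mk_mul, AGerm.mk_add,
      AGerm.hamiltonian_eq, AGerm.mk_eq_iff]
    exact hH
  · rw [AGerm.eval_mk, hψ0]
    rfl
  · have hj := analyticAt_jac hψ
    have hpc : ∀ i, AnalyticAt ℝ (fun p => c i (modelH k ε p) * ((ψ p).1 ^ i * jac ψ p)) 0 :=
      fun i => (AGerm.analyticAt_comp_modelH hk ε (hc i)).mul ((h1.pow i).mul hj)
    have hpd : ∀ i, AnalyticAt ℝ (fun p : Plane => d i (modelH k ε p) * p.1 ^ i) 0 :=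
      fun i => (AGerm.analyticAt_comp_modelH hk ε (hd i)).mul (analyticAt_fst.pow i)
    rw [AGerm.jacobian_mk hψ]
    simp only [AGerm.x, AGerm.ofH, AGerm.mk_pow, AGerm.mk_mul]
    rw [← AGerm.mk_sum _ _ hpc (Finset.analyticAt_fun_sum _ fun i _ => hpc i),
      ← AGerm.mk_sum _ _ hpd (Finset.analyticAt_fun_sum _ fun i _ => hpd i), AGerm.mk_eq_iff]
    filter_upwards [density_congr hω, hH] with p h3 h4
    rw [density_pullback, density_normalForm, density_normalForm] at h3
    simp only [Function.comp_apply] at h4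
    simp only [h4] at h3
    rw [Finset.sum_mul] at h3
    convert h3 using 2 <;> ring

theorem symmetry_jac_and_linear_part {k : ℕ} (hk : 2 ≤ k) {ε : ℝ} (hε : ε ≠ 0)
    {ψ : Plane → Plane} (hψ : AnalyticAt ℝ ψ 0) (hψ0 : ψ 0 = 0)
    (hH : (modelH k ε ∘ ψ) =ᶠ[𝓝 0] modelH k ε) :
    jac ψ 0 ^ 2 = 1 ∧ (3 ≤ k → fderiv ℝ (fun p => (ψ p).1) 0 (1, 0) ^ k = 1) := by
  have h1 := analyticAt_fst_comp hψ
  have h2 := analyticAt_snd_comp hψ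
  have h := AGerm.symmetry_linear_part (k := k) (ε := ε) (u := AGerm.mk _ h1) (v := AGerm.mk _ h2)
    ?_ hk hε ?_ ?_
  · rwa [AGerm.jacobian_mk hψ, AGerm.eval_mk, AGerm.dx, AGerm.dirDeriv_mk, AGerm.eval_mk] at h
  · rw [AGerm.mk_pow, AGerm.mk_pow, AGerm.algebraMap_eq, AGerm.mk_mul, AGerm.mk_add,
      AGerm.hamiltonian_eq, AGerm.mk_eq_iff]
    exact hH
  · rw [AGerm.eval_mk, hψ0]
    rfl
  · rw [AGerm.eval_mk, hψ0]
    rfl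

/-- Normal forms related by a symmetry of the Hamiltonian have the same invariants, up to the sign
given by the orientation. -/
theorem sameInvariants_of_symmetry {k : ℕ} (hk : 2 ≤ k) {ε : ℝ} (hε : ε ≠ 0) {ψ : Plane → Plane}
    (hψ : AnalyticAt ℝ ψ 0) (hψ0 : ψ 0 = 0) (hH : (modelH k ε ∘ ψ) =ᶠ[𝓝 0] modelH k ε)
    {c d : ℕ → ℝ → ℝ} (hc : ∀ i < k - 1, AnalyticAt ℝ (c i) 0)
    (hd : ∀ i < k - 1, AnalyticAt ℝ (d i) 0)
    (hω : pullback ψ (normalForm k ε c) =ᶠ[𝓝 0] normalForm k ε d) :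
    SameInvariants k (fun i h => jac ψ 0 * c i h) d := by
  -- Indices i ≥ k − 1 do not enter the form; zero there makes every entry analytic, as
  -- `eventuallyEq_of_symmetry` requires.
  let c' : ℕ → ℝ → ℝ := fun i t => if i < k - 1 then c i t else 0
  let d' : ℕ → ℝ → ℝ := fun i t => if i < k - 1 then d i t else 0
  have hc' : ∀ i < k - 1, c' i = c i := fun i hi => funext fun t => if_pos hi
  have hd' : ∀ i < k - 1, d' i = d i := fun i hi => funext fun t => if_pos hi
  have hext : ∀ (c c' : ℕ → ℝ → ℝ), (∀ i < k - 1, AnalyticAt ℝ (c i) 0) →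
      (c' = fun i t => if i < k - 1 then c i t else 0) → ∀ i, AnalyticAt ℝ (c' i) 0 := by
    rintro c _ hc rfl i
    by_cases hi : i < k - 1
    · simpa only [if_pos hi] using hc i hi
    · simpa only [if_neg hi] using analyticAt_const
  have hnf : ∀ {c c' : ℕ → ℝ → ℝ}, (∀ i < k - 1, c' i = c i) →
      normalForm k ε c' = normalForm k ε c := fun {c c'} h => by
    ext1 p
    rw [normalForm, normalForm, Finset.sum_congr rfl fun i hi => by rw [h i (Finset.mem_range.1 hi)]]
  rw [← hnf hc', ← hnf hd'] at hω
  have key : ∀ i < k - 1, d i =ᶠ[𝓝 0] fun t =>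
      fderiv ℝ (fun p => (ψ p).1) 0 (1, 0) ^ i * jac ψ 0 * c i t := fun i hi => by
    have := eventuallyEq_of_symmetry (by omega) hε hψ hψ0 hH (hext c c' hc rfl) (hext d d' hd rfl)
      hω hi
    rwa [hc' i hi, hd' i hi] at this
  obtain ⟨-, h2⟩ := symmetry_jac_and_linear_part hk hε hψ hψ0 hH
  generalize fderiv ℝ (fun p => (ψ p).1) 0 (1, 0) = a at *
  generalize jac ψ 0 = D at *
  have h1 : a = 1 → SameInvariants k (fun i h => D * c i h) d := fun ha => Or.inl fun i hi => by
    simpa [ha] using key i hi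
  rcases hk.eq_or_lt with rfl | hk'
  -- For k = 2 the number a is unconstrained, but only i = 0 occurs and a^0 = 1.
  · refine Or.inl fun i hi => ?_
    obtain rfl : i = 0 := by omega
    simpa using key 0 hi
  · rcases Nat.even_or_odd k with hk2 | hk2
    · rcases (pow_eq_one_iff_cases).1 (h2 hk') with h | h | h
      · omega
      · exact h1 h
      · refine Or.inr ⟨hk2, fun i hi => ?_⟩
        simpa [h.1, mul_assoc] using key i hi
    · rcases (pow_eq_one_iff_cases).1 (h2 hk') with h | h | h
      · omega
      · exact h1 h
      · exact absurd h.2 (Nat.not_even_iff_odd.2 hk2)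

/-! ### Equivalence of pairs -/

/-- In terms of densities, functoriality of the pull-back is multiplicativity of the Jacobian. -/
theorem density_pullback_comp {ψ φ : Plane → Plane} (hψ : AnalyticAt ℝ ψ 0) (hφ : IsDiffeoGerm φ)
    {ω₀ ω₁ : TwoForm} (h : pullback ψ ω₀ =ᶠ[𝓝 0] ω₁) :
    density (pullback (ψ ∘ φ) ω₀) =ᶠ[𝓝 0] density (pullback φ ω₁) := by
  filter_upwards [hφ.tendsto.eventually hψ.eventually_analyticAt,
    hφ.analyticAt.eventually_analyticAt, hφ.tendsto.eventually (density_congr h)] with p h1 h2 h3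
  rw [density_pullback, density_pullback, jac_comp h1.differentiableAt h2.differentiableAt, ← h3,
    density_pullback]
  simp only [Function.comp_apply]
  ring

theorem transport_comp {ψ φ : Plane → Plane} (hψ : IsDiffeoGerm ψ) (hφ : IsDiffeoGerm φ)
    {H₀ H₁ H₂ : Plane → ℝ} {ω₀ ω₁ ω₂ : TwoForm} (h₀ : (H₀ ∘ ψ) =ᶠ[𝓝 0] H₁)
    (h₀' : pullback ψ ω₀ =ᶠ[𝓝 0] ω₁) (h₁ : (H₁ ∘ φ) =ᶠ[𝓝 0] H₂)
    (h₁' : pullback φ ω₁ =ᶠ[𝓝 0] ω₂) :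
    (H₀ ∘ (ψ ∘ φ)) =ᶠ[𝓝 0] H₂ ∧ pullback (ψ ∘ φ) ω₀ =ᶠ[𝓝 0] ω₂ :=
  ⟨EventuallyEq.trans (hφ.tendsto.eventually h₀) h₁, eventuallyEq_of_density
    ((density_pullback_comp hψ.analyticAt hφ h₀').trans (density_congr h₁'))⟩

theorem transport_inverse {ψ φ : Plane → Plane} (hψ : IsDiffeoGerm ψ) (hφ : IsDiffeoGerm φ)
    (hψφ : ∀ᶠ p in 𝓝 (0 : Plane), ψ (φ p) = p)
    {H₀ H₁ : Plane → ℝ} {ω₀ ω₁ : TwoForm} (h : (H₀ ∘ ψ) =ᶠ[𝓝 0] H₁)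
    (h' : pullback ψ ω₀ =ᶠ[𝓝 0] ω₁) :
    (H₁ ∘ φ) =ᶠ[𝓝 0] H₀ ∧ pullback φ ω₁ =ᶠ[𝓝 0] ω₀ := by
  constructor
  · filter_upwards [hφ.tendsto.eventually h, hψφ] with p h1 h2
    rw [Function.comp_apply, ← h1, Function.comp_apply, h2]
  · refine eventuallyEq_of_density ((density_pullback_comp hψ.analyticAt hφ h').symm.trans ?_)
    filter_upwards [hψφ.eventually_nhds] with p h1
    rw [density_pullback, jac_congr (ψ := ψ ∘ φ) (φ := fun p => p) h1, jac_id, mul_one, Function.comp_apply,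
      h1.self_of_nhds]

theorem jac_comp_zero {ψ φ : Plane → Plane} (hψ : IsDiffeoGerm ψ) (hφ : IsDiffeoGerm φ) :
    jac (ψ ∘ φ) 0 = jac ψ 0 * jac φ 0 := by
  rw [jac_comp (by rw [hφ.map_zero]; exact hψ.analyticAt.differentiableAt)
    hφ.analyticAt.differentiableAt, hφ.map_zero]

section Relations

variable {H₀ H₁ H₂ : Plane → ℝ} {ω₀ ω₁ ω₂ : TwoForm}

theorem OrientedEquivalent.equivalent (h : OrientedEquivalent H₀ ω₀ H₁ ω₁) :
    Equivalent H₀ ω₀ H₁ ω₁ := by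
  obtain ⟨ψ, h1, -, h2⟩ := h
  exact ⟨ψ, h1, h2⟩

theorem Equivalent.trans (h₀ : Equivalent H₀ ω₀ H₁ ω₁) (h₁ : Equivalent H₁ ω₁ H₂ ω₂) :
    Equivalent H₀ ω₀ H₂ ω₂ := by
  obtain ⟨ψ, h1, h2, h3⟩ := h₀
  obtain ⟨φ, h4, h5, h6⟩ := h₁
  exact ⟨ψ ∘ φ, h1.comp h4, transport_comp h1 h4 h2 h3 h5 h6⟩

theorem Equivalent.symm (h : Equivalent H₀ ω₀ H₁ ω₁) : Equivalent H₁ ω₁ H₀ ω₀ := by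
  obtain ⟨ψ, h1, h2, h3⟩ := h
  obtain ⟨φ, h4, -, h5, -⟩ := h1.exists_inverse
  exact ⟨φ, h4, transport_inverse h1 h4 h5 h2 h3⟩

theorem OrientedEquivalent.trans (h₀ : OrientedEquivalent H₀ ω₀ H₁ ω₁)
    (h₁ : OrientedEquivalent H₁ ω₁ H₂ ω₂) : OrientedEquivalent H₀ ω₀ H₂ ω₂ := by
  obtain ⟨ψ, h1, ho, h2, h3⟩ := h₀
  obtain ⟨φ, h4, ho', h5, h6⟩ := h₁
  refine ⟨ψ ∘ φ, h1.comp h4, ?_, transport_comp h1 h4 h2 h3 h5 h6⟩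
  rw [preservesOrientation_iff] at *
  rw [jac_comp_zero h1 h4]
  exact mul_pos ho ho'

theorem OrientedEquivalent.symm (h : OrientedEquivalent H₀ ω₀ H₁ ω₁) :
    OrientedEquivalent H₁ ω₁ H₀ ω₀ := by
  obtain ⟨ψ, h1, ho, h2, h3⟩ := h
  obtain ⟨φ, h4, -, h5, h6⟩ := h1.exists_inverse
  refine ⟨φ, h4, ?_, transport_inverse h1 h4 h5 h2 h3⟩
  rw [preservesOrientation_iff] at *
  exact (pos_iff_pos_of_mul_pos (h6 ▸ one_pos)).1 ho

end Relations

theorem orientedEquivalent_of_eventuallyEq (H : Plane → ℝ) {ω₀ ω₁ : TwoForm}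
    (h : ω₀ =ᶠ[𝓝 0] ω₁) : OrientedEquivalent H ω₀ H ω₁ := by
  have hj : jac (fun p => p) 0 = 1 := jac_id 0
  refine ⟨fun p => p, isDiffeoGerm_of_jac_ne_zero analyticAt_id rfl (by rw [hj]; norm_num),
    preservesOrientation_iff.2 (by rw [hj]; norm_num), EventuallyEq.rfl, ?_⟩
  refine eventuallyEq_of_density (EventuallyEq.trans ?_ (density_congr h))
  exact Eventually.of_forall fun p => by rw [density_pullback, jac_id, mul_one]

/-! ### The linear symmetries of the Hamiltonian -/

theorem hasFDerivAt_linear (a b : ℝ) (p : Plane) :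
    HasFDerivAt (fun p : Plane => (a * p.1, b * p.2))
      ((a • ContinuousLinearMap.fst ℝ ℝ ℝ).prod (b • ContinuousLinearMap.snd ℝ ℝ ℝ)) p :=
  (hasFDerivAt_fst.const_mul a).prodMk (hasFDerivAt_snd.const_mul b)

theorem jac_linear (a b : ℝ) (p : Plane) : jac (fun p : Plane => (a * p.1, b * p.2)) p = a * b := by
  rw [jac, (hasFDerivAt_linear a b p).fderiv]
  simp

theorem isDiffeoGerm_linear {a b : ℝ} (h : a * b ≠ 0) :
    IsDiffeoGerm fun p : Plane => (a * p.1, b * p.2) :=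
  isDiffeoGerm_of_jac_ne_zero ((analyticAt_const.mul analyticAt_fst).prod
    (analyticAt_const.mul analyticAt_snd)) (by simp) (by rwa [jac_linear])

theorem modelH_linear {k : ℕ} (ε : ℝ) {a b : ℝ} (ha : a ^ k = 1) (hb : b ^ 2 = 1) (p : Plane) :
    modelH k ε (a * p.1, b * p.2) = modelH k ε p := by
  simp only [modelH, mul_pow, ha, hb, one_mul]

theorem pullback_linear_normalForm {k : ℕ} (ε : ℝ) {a b : ℝ} (ha : a ^ k = 1) (hb : b ^ 2 = 1)
    (c : ℕ → ℝ → ℝ) :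
    pullback (fun p : Plane => (a * p.1, b * p.2)) (normalForm k ε c) =ᶠ[𝓝 0]
      normalForm k ε fun i h => a * b * (a ^ i * c i h) := by
  refine eventuallyEq_of_density (Eventually.of_forall fun p => ?_)
  rw [density_pullback, jac_linear, density_normalForm, density_normalForm]
  simp only [modelH_linear ε ha hb, Finset.sum_mul, mul_pow]
  exact Finset.sum_congr rfl fun i _ => by ring

theorem equivalent_neg_normalForm (k : ℕ) (ε : ℝ) (c : ℕ → ℝ → ℝ) :
    Equivalent (modelH k ε) (normalForm k ε c) (modelH k ε) (normalForm k ε fun i h => -c i h) := by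
  refine ⟨fun p => (1 * p.1, -1 * p.2), isDiffeoGerm_linear (by norm_num),
    Eventually.of_forall (modelH_linear ε (one_pow k) (by norm_num)), ?_⟩
  have := pullback_linear_normalForm (k := k) ε (one_pow k) (show (-1 : ℝ) ^ 2 = 1 by norm_num) c
  simpa using this

theorem SameInvariants.orientedEquivalent {k : ℕ} (hk : 1 ≤ k) (ε : ℝ) {c d : ℕ → ℝ → ℝ}
    (h : SameInvariants k c d) :
    OrientedEquivalent (modelH k ε) (normalForm k ε c) (modelH k ε) (normalForm k ε d) := by
  rcases h with h | ⟨hk2, h⟩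
  · exact orientedEquivalent_of_eventuallyEq _ (normalForm_congr hk ε fun i hi => (h i hi).symm)
  · refine OrientedEquivalent.trans (ω₁ := normalForm k ε fun i h => (-1) ^ i * c i h) ?_
      (orientedEquivalent_of_eventuallyEq _ (normalForm_congr hk ε fun i hi => (h i hi).symm))
    refine ⟨fun p => (-1 * p.1, -1 * p.2), isDiffeoGerm_linear (by norm_num),
      preservesOrientation_iff.2 (by rw [jac_linear]; norm_num),
      Eventually.of_forall (modelH_linear ε hk2.neg_one_pow (by norm_num)), ?_⟩
    have := pullback_linear_normalForm (k := k) ε hk2.neg_one_pow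
      (show (-1 : ℝ) ^ 2 = 1 by norm_num) c
    simpa using this

theorem orientedEquivalent_normalForm_iff {k : ℕ} (hk : 2 ≤ k) {ε : ℝ} (hε : ε ≠ 0)
    {c d : ℕ → ℝ → ℝ} (hc : Admissible k c) (hd : Admissible k d) :
    OrientedEquivalent (modelH k ε) (normalForm k ε c) (modelH k ε) (normalForm k ε d) ↔
      SameInvariants k c d := by
  refine ⟨?_, SameInvariants.orientedEquivalent (by omega) ε⟩
  rintro ⟨ψ, hψ, ho, hH, hω⟩
  have h1 := (symmetry_jac_and_linear_part hk hε hψ.analyticAt hψ.map_zero hH).1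
  have h2 := sameInvariants_of_symmetry hk hε hψ.analyticAt hψ.map_zero hH hc.1 hd.1 hω
  rw [preservesOrientation_iff] at ho
  rcases eq_or_eq_neg_of_sq_eq_sq _ 1 (h1.trans (one_pow 2).symm) with h | h
  · simpa [h] using h2
  · linarith

theorem equivalent_normalForm_iff {k : ℕ} (hk : 2 ≤ k) {ε : ℝ} (hε : ε ≠ 0)
    {c d : ℕ → ℝ → ℝ} (hc : Admissible k c) (hd : Admissible k d) :
    Equivalent (modelH k ε) (normalForm k ε c) (modelH k ε) (normalForm k ε d) ↔
      SameInvariants k c d ∨ SameInvariants k (fun i h => -c i h) d := by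
  constructor
  · rintro ⟨ψ, hψ, hH, hω⟩
    have h1 := (symmetry_jac_and_linear_part hk hε hψ.analyticAt hψ.map_zero hH).1
    have h2 := sameInvariants_of_symmetry hk hε hψ.analyticAt hψ.map_zero hH hc.1 hd.1 hω
    rcases eq_or_eq_neg_of_sq_eq_sq _ 1 (h1.trans (one_pow 2).symm) with h | h
    · exact Or.inl (by simpa [h] using h2)
    · exact Or.inr (by simpa [h] using h2)
  · rintro (h | h)
    · exact (h.orientedEquivalent (by omega) ε).equivalent
    · exact (equivalent_neg_normalForm k ε c).trans
        (h.orientedEquivalent (by omega) ε).equivalent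

/-! ### Symplectic forms on the plane -/

/-- Three vectors in the plane are dependent; this makes closedness of a two-form automatic. -/
theorem threeForm_eq_zero (A : Plane [⋀^Fin 3]→L[ℝ] ℝ) : A = 0 := by
  ext v
  refine A.toAlternatingMap.map_linearDependent v fun h => ?_
  have := h.fintype_card_le_finrank
  simp at this

theorem isSymplecticGerm_smul_dXiDx {f : Plane → ℝ} (hf : AnalyticAt ℝ f 0) (hf0 : f 0 ≠ 0) :
    IsSymplecticGerm fun p => f p • dXiDx := by
  -- The witness is v rotated by a right angle, for which dξ∧dx gives v.1² + v.2².
  refine ⟨hf.smul analyticAt_const, Eventually.of_forall fun p => threeForm_eq_zero _,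
    fun v hv => ⟨(v.2, -v.1), ?_⟩⟩
  change f 0 * dXiDx _ ≠ 0
  rw [dXiDx_apply]
  refine mul_ne_zero hf0 fun h => hv ?_
  simp only [Matrix.cons_val_zero, Matrix.cons_val_one] at h
  ext
  · change v.1 = 0
    nlinarith [sq_nonneg v.1, sq_nonneg v.2]
  · change v.2 = 0
    nlinarith [sq_nonneg v.1, sq_nonneg v.2]

theorem IsSymplecticGerm.density_ne_zero {ω : TwoForm} (h : IsSymplecticGerm ω) :
    density ω 0 ≠ 0 := by
  obtain ⟨w, hw⟩ := h.2.2 (1, 0) (by simp)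
  rw [eq_density_smul ω] at hw
  exact left_ne_zero_of_mul hw

theorem sum_zero_pow_mul {k : ℕ} (hk : 2 ≤ k) (ε : ℝ) (c : ℕ → ℝ → ℝ) :
    ∑ i ∈ Finset.range (k - 1), (0 : Plane).1 ^ i * c i (modelH k ε 0) = c 0 0 := by
  rw [modelH_zero (by omega), Finset.sum_eq_single 0]
  · simp
  · intro i _ hi
    simp [hi]
  · intro h
    exact absurd (Finset.mem_range.2 (by omega)) h

theorem Admissible.isASystem {k : ℕ} (hk : 2 ≤ k) (ε : ℝ) {c : ℕ → ℝ → ℝ} (hc : Admissible k c) :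
    IsASystem k ε (modelH k ε) (normalForm k ε c) := by
  refine ⟨analyticAt_modelH k ε 0, ⟨fun p => p, isDiffeoGerm_of_jac_ne_zero analyticAt_id rfl
    (by rw [jac_id]; norm_num), EventuallyEq.rfl⟩, isSymplecticGerm_smul_dXiDx ?_ ?_⟩
  · exact Finset.analyticAt_fun_sum _ fun i hi => (analyticAt_fst.pow i).mul
      (AGerm.analyticAt_comp_modelH (by omega) ε (hc.1 i (Finset.mem_range.1 hi)))
  · rw [sum_zero_pow_mul hk]
    exact hc.2

theorem Admissible.hasNormalForm {k : ℕ} (ε : ℝ) {c : ℕ → ℝ → ℝ} (hc : Admissible k c) :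
    HasNormalForm k ε (modelH k ε) (normalForm k ε c) c :=
  ⟨hc, orientedEquivalent_of_eventuallyEq _ EventuallyEq.rfl⟩

/-- The reflection ξ ↦ −ξ preserves the model Hamiltonian, so composing with it corrects the
orientation. -/
theorem HasASingularity.exists_preservesOrientation {k : ℕ} {ε : ℝ} {H : Plane → ℝ}
    (h : HasASingularity k ε H) :
    ∃ φ : Plane → Plane, IsDiffeoGerm φ ∧ 0 < jac φ 0 ∧ (H ∘ φ) =ᶠ[𝓝 0] modelH k ε := by
  obtain ⟨φ, hφ, hH⟩ := h
  rcases hφ.jac_ne_zero.lt_or_gt with h | h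
  · have hρ : IsDiffeoGerm fun p : Plane => (1 * p.1, -1 * p.2) := isDiffeoGerm_linear (by norm_num)
    refine ⟨_, hφ.comp hρ, ?_, ?_⟩
    · rw [jac_comp_zero hφ hρ, jac_linear]
      linarith
    · exact EventuallyEq.trans (hρ.tendsto.eventually hH)
        (Eventually.of_forall (modelH_linear ε (one_pow k) (by norm_num)))
  · exact ⟨φ, hφ, h, hH⟩

/-- Every system has a normal form. -/
theorem IsASystem.exists_hasNormalForm {k : ℕ} (hk : 2 ≤ k) {ε : ℝ} (hε : ε = 1 ∨ ε = -1)
    {H : Plane → ℝ} {ω : TwoForm} (h : IsASystem k ε H ω) : ∃ c, HasNormalForm k ε H ω c := by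
  obtain ⟨-, hA, hω⟩ := h
  obtain ⟨φ, hφ, hφj, hφH⟩ := hA.exists_preservesOrientation
  let f : Plane → ℝ := fun p => density ω (φ p) * jac φ p
  have hf : AnalyticAt ℝ f 0 := by
    refine AnalyticAt.mul (AnalyticAt.comp (g := density ω) ?_ hφ.analyticAt)
      (analyticAt_jac hφ.analyticAt)
    rw [hφ.map_zero]
    exact analyticAt_density hω.1
  have hf0 : f 0 ≠ 0 := by
    refine mul_ne_zero ?_ hφj.ne'
    rw [hφ.map_zero]
    exact hω.density_ne_zero
  obtain ⟨c, η, hc, hη, hcη⟩ := exists_normal_add_hamD (show 1 ≤ k by omega) hε hf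
  obtain ⟨ψ, hψ, hψj, hψH, hψf⟩ := exists_level_preserving_diffeo hk ε hf hf0 hη
  refine ⟨c, ⟨fun i _ => hc i, ?_⟩, φ ∘ ψ, hφ.comp hψ, ?_, ?_⟩
  · have h0 := hcη.self_of_nhds
    rw [sum_zero_pow_mul hk] at h0
    have h1 : hamD k ε η 0 = 0 := by simp [hamD, show k - 1 ≠ 0 by omega]
    rw [h1, add_zero] at h0
    rwa [← h0]
  · rw [preservesOrientation_iff, jac_comp_zero hφ hψ, hψj, mul_one]
    exact hφj
  · refine transport_comp hφ hψ hφH EventuallyEq.rfl hψH (eventuallyEq_of_density ?_)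
    rw [density_normalForm]
    filter_upwards [hcη, hψf] with p h1 h2
    rw [density_pullback, density_pullback, show density ω (φ (ψ p)) * jac φ (ψ p) = f (ψ p) from rfl,
      h2, h1, add_sub_cancel_right]

end ASing

end

theorem mainTheorem7 (k : ℕ) (hk : 2 ≤ k) (ε : ℝ) (hε : ε = 1 ∨ ε = -1) :
    -- every system has a normal form
    (∀ (H : ASing.Plane → ℝ) (ω : ASing.TwoForm), ASing.IsASystem k ε H ω →
      ∃ c : ℕ → ℝ → ℝ, ASing.HasNormalForm k ε H ω c) ∧
    -- the coefficients are unique, exactly up to the stated sign change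
    (∀ (H : ASing.Plane → ℝ) (ω : ASing.TwoForm), ASing.IsASystem k ε H ω →
      ∀ c d : ℕ → ℝ → ℝ, ASing.HasNormalForm k ε H ω c →
        (ASing.HasNormalForm k ε H ω d ↔ ASing.Admissible k d ∧ ASing.SameInvariants k c d)) ∧
    -- they form a complete set of invariants
    (∀ (H₀ H₁ : ASing.Plane → ℝ) (ω₀ ω₁ : ASing.TwoForm),
      ASing.IsASystem k ε H₀ ω₀ → ASing.IsASystem k ε H₁ ω₁ →
      ∀ c₀ c₁ : ℕ → ℝ → ℝ,
        ASing.HasNormalForm k ε H₀ ω₀ c₀ → ASing.HasNormalForm k ε H₁ ω₁ c₁ →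
        (ASing.OrientedEquivalent H₀ ω₀ H₁ ω₁ ↔ ASing.SameInvariants k c₀ c₁)) ∧
    -- every admissible tuple occurs
    (∀ c : ℕ → ℝ → ℝ, ASing.Admissible k c →
      ASing.IsASystem k ε (ASing.modelH k ε) (ASing.normalForm k ε c) ∧
      ASing.HasNormalForm k ε (ASing.modelH k ε) (ASing.normalForm k ε c) c) ∧
    -- for the full group, including orientation-reversing germs, a global sign is added
    (∀ (H₀ H₁ : ASing.Plane → ℝ) (ω₀ ω₁ : ASing.TwoForm),
      ASing.IsASystem k ε H₀ ω₀ → ASing.IsASystem k ε H₁ ω₁ →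
      ∀ c₀ c₁ : ℕ → ℝ → ℝ,
        ASing.HasNormalForm k ε H₀ ω₀ c₀ → ASing.HasNormalForm k ε H₁ ω₁ c₁ →
        (ASing.Equivalent H₀ ω₀ H₁ ω₁ ↔
          ASing.SameInvariants k c₀ c₁ ∨
          ASing.SameInvariants k (fun i h => -c₀ i h) c₁)) := by
  have hε0 : ε ≠ 0 := by rcases hε with rfl | rfl <;> norm_num
  refine ⟨fun H ω h => h.exists_hasNormalForm hk hε, fun H ω _ c d hc => ?_,
    fun H₀ H₁ ω₀ ω₁ _ _ c₀ c₁ h₀ h₁ => ?_, fun c hc => ⟨hc.isASystem hk ε, hc.hasNormalForm ε⟩,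
    fun H₀ H₁ ω₀ ω₁ _ _ c₀ c₁ h₀ h₁ => ?_⟩
  -- Transitivity through the given normal forms leaves only a comparison of normal forms over the
  -- model Hamiltonian.
  · refine and_congr_right fun hd => ?_
    rw [← ASing.orientedEquivalent_normalForm_iff hk hε0 hc.1 hd]
    exact ⟨hc.2.symm.trans, hc.2.trans⟩
  · rw [← ASing.orientedEquivalent_normalForm_iff hk hε0 h₀.1 h₁.1]
    exact ⟨fun h => (h₀.2.symm.trans h).trans h₁.2, fun h => (h₀.2.trans h).trans h₁.2.symm⟩
  · rw [← ASing.equivalent_normalForm_iff hk hε0 h₀.1 h₁.1]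
    exact ⟨fun h => (h₀.2.equivalent.symm.trans h).trans h₁.2.equivalent,
      fun h => (h₀.2.equivalent.trans h).trans h₁.2.equivalent.symm⟩
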